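/- Let $(V^{n+1},\langle\cdot,\cdot\rangle)$ be a smooth $(n+1)$-dimensional pseudo-Riemannian manifold (Riemannian or Lorentzian, say) with Levi-Civita connection $D$, and let $Q$ be a smooth conformal Killing–Yano two-form on $V$: with $\xi=\mathrm{div}_V Q$, i.e. $\langle\xi,Z\rangle=\sum_{A,B} g^{AB}(D_{A}Q)(E_B,Z)$ in a local frame $(E_A)$ of $TV$, $$(D_XQ)(Y,Z)+(D_YQ)(X,Z)=\frac2n\Big(\langle X,Y\rangle\langle\xi,Z\rangle-\tfrac12\langle X,Z\rangle\langle\xi,Y\rangle-\tfrac12\langle Y,Z\rangle\langle\xi,X\rangle\Big)$$ for all tangent vectors $X,Y,Z$. Let $F:\Sigma^{n-1}\to V$ be a smooth spacelike immersion of a closed oriented manifold, with induced metric $F^*\langle\cdot,\cdot\rangle$, gradient $\nabla$ and Riemannian measure $d\mu$. Assume that the normal bundle is oriented and is locally spanned by positively oriented smooth orthonormal frames $(e_n,e_{n+1})$ with $e_n$ spacelike and $e_{n+1}$ timelike (so $V$ is Lorentzian along $\Sigma$; if $V$ is Lorentzian such local frames always exist). Let $\vec H=\sum_{a=1}^{n-1}(D_{e_a}e_a)^\perp$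 be the mean curvature vector, $(e_a)_{a=1}^{n-1}$ being a local orthonormal frame of $\Sigma$, and assume $\langle\vec H,\vec H\rangle>0$ everywhere on $\Sigma$. Put $$|\vec H|=\langle\vec H,\vec H\rangle^{1/2},\qquad \vec J=\langle\vec H,e_{n+1}\rangle e_n-\langle\vec H,e_n\rangle e_{n+1},\qquad \alpha_{\vec H}(X)=\Big\langle D_X\Big(-\frac{\vec H}{|\vec H|}\Big),\frac{\vec J}{|\vec H|}\Big\rangle\quad(X\in T\Sigma);$$ $\vec J$ does not depend on the choice of the positively oriented frame $(e_n,e_{n+1})$. Then for every smooth function $f:\Sigma\to\mathbb R$ and for each choice of the sign $\pm$ (the same throughout), all the integrands below are integrable and $$\frac{n-1}{n}\int_\Sigma\frac{f}{|\vec H|}\big\langle\xi,\pm\vec H+\vec J\big\rangle\,d\mu+\int_\Sigma\frac{f}{|\vec H|}\,Q(\vec H,\vec J)\,d\mu+\int_\Sigma\frac1{|\vec H|}\,Q\Big(\nabla f\pm f\sum_{a=1}^{n-1}\alpha_{\vec H}(e_a)e_a,\ \pm\vec H+\vec J\Big)\,d\mu=0.$$ -/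

import Mathlib

open Bundle FiberBundle MeasureTheory
open scoped Manifold ContDiff Topology

noncomputable section

/-! ## Linear algebra of a (possibly indefinite) scalar product -/

section LinearAlgebra

variable {ι : Type*} [Fintype ι] [DecidableEq ι]
  {T : Type*} [AddCommGroup T] [Module ℝ T]
  {W : Type*} [AddCommGroup W] [Module ℝ W]

/-- Gram matrix `g_{ij} = g(b_i, b_j)` of a bilinear form in a basis. -/
def gram (b : Module.Basis ι ℝ T) (g : T → T → ℝ) : Matrix ι ι ℝ :=
  Matrix.of fun i j => g (b i) (b j)

/-- Metric trace `∑ g^{ij} B(b_i, b_j)`. For nondegenerate `g` and bilinear `B` it does not depend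
on the basis, and it equals `∑ ε_a B(e_a, e_a)` in a `g`-orthonormal basis with
`g(e_a, e_a) = ε_a = ±1`. -/
def metricTrace (b : Module.Basis ι ℝ T) (g : T → T → ℝ) (B : T → T → W) : W :=
  ∑ i, ∑ j, (gram b g)⁻¹ i j • B (b i) (b j)

/-- The vector `φ^♯ = ∑ g^{ij} φ(b_j) b_i` dual to a linear form: for nondegenerate `g` it is
characterized by `g(φ^♯, v) = φ(v)`. In a `g`-orthonormal basis of a positive definite `g` it is
`∑ φ(e_a) e_a`. -/
def sharp (b : Module.Basis ι ℝ T) (g : T → T → ℝ) (φ : T → ℝ) : T :=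
  ∑ i, ∑ j, ((gram b g)⁻¹ i j * φ (b j)) • b i

end LinearAlgebra

/-- The standard basis of a tangent space of a `k`-dimensional manifold. -/
def tangentBasis {k : ℕ} {M : Type*} [TopologicalSpace M]
    [ChartedSpace (EuclideanSpace ℝ (Fin k)) M] (x : M) :
    Module.Basis (Fin k) ℝ (TangentSpace (𝓡 k) x) :=
  (EuclideanSpace.basisFun (Fin k) ℝ).toBasis

/-! ## The ambient manifold -/

section Ambient

variable {k : ℕ} {V : Type*} [TopologicalSpace V] [ChartedSpace (EuclideanSpace ℝ (Fin k)) V]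
  [IsManifold (𝓡 k) ∞ V]

/-- A smooth pseudo-Riemannian metric (of arbitrary signature: Riemannian and Lorentzian metrics
are both included). -/
structure PseudoRiemannianMetric (k : ℕ) (V : Type*) [TopologicalSpace V]
    [ChartedSpace (EuclideanSpace ℝ (Fin k)) V] [IsManifold (𝓡 k) ∞ V] where
  inner (x : V) : TangentSpace (𝓡 k) x →L[ℝ] TangentSpace (𝓡 k) x →L[ℝ] ℝ
  symm (x : V) (v w : TangentSpace (𝓡 k) x) : inner x v w = inner x w v
  nondegenerate (x : V) (v : TangentSpace (𝓡 k) x) : (∀ w, inner x v w = 0) → v = 0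
  contMDiff : ContMDiff (𝓡 k) ((𝓡 k).prod 𝓘(ℝ, EuclideanSpace ℝ (Fin k) →L[ℝ]
      EuclideanSpace ℝ (Fin k) →L[ℝ] ℝ)) ∞
    (fun x => TotalSpace.mk' (EuclideanSpace ℝ (Fin k) →L[ℝ] EuclideanSpace ℝ (Fin k) →L[ℝ] ℝ)
      (E := fun x : V => TangentSpace (𝓡 k) x →L[ℝ] TangentSpace (𝓡 k) x →L[ℝ] ℝ) x (inner x))

/-- A smooth two-form (a smooth section of alternating bilinear forms on the tangent bundle). -/
structure TwoForm (k : ℕ) (V : Type*) [TopologicalSpace V]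
    [ChartedSpace (EuclideanSpace ℝ (Fin k)) V] [IsManifold (𝓡 k) ∞ V] where
  form (x : V) : TangentSpace (𝓡 k) x →L[ℝ] TangentSpace (𝓡 k) x →L[ℝ] ℝ
  alternating (x : V) (v : TangentSpace (𝓡 k) x) : form x v v = 0
  contMDiff : ContMDiff (𝓡 k) ((𝓡 k).prod 𝓘(ℝ, EuclideanSpace ℝ (Fin k) →L[ℝ]
      EuclideanSpace ℝ (Fin k) →L[ℝ] ℝ)) ∞
    (fun x => TotalSpace.mk' (EuclideanSpace ℝ (Fin k) →L[ℝ] EuclideanSpace ℝ (Fin k) →L[ℝ] ℝ)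
      (E := fun x : V => TangentSpace (𝓡 k) x →L[ℝ] TangentSpace (𝓡 k) x →L[ℝ] ℝ) x (form x))

/-- Differentiability at `x` of a vector field. -/
def VectorFieldDiffAt (X : Π x : V, TangentSpace (𝓡 k) x) (x : V) : Prop :=
  MDifferentiableAt (𝓡 k) ((𝓡 k).prod 𝓘(ℝ, EuclideanSpace ℝ (Fin k)))
    (fun y => TotalSpace.mk' (EuclideanSpace ℝ (Fin k))
      (E := (TangentSpace (𝓡 k) : V → Type _)) y (X y)) x

/-- `D` is the Levi-Civita connection of `g`: it is torsion free, `D_X Y - D_Y X = [X, Y]`, and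
metric, `X g(Y, Z) = g(D_X Y, Z) + g(Y, D_X Z)`. In Mathlib's convention `D Y x v` is `D_v Y` at
`x`. -/
structure IsLeviCivita (g : PseudoRiemannianMetric k V)
    (D : CovariantDerivative (𝓡 k) (EuclideanSpace ℝ (Fin k))
      (TangentSpace (𝓡 k) : V → Type _)) : Prop where
  torsion_free : ∀ (X Y : Π x : V, TangentSpace (𝓡 k) x) (x : V),
    VectorFieldDiffAt X x → VectorFieldDiffAt Y x →
      D Y x (X x) - D X x (Y x) = VectorField.mlieBracket (𝓡 k) X Y x
  metric : ∀ (Y Z : Π x : V, TangentSpace (𝓡 k) x) (x : V),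
    VectorFieldDiffAt Y x → VectorFieldDiffAt Z x → ∀ v : TangentSpace (𝓡 k) x,
      mvfderiv (𝓡 k) (fun y => g.inner y (Y y) (Z y)) x v =
        g.inner x (D Y x v) (Z x) + g.inner x (Y x) (D Z x v)

/-- Covariant derivative of a two-form, `(D_u Q)(v, w) = u(Q(Y, Z)) - Q(D_u Y, w) - Q(v, D_u Z)`,
where `Y`, `Z` are local vector fields extending `v`, `w` (here those with constant coefficients in
a chart; by tensoriality the choice is immaterial). -/
def TwoForm.covDeriv (Q : TwoForm k V)
    (D : CovariantDerivative (𝓡 k) (EuclideanSpace ℝ (Fin k))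
      (TangentSpace (𝓡 k) : V → Type _)) (x : V) (u v w : TangentSpace (𝓡 k) x) : ℝ :=
  mvfderiv (𝓡 k) (fun y => Q.form y (extend (EuclideanSpace ℝ (Fin k)) v y)
      (extend (EuclideanSpace ℝ (Fin k)) w y)) x u
    - Q.form x (D (extend (EuclideanSpace ℝ (Fin k)) v) x u) w
    - Q.form x v (D (extend (EuclideanSpace ℝ (Fin k)) w) x u)

/-- The vector field `ξ = div Q`: `⟨ξ, Z⟩ = ∑ g^{AB} (D_A Q)(B, Z)`. -/
def TwoForm.divergence (Q : TwoForm k V) (g : PseudoRiemannianMetric k V)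
    (D : CovariantDerivative (𝓡 k) (EuclideanSpace ℝ (Fin k))
      (TangentSpace (𝓡 k) : V → Type _)) (x : V) : TangentSpace (𝓡 k) x :=
  sharp (tangentBasis x) (fun v w => g.inner x v w) fun z =>
    metricTrace (tangentBasis x) (fun v w => g.inner x v w) fun u v => Q.covDeriv D x u v z

/-- Conformal Killing-Yano two-forms on a manifold of dimension `k = n + 1`. -/
def TwoForm.IsConformalKillingYano (Q : TwoForm k V) (g : PseudoRiemannianMetric k V)
    (D : CovariantDerivative (𝓡 k) (EuclideanSpace ℝ (Fin k))
      (TangentSpace (𝓡 k) : V → Type _)) : Prop :=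
  ∀ (x : V) (X Y Z : TangentSpace (𝓡 k) x),
    Q.covDeriv D x X Y Z + Q.covDeriv D x Y X Z =
      (2 / ((k : ℝ) - 1)) * (g.inner x X Y * g.inner x (Q.divergence g D x) Z
        - (1 / 2) * (g.inner x X Z * g.inner x (Q.divergence g D x) Y)
        - (1 / 2) * (g.inner x Y Z * g.inner x (Q.divergence g D x) X))

end Ambient

/-! ## Riemannian volume -/

section Volume

variable {m : ℕ} {S : Type*} [TopologicalSpace S] [ChartedSpace (EuclideanSpace ℝ (Fin m)) S]
  [MeasurableSpace S]

/-- The measure `√(det h_{ij}) dy¹ ⋯ dyᵐ` of the chart at `c`, transported to `S`; it is carried by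
the domain of that chart. -/
def chartVolume (h : Π p : S, TangentSpace (𝓡 m) p → TangentSpace (𝓡 m) p → ℝ) (c : S) :
    Measure S :=
  (((volume : Measure (EuclideanSpace ℝ (Fin m))).restrict
      (extChartAt (𝓡 m) c).target).withDensity fun y =>
        ENNReal.ofReal (Real.sqrt (Matrix.det (Matrix.of fun i j : Fin m =>
          h ((extChartAt (𝓡 m) c).symm y)
            (mfderiv 𝓘(ℝ, EuclideanSpace ℝ (Fin m)) (𝓡 m) (extChartAt (𝓡 m) c).symm y
              (EuclideanSpace.basisFun (Fin m) ℝ i))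
            (mfderiv 𝓘(ℝ, EuclideanSpace ℝ (Fin m)) (𝓡 m) (extChartAt (𝓡 m) c).symm y
              (EuclideanSpace.basisFun (Fin m) ℝ j)))))).map (extChartAt (𝓡 m) c).symm

/-- The Riemannian measure of the metric `h`: the least measure dominating all the chart measures.
Since chart measures agree on overlaps, it coincides with `chartVolume h c` on the domain of the
chart at `c`. -/
def riemannianVolume (h : Π p : S, TangentSpace (𝓡 m) p → TangentSpace (𝓡 m) p → ℝ) :
    Measure S :=
  ⨆ c : S, chartVolume h c

end Volume

/-! ## Immersed submanifolds -/

section Submanifold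

variable {m k : ℕ} {S : Type*} [TopologicalSpace S] [ChartedSpace (EuclideanSpace ℝ (Fin m)) S]
  [IsManifold (𝓡 m) ∞ S]
  {V : Type*} [TopologicalSpace V] [ChartedSpace (EuclideanSpace ℝ (Fin k)) V]
  [IsManifold (𝓡 k) ∞ V]

/-- Smoothness on `U` of a vector field along `F`, i.e. of a section of `F^* TV`. -/
def SmoothAlongOn (F : S → V) (U : Set S) (N : Π p : S, TangentSpace (𝓡 k) (F p)) : Prop :=
  ContMDiffOn (𝓡 m) ((𝓡 k).prod 𝓘(ℝ, EuclideanSpace ℝ (Fin k))) ∞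
    (fun p => TotalSpace.mk' (EuclideanSpace ℝ (Fin k))
      (E := (TangentSpace (𝓡 k) : V → Type _)) (F p) (N p)) U

/-- The induced (pulled back) symmetric form `h = F^* g`. -/
def inducedMetric (g : PseudoRiemannianMetric k V) (F : S → V) (p : S)
    (u v : TangentSpace (𝓡 m) p) : ℝ :=
  g.inner (F p) (mfderiv (𝓡 m) (𝓡 k) F p u) (mfderiv (𝓡 m) (𝓡 k) F p v)

/-- A smooth spacelike immersion: a smooth map whose induced form `F^* g` is positive definite (in
particular its differential is injective everywhere). -/
structure IsSpacelikeImmersion (g : PseudoRiemannianMetric k V) (F : S → V) : Prop where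
  contMDiff : ContMDiff (𝓡 m) (𝓡 k) ∞ F
  pos : ∀ (p : S) (v : TangentSpace (𝓡 m) p), v ≠ 0 → 0 < inducedMetric g F p v v

/-- The covariant derivative `D_v N` at `p` of a vector field `N` along `F` (the pulled back
connection). Writing `N(q) = ∑ N^i(q) E_i(F(q))` near `p`, with `E_i` the coordinate frame of `V`
around `F p`, it is `∑ dN^i(v) E_i + ∑ N^i(p) D_{dF(v)} E_i`. -/
def covAlong (D : CovariantDerivative (𝓡 k) (EuclideanSpace ℝ (Fin k))
      (TangentSpace (𝓡 k) : V → Type _)) (F : S → V)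
    (N : Π p : S, TangentSpace (𝓡 k) (F p)) (p : S) :
    TangentSpace (𝓡 m) p →L[ℝ] TangentSpace (𝓡 k) (F p) :=
  ((trivializationAt (EuclideanSpace ℝ (Fin k)) (TangentSpace (𝓡 k) : V → Type _)
      (F p)).symmL ℝ (F p)).comp
    (mvfderiv (𝓡 m) (fun q => (trivializationAt (EuclideanSpace ℝ (Fin k))
      (TangentSpace (𝓡 k) : V → Type _) (F p)).continuousLinearMapAt ℝ (F q) (N q)) p)
  + (D (extend (EuclideanSpace ℝ (Fin k)) (N p)) (F p)).comp (mfderiv (𝓡 m) (𝓡 k) F p)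

/-- The component of `w` normal to the submanifold. -/
def normalPart (g : PseudoRiemannianMetric k V) (F : S → V) (p : S)
    (w : TangentSpace (𝓡 k) (F p)) : TangentSpace (𝓡 k) (F p) :=
  w - mfderiv (𝓡 m) (𝓡 k) F p (sharp (tangentBasis p) (inducedMetric g F p)
    fun u => g.inner (F p) w (mfderiv (𝓡 m) (𝓡 k) F p u))

/-- The second fundamental form `II(u, v) = (D_u dF(Y))^⊥`, with `Y` a local vector field on the
submanifold extending `v`. -/
def secondFundamentalForm (g : PseudoRiemannianMetric k V)
    (D : CovariantDerivative (𝓡 k) (EuclideanSpace ℝ (Fin k))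
      (TangentSpace (𝓡 k) : V → Type _)) (F : S → V) (p : S)
    (u v : TangentSpace (𝓡 m) p) : TangentSpace (𝓡 k) (F p) :=
  normalPart (m := m) g F p (covAlong D F
    (fun q => mfderiv (𝓡 m) (𝓡 k) F q (extend (EuclideanSpace ℝ (Fin m)) v q)) p u)

/-- The mean curvature vector, the (unnormalized) trace of the second fundamental form. -/
def meanCurvature (g : PseudoRiemannianMetric k V)
    (D : CovariantDerivative (𝓡 k) (EuclideanSpace ℝ (Fin k))
      (TangentSpace (𝓡 k) : V → Type _)) (F : S → V) (p : S) : TangentSpace (𝓡 k) (F p) :=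
  metricTrace (tangentBasis (k := m) p) (inducedMetric g F p) (secondFundamentalForm g D F p)

/-- The length `|H| = √⟨H, H⟩` of a spacelike mean curvature vector. -/
def meanCurvatureNorm (m : ℕ) {S : Type*} [TopologicalSpace S]
    [ChartedSpace (EuclideanSpace ℝ (Fin m)) S] [IsManifold (𝓡 m) ∞ S]
    (g : PseudoRiemannianMetric k V)
    (D : CovariantDerivative (𝓡 k) (EuclideanSpace ℝ (Fin k))
      (TangentSpace (𝓡 k) : V → Type _)) (F : S → V) (p : S) : ℝ :=
  Real.sqrt (g.inner (F p) (meanCurvature (m := m) g D F p) (meanCurvature (m := m) g D F p))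

/-- `(e, t)` is a smooth orthonormal normal frame over `U`, with `e` spacelike and `t` timelike. -/
structure IsNormalFrameOn (g : PseudoRiemannianMetric k V) (F : S → V) (U : Set S)
    (e t : Π p : S, TangentSpace (𝓡 k) (F p)) : Prop where
  smooth_e : SmoothAlongOn (m := m) F U e
  smooth_t : SmoothAlongOn (m := m) F U t
  normal_e : ∀ p ∈ U, ∀ v : TangentSpace (𝓡 m) p,
    g.inner (F p) (e p) (mfderiv (𝓡 m) (𝓡 k) F p v) = 0
  normal_t : ∀ p ∈ U, ∀ v : TangentSpace (𝓡 m) p,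
    g.inner (F p) (t p) (mfderiv (𝓡 m) (𝓡 k) F p v) = 0
  inner_e_e : ∀ p ∈ U, g.inner (F p) (e p) (e p) = 1
  inner_t_t : ∀ p ∈ U, g.inner (F p) (t p) (t p) = -1
  inner_e_t : ∀ p ∈ U, g.inner (F p) (e p) (t p) = 0

/-- An orientation of the normal bundle of a codimension-two spacelike submanifold, given by an
oriented atlas of local orthonormal normal frames (spacelike, timelike): around every point `p`
there is a frame over the open set `dom p`, and on overlaps two frames are related by a matrix of
positive determinant. (If `(e', t')` and `(e, t)` are two such frames,
`e' = ⟨e', e⟩ e - ⟨e', t⟩ t` and `t' = ⟨t', e⟩ e - ⟨t', t⟩ t`.) -/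
structure NormalOrientation {m k : ℕ} {S : Type*} [TopologicalSpace S]
    [ChartedSpace (EuclideanSpace ℝ (Fin m)) S] [IsManifold (𝓡 m) ∞ S]
    {V : Type*} [TopologicalSpace V] [ChartedSpace (EuclideanSpace ℝ (Fin k)) V]
    [IsManifold (𝓡 k) ∞ V] (g : PseudoRiemannianMetric k V) (F : S → V) where
  dom : S → Set S
  isOpen_dom : ∀ p, IsOpen (dom p)
  mem_dom : ∀ p, p ∈ dom p
  e : S → Π q : S, TangentSpace (𝓡 k) (F q)
  t : S → Π q : S, TangentSpace (𝓡 k) (F q)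
  isNormalFrameOn : ∀ p, IsNormalFrameOn (m := m) g F (dom p) (e p) (t p)
  oriented : ∀ p p' q : S, q ∈ dom p → q ∈ dom p' →
    0 < g.inner (F q) (e p' q) (t p q) * g.inner (F q) (t p' q) (e p q)
      - g.inner (F q) (e p' q) (e p q) * g.inner (F q) (t p' q) (t p q)

/-- The reflection `J = ⟨H, e_{n+1}⟩ e_n - ⟨H, e_n⟩ e_{n+1}` of the mean curvature vector, where
`(e_n, e_{n+1})` is any positively oriented orthonormal normal frame with `e_n` spacelike and
`e_{n+1}` timelike. It depends only on the orientation of the normal bundle; in particular it is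
unchanged under `(e_n, e_{n+1}) ↦ (-e_n, -e_{n+1})`, so that one may take `e_{n+1}` to be future
directed when there is a time orientation. -/
def NormalOrientation.reflectedMeanCurvature {g : PseudoRiemannianMetric k V} {F : S → V}
    (o : NormalOrientation (m := m) g F)
    (D : CovariantDerivative (𝓡 k) (EuclideanSpace ℝ (Fin k))
      (TangentSpace (𝓡 k) : V → Type _)) (p : S) : TangentSpace (𝓡 k) (F p) :=
  g.inner (F p) (meanCurvature (m := m) g D F p) (o.t p p) • o.e p p
    - g.inner (F p) (meanCurvature (m := m) g D F p) (o.e p p) • o.t p p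

/-- The connection one-form in the mean curvature gauge, `α_H(v) = ⟨D_v (-H/|H|), J/|H|⟩`. -/
def NormalOrientation.connectionForm {g : PseudoRiemannianMetric k V} {F : S → V}
    (o : NormalOrientation (m := m) g F)
    (D : CovariantDerivative (𝓡 k) (EuclideanSpace ℝ (Fin k))
      (TangentSpace (𝓡 k) : V → Type _)) (p : S) (v : TangentSpace (𝓡 m) p) : ℝ :=
  g.inner (F p)
    (covAlong D F
      (fun q => -((meanCurvatureNorm m g D F q)⁻¹ • meanCurvature (m := m) g D F q)) p v)
    ((meanCurvatureNorm m g D F p)⁻¹ • o.reflectedMeanCurvature D p)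

/-- The tangent vector `∑ α_H(e_a) e_a`, with `(e_a)` an orthonormal basis of the tangent space of the
submanifold, i.e. the metric dual of `α_H`. -/
def NormalOrientation.connectionVector {g : PseudoRiemannianMetric k V} {F : S → V}
    (o : NormalOrientation (m := m) g F)
    (D : CovariantDerivative (𝓡 k) (EuclideanSpace ℝ (Fin k))
      (TangentSpace (𝓡 k) : V → Type _)) (p : S) : TangentSpace (𝓡 m) p :=
  sharp (tangentBasis p) (inducedMetric g F p) (o.connectionForm D p)

/-- The gradient `∇f` of a function with respect to the induced metric. -/
def inducedGradient (g : PseudoRiemannianMetric k V) (F : S → V) (f : S → ℝ) (p : S) :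
    TangentSpace (𝓡 m) p :=
  sharp (tangentBasis p) (inducedMetric g F p) fun v => mvfderiv (𝓡 m) f p v

end Submanifold

end

/-!
The three integrands add up to the divergence of a one-form on `S`, so the formula is the divergence
theorem on a closed manifold.

Put `ℓ = (s H + J) / |H|`. This is a null normal field along `F`, and the one-form in question is
`θ(X) = f Q(dF X, ℓ)`. Its divergence is the trace over the tangent space of `S` of four terms.

* The derivative of `f` gives `Q(∇f, ℓ)`.
* The derivative of `Q` gives `f ∑ₐ (D_{eₐ} Q)(eₐ, ℓ)`. Since `ℓ` is orthogonal to the tangent space,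
  tracing the conformal Killing-Yano equation over that space evaluates it to
  `m / (m + 1) f ⟨ξ, ℓ⟩` (`IsFramedPatch.trace_coordCovForm`).
* The derivative of `dF` has trace `H`, and `Q(H, ℓ) = Q(H, J) / |H|` because `Q` is alternating.
* The derivative of `ℓ` splits into a tangential and a normal part. The tangential part is the shape
  operator of `ℓ`, which is self-adjoint and so pairs to zero with the alternating form `Q`
  (`sum_symm_mul_antisymm_eq_zero`). The normal plane is Lorentzian and `(H / |H|, J / |H|)` is an
  orthonormal frame of it, so the normal part is `s α_H(X) ℓ` (`IsFramedPatch.coordCov_patchNull`).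
  This is the term containing the connection vector.

The divergence is computed in charts of `S` and `V`: all objects are expressed there, in the
situation `IsFramedPatch` of a smooth map `u` into a vector space carrying a variable scalar product
`G`, with a normal frame `(e, t)`. The identity is `IsFramedPatch.sum_fderiv_eq`, stated as the
coordinate divergence of `√det · g⁻¹ θ`. Lemmas such as `chartCoord_covAlong`,
`chartCoord_meanCurvature` and `connectionForm_eq` translate the intrinsic definitions into charts.

The Riemannian measure has density `√det` in every chart (`integral_riemannianVolume`). For `f`
supported in one patch the integral is therefore that of a divergence of compactly supported fields
on Euclidean space, which is zero (`integral_totalIntegrand_of_patch`); a partition of unity then gives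
the general case (`integral_totalIntegrand`).

Integrability holds because the integrands are continuous and `S` is compact. The case `m = 0` is
vacuous: there `H` is an empty sum, which contradicts `⟨H, H⟩ > 0` unless `S` is empty.
-/

noncomputable section

set_option maxSynthPendingDepth 3
set_option linter.unusedSectionVars false

/-! ### Traces and musical isomorphisms in an arbitrary basis -/

section MetricLinearAlgebra

variable {ι κ : Type*} [Fintype ι] [DecidableEq ι] [Fintype κ] [DecidableEq κ]
  {T : Type*} [AddCommGroup T] [Module ℝ T] {W : Type*} [AddCommGroup W] [Module ℝ W]

/-- A symmetric nondegenerate bilinear form, presented as a bare function of two vectors. -/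
structure IsScalarProduct (g : T → T → ℝ) : Prop where
  add_left : ∀ u v w, g (u + v) w = g u w + g v w
  smul_left : ∀ (a : ℝ) u w, g (a • u) w = a * g u w
  symm : ∀ u v, g u v = g v u
  nondegenerate : ∀ v, (∀ w, g v w = 0) → v = 0

namespace IsScalarProduct

variable {g : T → T → ℝ} (hg : IsScalarProduct g)
include hg

lemma sum_left {σ : Type*} (s : Finset σ) (u : σ → T) (w : T) :
    g (∑ i ∈ s, u i) w = ∑ i ∈ s, g (u i) w :=
  map_sum (⟨⟨fun v => g v w, by simpa using hg.smul_left 0 0 w⟩,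
    fun _ _ => hg.add_left _ _ _⟩ : T →+ ℝ) u s

lemma sub_left (u v w : T) : g (u - v) w = g u w - g v w := by
  rw [sub_eq_add_neg, hg.add_left, ← neg_one_smul ℝ v, hg.smul_left]; ring

lemma ext {u v : T} (h : ∀ w, g u w = g v w) : u = v :=
  sub_eq_zero.1 (hg.nondegenerate _ fun w => by rw [hg.sub_left, h, sub_self])

omit [DecidableEq ι] in
lemma ext_basis (b : Module.Basis ι ℝ T) {u v : T} (h : ∀ i, g u (b i) = g v (b i)) : u = v := by
  refine hg.ext fun w => ?_
  rw [← b.sum_repr w, hg.symm u, hg.symm v, hg.sum_left, hg.sum_left]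
  refine Finset.sum_congr rfl fun i _ => ?_
  rw [hg.smul_left, hg.smul_left, hg.symm _ u, hg.symm _ v, h]

lemma isUnit_det_gram (b : Module.Basis ι ℝ T) : IsUnit (gram b g).det := by
  rw [isUnit_iff_ne_zero]
  intro h0
  obtain ⟨c, hc, hc0⟩ := Matrix.exists_vecMul_eq_zero_iff.2 h0
  apply hc
  have : ∑ i, c i • b i = 0 := by
    refine hg.ext_basis b fun j => ?_
    rw [hg.sum_left, show (0 : T) = (0 : ℝ) • 0 by simp, hg.smul_left, zero_mul]
    have := congrFun hc0 j
    simpa [Matrix.vecMul, dotProduct, gram, hg.smul_left] using this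
  exact funext fun i => by
    simpa using Fintype.linearIndependent_iff.1 b.linearIndependent c this i

omit [Fintype ι] [DecidableEq ι] in
lemma gram_transpose (b : Module.Basis ι ℝ T) : (gram b g).transpose = gram b g := by
  ext i j; exact hg.symm _ _

lemma gram_inv_symm (b : Module.Basis ι ℝ T) (i j : ι) :
    (gram b g)⁻¹ i j = (gram b g)⁻¹ j i := by
  have := Matrix.transpose_nonsing_inv (gram b g)
  rw [hg.gram_transpose] at this
  exact congrFun (congrFun this j) i

lemma sum_gram_inv_mul (b : Module.Basis ι ℝ T) (i k : ι) :
    ∑ j, (gram b g)⁻¹ i j * g (b j) (b k) = if i = k then 1 else 0 := by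
  have := congrFun (congrFun (Matrix.nonsing_inv_mul _ (hg.isUnit_det_gram b)) i) k
  simpa [Matrix.mul_apply, gram, Matrix.one_apply] using this

/-- The defining property of `sharp`, tested on the basis in which it is computed. -/
lemma sharp_apply_basis (b : Module.Basis ι ℝ T) (φ : T → ℝ) (k : ι) :
    g (sharp b g φ) (b k) = φ (b k) := by
  unfold sharp
  rw [hg.sum_left]
  simp only [← Finset.sum_smul, hg.smul_left, Finset.sum_mul]
  rw [Finset.sum_comm]
  have : ∀ j, ∑ i, (gram b g)⁻¹ i j * φ (b j) * g (b i) (b k)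
      = φ (b j) * ∑ i, (gram b g)⁻¹ j i * g (b i) (b k) := fun j => by
    rw [Finset.mul_sum]
    exact Finset.sum_congr rfl fun i _ => by rw [hg.gram_inv_symm b i j]; ring
  simp only [this, hg.sum_gram_inv_mul]
  simp

lemma sharp_apply (b : Module.Basis ι ℝ T) (φ : T →ₗ[ℝ] ℝ) (v : T) :
    g (sharp b g φ) v = φ v := by
  conv_lhs => rw [← b.sum_repr v]
  conv_rhs => rw [← b.sum_repr v]
  rw [hg.symm, hg.sum_left, map_sum]
  refine Finset.sum_congr rfl fun i _ => ?_
  rw [hg.smul_left, hg.symm, hg.sharp_apply_basis, map_smul, smul_eq_mul]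

lemma sharp_eq (b : Module.Basis ι ℝ T) (c : Module.Basis κ ℝ T) (φ : T →ₗ[ℝ] ℝ) :
    sharp b g φ = sharp c g φ :=
  hg.ext fun v => by rw [hg.sharp_apply, hg.sharp_apply]

/-- The `g`-dual basis `b^i = ∑ g^{ij} b_j`. -/
lemma dual_apply (b : Module.Basis ι ℝ T) (i k : ι) :
    g (∑ j, (gram b g)⁻¹ i j • b j) (b k) = if i = k then 1 else 0 := by
  rw [hg.sum_left]
  simpa only [hg.smul_left] using hg.sum_gram_inv_mul b i k

/-- A metric trace of a bilinear map does not depend on the basis. -/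
lemma metricTrace_eq (b : Module.Basis ι ℝ T) (c : Module.Basis κ ℝ T) (B : T →ₗ[ℝ] T →ₗ[ℝ] W) :
    metricTrace b g (fun u v => B u v) = metricTrace c g (fun u v => B u v) := by
  obtain ⟨b', hb'⟩ : ∃ b' : ι → T, b' = fun i => ∑ j, (gram b g)⁻¹ i j • b j := ⟨_, rfl⟩
  obtain ⟨c', hc'⟩ : ∃ c' : κ → T, c' = fun i => ∑ j, (gram c g)⁻¹ i j • c j := ⟨_, rfl⟩
  have tr : metricTrace b g (fun u v => B u v) = ∑ i, B (b i) (b' i) := by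
    simp [metricTrace, hb']
  have tr' : metricTrace c g (fun u v => B u v) = ∑ i, B (c i) (c' i) := by
    simp [metricTrace, hc']
  have h1 : ∀ i, b i = ∑ k, g (b i) (c' k) • c k := fun i => by
    have hr : ∀ k, g (b i) (c' k) = c.repr (b i) k := fun k => by
      conv_lhs => rw [← c.sum_repr (b i)]
      rw [hg.sum_left]
      simp only [hg.smul_left]
      have : ∀ i, g (c i) (c' k) = if k = i then 1 else 0 := fun i => by
        rw [hg.symm, hc', hg.dual_apply]
      simp [this]
    simp only [hr, c.sum_repr]
  have h2 : ∀ k, c' k = ∑ i, g (b i) (c' k) • b' i := fun k => hg.ext_basis b fun j => by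
    rw [hg.sum_left]
    simp only [hg.smul_left]
    have : ∀ i, g (b' i) (b j) = if i = j then 1 else 0 := fun i => by
      rw [hb', hg.dual_apply]
    simp only [this, mul_ite, mul_one, mul_zero, Finset.sum_ite_eq', Finset.mem_univ, if_true]
    exact hg.symm _ _
  rw [tr, tr']
  calc ∑ i, B (b i) (b' i) = ∑ i, ∑ k, g (b i) (c' k) • B (c k) (b' i) := by
        refine Finset.sum_congr rfl fun i _ => ?_
        conv_lhs => rw [h1 i]
        simp
    _ = ∑ k, B (c k) (c' k) := by
        rw [Finset.sum_comm]
        refine Finset.sum_congr rfl fun k _ => ?_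
        conv_rhs => rw [h2 k]
        simp

end IsScalarProduct

end MetricLinearAlgebra

/-! ### Derivatives of determinants and inverses, and the coordinate divergence -/

section MatrixCalculus

variable {ι : Type*} [Fintype ι] [DecidableEq ι]
  {X : Type*} [NormedAddCommGroup X] [NormedSpace ℝ X]

lemma contDiffAt_matrix_det {n : WithTop ℕ∞} {h : X → Matrix ι ι ℝ} {y : X}
    (hh : ∀ i j, ContDiffAt ℝ n (fun x => h x i j) y) :
    ContDiffAt ℝ n (fun x => (h x).det) y := by
  simp only [Matrix.det_apply]
  refine ContDiffAt.sum fun σ _ => ContDiffAt.const_smul _ ?_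
  exact contDiffAt_prod fun i _ => hh _ _

lemma contDiffAt_matrix_inv {n : WithTop ℕ∞} {h : X → Matrix ι ι ℝ} {y : X}
    (hh : ∀ i j, ContDiffAt ℝ n (fun x => h x i j) y) (hdet : (h y).det ≠ 0) (i j : ι) :
    ContDiffAt ℝ n (fun x => (h x)⁻¹ i j) y := by
  have : (fun x => (h x)⁻¹ i j) = fun x => ((h x).det)⁻¹ * (h x).adjugate i j := by
    ext x; simp [Matrix.inv_def]
  rw [this]
  refine ((contDiffAt_matrix_det hh).inv hdet).mul ?_
  simp only [Matrix.adjugate_apply]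
  refine contDiffAt_matrix_det fun a c => ?_
  by_cases ha : a = j
  · subst ha; simpa using contDiffAt_const
  · simpa [Matrix.updateRow_ne ha] using hh a c

/-- Jacobi's formula. -/
lemma fderiv_matrix_det {h : X → Matrix ι ι ℝ} {y : X}
    (hh : ∀ i j, DifferentiableAt ℝ (fun x => h x i j) y) (v : X) :
    fderiv ℝ (fun x => (h x).det) y v
      = ∑ i, ∑ j, (h y).adjugate j i * fderiv ℝ (fun x => h x i j) y v := by
  let D : ContinuousMultilinearMap ℝ (fun _ : ι => ι → ℝ) ℝ :=
    ⟨(Matrix.detRowAlternating (R := ℝ) (n := ι)).toMultilinearMap,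
      Continuous.matrix_det continuous_id⟩
  have hrow : ∀ i, HasFDerivAt (fun x => h x i)
      (ContinuousLinearMap.pi fun j => fderiv ℝ (fun x => h x i j) y) y :=
    fun i => hasFDerivAt_pi.2 fun j => (hh i j).hasFDerivAt
  have key : HasFDerivAt (fun x => (h x).det) _ y := HasFDerivAt.multilinear_comp (f := D) hrow
  rw [key.fderiv]
  simp only [_root_.sum_apply, ContinuousLinearMap.comp_apply]
  refine Finset.sum_congr rfl fun i _ => ?_
  have : (D.toContinuousLinearMap (fun j => h y j) i)
      ((ContinuousLinearMap.pi fun j => fderiv ℝ (fun x => h x i j) y) v)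
      = ((h y).updateRow i fun j => fderiv ℝ (fun x => h x i j) y v).det := rfl
  rw [this, ← Matrix.cramer_transpose_apply, Matrix.cramer_eq_adjugate_mulVec,
    ← Matrix.adjugate_transpose]
  simp [Matrix.mulVec, dotProduct]

lemma fderiv_matrix_inv {h : X → Matrix ι ι ℝ} {y : X}
    (hh : ∀ i j, ContDiffAt ℝ 1 (fun x => h x i j) y) (hdet : (h y).det ≠ 0) (v : X) (i j : ι) :
    fderiv ℝ (fun x => (h x)⁻¹ i j) y v
      = - ∑ a, ∑ b, (h y)⁻¹ i a * fderiv ℝ (fun x => h x a b) y v * (h y)⁻¹ b j := by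
  have hd : ∀ i j, DifferentiableAt ℝ (fun x => h x i j) y := fun i j =>
    (hh i j).differentiableAt one_ne_zero
  have hi : ∀ i j, DifferentiableAt ℝ (fun x => (h x)⁻¹ i j) y := fun i j =>
    (contDiffAt_matrix_inv hh hdet i j).differentiableAt one_ne_zero
  let dI : Matrix ι ι ℝ := Matrix.of fun i j => fderiv ℝ (fun x => (h x)⁻¹ i j) y v
  let dh : Matrix ι ι ℝ := Matrix.of fun i j => fderiv ℝ (fun x => h x i j) y v
  have hev : ∀ᶠ x in 𝓝 y, (h x).det ≠ 0 :=
    (contDiffAt_matrix_det hh).continuousAt.eventually_ne hdet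
  have hprod : dI * h y + (h y)⁻¹ * dh = 0 := by
    ext i k
    have h0 : fderiv ℝ (fun x => ∑ j, (h x)⁻¹ i j * h x j k) y v = 0 := by
      have : (fun x => ∑ j, (h x)⁻¹ i j * h x j k) =ᶠ[𝓝 y]
          fun _ => (1 : Matrix ι ι ℝ) i k := by
        filter_upwards [hev] with x hx
        rw [← Matrix.nonsing_inv_mul (h x) (isUnit_iff_ne_zero.2 hx), Matrix.mul_apply]
      rw [this.fderiv_eq]; simp
    rw [fderiv_fun_sum fun j _ => (hi i j).fun_mul (hd j k)] at h0
    simp only [_root_.sum_apply] at h0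
    refine Eq.trans ?_ h0
    rw [Matrix.add_apply, Matrix.mul_apply, Matrix.mul_apply, ← Finset.sum_add_distrib]
    refine Finset.sum_congr rfl fun j _ => ?_
    rw [fderiv_fun_mul (hi i j) (hd j k)]
    simp [dI, dh]; ring
  have hu : IsUnit (h y).det := isUnit_iff_ne_zero.2 hdet
  have : dI = -((h y)⁻¹ * dh * (h y)⁻¹) := by
    calc dI = dI * h y * (h y)⁻¹ := by rw [Matrix.mul_assoc, Matrix.mul_nonsing_inv _ hu,
              Matrix.mul_one]
      _ = _ := by rw [eq_neg_of_add_eq_zero_left hprod, Matrix.neg_mul]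
  have := congrFun (congrFun this i) j
  simp only [dI, dh, Matrix.of_apply, Matrix.neg_apply, Matrix.mul_apply, Finset.sum_mul] at this
  rw [this, Finset.sum_comm]

/-- The coordinate divergence `∑ ∂_i (√h h^{ij} θ_j)` of a one-form is `√h` times its covariant
divergence `∑ h^{ij} (∂_i θ_j - Γ_{ij}^k θ_k)`. Here `C i j l` stands for the Christoffel symbol
`Γ_{ijl}` of the first kind, which enters through its symmetry and `∂_i h_{jl} = Γ_{ijl} + Γ_{ilj}`
only. -/
theorem sum_fderiv_sqrt_det_mul_inv_mul {h : X → Matrix ι ι ℝ} {θ : ι → X → ℝ} {y : X}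
    (b : ι → X) (hh : ∀ i j, ContDiffAt ℝ 1 (fun x => h x i j) y)
    (hθ : ∀ j, DifferentiableAt ℝ (θ j) y) (hdet : 0 < (h y).det)
    (hsymm : ∀ i j, (h y)⁻¹ i j = (h y)⁻¹ j i)
    (C : ι → ι → ι → ℝ) (hC : ∀ i j l, C i j l = C j i l)
    (hdh : ∀ i j l, fderiv ℝ (fun x => h x j l) y (b i) = C i j l + C i l j) :
    ∑ i, fderiv ℝ (fun x => √(h x).det * ∑ j, (h x)⁻¹ i j * θ j x) y (b i)
      = √(h y).det * ∑ i, ∑ j, (h y)⁻¹ i j *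
          (fderiv ℝ (θ j) y (b i) - ∑ k, ∑ l, (h y)⁻¹ l k * C i j l * θ k y) := by
  have hd : ∀ i j, DifferentiableAt ℝ (fun x => h x i j) y := fun i j =>
    (hh i j).differentiableAt one_ne_zero
  have hi : ∀ i j, DifferentiableAt ℝ (fun x => (h x)⁻¹ i j) y := fun i j =>
    (contDiffAt_matrix_inv hh hdet.ne' i j).differentiableAt one_ne_zero
  have hdd : DifferentiableAt ℝ (fun x => (h x).det) y :=
    (contDiffAt_matrix_det hh).differentiableAt one_ne_zero
  set A : ι → ι → ℝ := fun i j => (h y)⁻¹ i j with hA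
  have hadj : ∀ i j, (h y).adjugate i j = (h y).det * A i j := by
    intro i j
    simp [hA, Matrix.inv_def, hdet.ne']
  have hsq : ∀ v, fderiv ℝ (fun x => √(h x).det) y v
      = √(h y).det * (1 / 2 * ∑ i, ∑ j, A j i * fderiv ℝ (fun x => h x i j) y v) := by
    intro v
    rw [fderiv_sqrt hdd hdet.ne']
    simp only [_root_.smul_apply, smul_eq_mul]
    rw [fderiv_matrix_det hd]
    simp only [hadj, mul_assoc, ← Finset.mul_sum]
    have h2 : √(h y).det * √(h y).det = (h y).det := Real.mul_self_sqrt hdet.le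
    have h3 : √(h y).det ≠ 0 := (Real.sqrt_pos.2 hdet).ne'
    field_simp
    rw [pow_two, h2]
  have hdh' : ∀ i, ∑ a, ∑ c, A c a * fderiv ℝ (fun x => h x a c) y (b i)
      = 2 * ∑ a, ∑ c, A a c * C i a c := by
    intro i
    simp only [hdh, mul_add, Finset.sum_add_distrib]
    rw [two_mul]
    congr 1
    · exact Finset.sum_congr rfl fun a _ => Finset.sum_congr rfl fun c _ => by
        rw [show A c a = A a c from hsymm _ _]
    · rw [Finset.sum_comm]
  have hder : ∀ i, fderiv ℝ (fun x => √(h x).det * ∑ j, (h x)⁻¹ i j * θ j x) y (b i)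
      = √(h y).det * ((∑ a, ∑ c, A a c * C i a c) * ∑ j, A i j * θ j y
        + ∑ j, (A i j * fderiv ℝ (θ j) y (b i)
          - (∑ a, ∑ c, A i a * (C i a c + C i c a) * A c j) * θ j y)) := by
    intro i
    rw [fderiv_fun_mul (hdd.sqrt hdet.ne')
      (DifferentiableAt.fun_sum fun j _ => (hi i j).fun_mul (hθ j)),
      fderiv_fun_sum fun j _ => (hi i j).fun_mul (hθ j)]
    simp only [_root_.add_apply, _root_.smul_apply, smul_eq_mul,
      _root_.sum_apply]
    rw [hsq, hdh' i]
    have : ∀ j, fderiv ℝ (fun x => (h x)⁻¹ i j * θ j x) y (b i)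
        = A i j * fderiv ℝ (θ j) y (b i)
          - (∑ a, ∑ c, A i a * (C i a c + C i c a) * A c j) * θ j y := by
      intro j
      rw [fderiv_fun_mul (hi i j) (hθ j)]
      simp only [_root_.add_apply, _root_.smul_apply, smul_eq_mul]
      rw [fderiv_matrix_inv hh hdet.ne']
      simp only [hdh]
      ring
    simp only [this]
    ring
  simp only [hder]
  rw [← Finset.mul_sum]
  congr 1
  simp only [Finset.sum_add_distrib, Finset.sum_sub_distrib, mul_sub, add_mul, mul_add]
  have e1 : ∑ i, ∑ j, (∑ a, ∑ c, A i a * C i a c * A c j) * θ j y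
      = ∑ i, ∑ j, A i j * ∑ k, ∑ l, A l k * C i j l * θ k y := by
    refine Finset.sum_congr rfl fun i _ => ?_
    simp only [Finset.sum_mul, Finset.mul_sum]
    rw [Finset.sum_comm]
    refine Finset.sum_congr rfl fun a _ => Finset.sum_congr rfl fun k _ =>
      Finset.sum_congr rfl fun l _ => by ring
  have e2 : ∑ i, ∑ j, (∑ a, ∑ c, A i a * C i c a * A c j) * θ j y
      = ∑ i, (∑ a, ∑ c, A a c * C i a c) * ∑ j, A i j * θ j y := by
    have : ∀ i, (∑ a, ∑ c, A a c * C i a c) * ∑ j, A i j * θ j y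
        = ∑ a, ∑ c, ∑ j, A a c * C a i c * A i j * θ j y := fun i => by
      rw [Finset.sum_mul]
      refine Finset.sum_congr rfl fun a _ => ?_
      rw [Finset.sum_mul]
      refine Finset.sum_congr rfl fun c _ => ?_
      rw [Finset.mul_sum]
      exact Finset.sum_congr rfl fun j _ => by rw [hC i a c]; ring
    simp only [this, Finset.sum_mul]
    rw [Finset.sum_comm (f := fun i a => ∑ c, ∑ j, A a c * C a i c * A i j * θ j y)]
    refine Finset.sum_congr rfl fun i _ => ?_
    rw [Finset.sum_comm (f := fun c a => ∑ j, A i a * C i c a * A c j * θ j y),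
      Finset.sum_comm]
    exact Finset.sum_congr rfl fun a _ => Finset.sum_comm
  rw [e1, e2]
  ring

end MatrixCalculus

/-! ### Levi-Civita calculus in a coordinate domain -/

section CoordinateCalculus

variable {X E : Type*} [NormedAddCommGroup X] [NormedSpace ℝ X]
  [NormedAddCommGroup E] [NormedSpace ℝ E] [FiniteDimensional ℝ E]

lemma ContDiffAt.clm_flip {F₁ F₂ F₃ : Type*} [NormedAddCommGroup F₁] [NormedSpace ℝ F₁]
    [NormedAddCommGroup F₂] [NormedSpace ℝ F₂] [NormedAddCommGroup F₃] [NormedSpace ℝ F₃]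
    {f : X → F₁ →L[ℝ] F₂ →L[ℝ] F₃} {y : X} {n : WithTop ℕ∞} (hf : ContDiffAt ℝ n f y) :
    ContDiffAt ℝ n (fun x => (f x).flip) y :=
  (ContinuousLinearMap.flipₗᵢ ℝ F₁ F₂ F₃).contDiff.contDiffAt.comp y hf

/-- A smooth pseudo-Riemannian metric on an open subset `W` of a vector space. -/
structure IsMetricOn (G : E → E →L[ℝ] E →L[ℝ] ℝ) (W : Set E) : Prop where
  isOpen : IsOpen W
  contDiffOn : ContDiffOn ℝ ∞ G W
  symm : ∀ z ∈ W, ∀ a b, G z a b = G z b a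
  nondegenerate : ∀ z ∈ W, ∀ a, (∀ b, G z a b = 0) → a = 0

/-- The Christoffel symbols of the second kind of `G`, as the bilinear map obtained by raising an
index of `½ (∂_a G(b, c) + ∂_b G(a, c) - ∂_c G(a, b))`. -/
def christoffel (G : E → E →L[ℝ] E →L[ℝ] ℝ) (z a b : E) : E :=
  (G z).inverse ((1 / 2 : ℝ) • (fderiv ℝ G z a b + fderiv ℝ G z b a
    - ((fderiv ℝ G z).flip a).flip b))

/-- The covariant derivative in the direction `v` of a vector field `n` along the map `u`, in
coordinates. -/
def coordCov (G : E → E →L[ℝ] E →L[ℝ] ℝ) (u n : X → E) (y v : X) : E :=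
  fderiv ℝ n y v + christoffel G (u y) (fderiv ℝ u y v) (n y)

/-- The covariant derivative `(D_a q)(b, c)` of a bilinear form, in coordinates. -/
def coordCovForm (G q : E → E →L[ℝ] E →L[ℝ] ℝ) (z a b c : E) : ℝ :=
  fderiv ℝ q z a b c - q z (christoffel G z a b) c - q z b (christoffel G z a c)

namespace IsMetricOn

variable {G : E → E →L[ℝ] E →L[ℝ] ℝ} {W : Set E} (hG : IsMetricOn G W) {z : E} (hz : z ∈ W)
include hG hz

omit [FiniteDimensional ℝ E] in
lemma contDiffAt : ContDiffAt ℝ ∞ G z := hG.contDiffOn.contDiffAt (hG.isOpen.mem_nhds hz)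

omit [FiniteDimensional ℝ E] in
lemma differentiableAt : DifferentiableAt ℝ G z := (hG.contDiffAt hz).differentiableAt (by simp)

omit [FiniteDimensional ℝ E] in
lemma ext {a b : E} (h : ∀ c, G z a c = G z b c) : a = b :=
  sub_eq_zero.1 (hG.nondegenerate z hz _ fun c => by simp [h c])

lemma isInvertible : (G z).IsInvertible := by
  have hinj : Function.Injective (G z : E →ₗ[ℝ] E →L[ℝ] ℝ) := by
    refine (injective_iff_map_eq_zero _).2 fun a ha => hG.nondegenerate z hz a fun b => ?_
    have : G z a = 0 := ha
    simp [this]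
  have hdim : Module.finrank ℝ E = Module.finrank ℝ (E →L[ℝ] ℝ) := by
    rw [← (LinearMap.toContinuousLinearMap (𝕜 := ℝ) (E := E) (F' := ℝ)).finrank_eq]
    exact (Subspace.dual_finrank_eq (K := ℝ) (V := E)).symm
  let e := (LinearEquiv.ofInjectiveOfFinrankEq (G z : E →ₗ[ℝ] E →L[ℝ] ℝ) hinj hdim)
  exact ⟨e.toContinuousLinearEquiv, by ext; rfl⟩

lemma apply_christoffel (a b c : E) :
    G z (christoffel G z a b) c
      = 1 / 2 * (fderiv ℝ G z a b c + fderiv ℝ G z b a c - fderiv ℝ G z c a b) := by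
  rw [christoffel, (hG.isInvertible hz).self_apply_inverse]
  simp

omit [FiniteDimensional ℝ E] in
lemma fderiv_apply_symm (a b c : E) : fderiv ℝ G z a b c = fderiv ℝ G z a c b := by
  have hd := hG.differentiableAt hz
  have h1 : ∀ b c, fderiv ℝ (fun z => G z b c) z a = fderiv ℝ G z a b c := fun b c => by
    have : HasFDerivAt (fun z => G z b c)
      ((ContinuousLinearMap.apply ℝ ℝ c).comp ((ContinuousLinearMap.apply ℝ (E →L[ℝ] ℝ) b).comp
        (fderiv ℝ G z))) z :=
      ((ContinuousLinearMap.apply ℝ ℝ c).hasFDerivAt).comp z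
        (((ContinuousLinearMap.apply ℝ (E →L[ℝ] ℝ) b).hasFDerivAt).comp z hd.hasFDerivAt)
    rw [this.fderiv]; rfl
  rw [← h1, ← h1]
  congr 1
  refine Filter.EventuallyEq.fderiv_eq ?_
  filter_upwards [hG.isOpen.mem_nhds hz] with x hx using hG.symm x hx b c

lemma christoffel_symm (a b : E) : christoffel G z a b = christoffel G z b a :=
  hG.ext hz fun c => by
    rw [hG.apply_christoffel hz, hG.apply_christoffel hz, hG.fderiv_apply_symm hz c a b]; ring

/-- The Levi-Civita connection is metric. -/
lemma fderiv_apply (a b c : E) :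
    fderiv ℝ G z a b c = G z (christoffel G z a b) c + G z b (christoffel G z a c) := by
  rw [hG.symm z hz b, hG.apply_christoffel hz, hG.apply_christoffel hz,
    hG.fderiv_apply_symm hz a c b, hG.fderiv_apply_symm hz b a c, hG.fderiv_apply_symm hz c a b]
  ring

/-- Koszul: the Christoffel symbols are determined by their symmetry and by `G`. -/
lemma eq_christoffel {Γ : E → E → E} (hsymm : ∀ a b, Γ a b = Γ b a)
    (hmetric : ∀ a b c, fderiv ℝ G z a b c = G z (Γ a b) c + G z b (Γ a c)) (a b : E) :
    Γ a b = christoffel G z a b :=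
  hG.ext hz fun c => by
    rw [hG.apply_christoffel hz, hmetric, hmetric, hmetric, hsymm b a, hsymm c a, hsymm c b,
      hG.symm z hz b, hG.symm z hz a]
    ring

lemma christoffel_add_right (a b c : E) :
    christoffel G z a (b + c) = christoffel G z a b + christoffel G z a c :=
  hG.ext hz fun d => by
    simp only [hG.apply_christoffel hz, map_add, _root_.add_apply]; ring

lemma christoffel_smul_right (r : ℝ) (a b : E) :
    christoffel G z a (r • b) = r • christoffel G z a b :=
  hG.ext hz fun d => by
    simp only [hG.apply_christoffel hz, map_smul, _root_.smul_apply, smul_eq_mul]; ring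

lemma contDiffAt_christoffel {u a b : X → E} {y : X} (hy : u y = z) (hu : ContDiffAt ℝ ∞ u y)
    (ha : ContDiffAt ℝ ∞ a y) (hb : ContDiffAt ℝ ∞ b y) :
    ContDiffAt ℝ ∞ (fun x => christoffel G (u x) (a x) (b x)) y := by
  subst hy
  have hGu : ContDiffAt ℝ ∞ (fun x => G (u x)) y := (hG.contDiffAt hz).comp y hu
  have hdG : ContDiffAt ℝ ∞ (fun x => fderiv ℝ G (u x)) y :=
    ContDiffAt.comp y ((hG.contDiffAt hz).fderiv_right (m := ∞) (by simp)) hu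
  have hinv : ContDiffAt ℝ ∞ (fun x => (G (u x)).inverse) y := by
    obtain ⟨e, he⟩ := hG.isInvertible hz
    have := contDiffAt_map_inverse (n := ∞) e
    rw [he] at this
    exact ContDiffAt.comp y this hGu
  refine hinv.clm_apply (ContDiffAt.const_smul _ (ContDiffAt.sub (ContDiffAt.add ?_ ?_) ?_))
  · exact (hdG.clm_apply ha).clm_apply hb
  · exact (hdG.clm_apply hb).clm_apply ha
  · exact (hdG.clm_flip.clm_apply ha).clm_flip.clm_apply hb

end IsMetricOn

variable {G : E → E →L[ℝ] E →L[ℝ] ℝ} {W : Set E} {u n k : X → E} {y : X}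

lemma ContDiffAt.coordCov (hG : IsMetricOn G W) (hy : u y ∈ W) (hu : ContDiffAt ℝ ∞ u y)
    (hn : ContDiffAt ℝ ∞ n y) (v : X) : ContDiffAt ℝ ∞ (fun x => coordCov G u n x v) y := by
  have hd : ∀ {f : X → E}, ContDiffAt ℝ ∞ f y → ContDiffAt ℝ ∞ (fun x => fderiv ℝ f x v) y :=
    fun hf => (hf.fderiv_right (m := ∞) (by simp)).clm_apply contDiffAt_const
  exact (hd hn).add (hG.contDiffAt_christoffel hy rfl hu (hd hu) hn)

omit [FiniteDimensional ℝ E] in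
lemma fderiv_bilinear_along {q : E → E →L[ℝ] E →L[ℝ] ℝ} (hq : DifferentiableAt ℝ q (u y))
    (hu : DifferentiableAt ℝ u y) (hn : DifferentiableAt ℝ n y) (hk : DifferentiableAt ℝ k y)
    (v : X) : fderiv ℝ (fun x => q (u x) (n x) (k x)) y v
      = fderiv ℝ q (u y) (fderiv ℝ u y v) (n y) (k y) + q (u y) (fderiv ℝ n y v) (k y)
        + q (u y) (n y) (fderiv ℝ k y v) := by
  have h := ((hq.hasFDerivAt.comp y hu.hasFDerivAt).clm_apply hn.hasFDerivAt).clm_apply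
    hk.hasFDerivAt
  have h' : HasFDerivAt (fun x => q (u x) (n x) (k x)) _ y := h
  rw [h'.fderiv]
  simp
  ring

lemma fderiv_inner_along (hG : IsMetricOn G W) (hy : u y ∈ W) (hu : DifferentiableAt ℝ u y)
    (hn : DifferentiableAt ℝ n y) (hk : DifferentiableAt ℝ k y) (v : X) :
    fderiv ℝ (fun x => G (u x) (n x) (k x)) y v
      = G (u y) (coordCov G u n y v) (k y) + G (u y) (n y) (coordCov G u k y v) := by
  rw [fderiv_bilinear_along (hG.differentiableAt hy) hu hn hk, hG.fderiv_apply hy]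
  simp [coordCov]
  ring

omit [FiniteDimensional ℝ E] in
lemma fderiv_form_along {q : E → E →L[ℝ] E →L[ℝ] ℝ} (hq : DifferentiableAt ℝ q (u y))
    (hu : DifferentiableAt ℝ u y)
    (hn : DifferentiableAt ℝ n y) (hk : DifferentiableAt ℝ k y) (v : X) :
    fderiv ℝ (fun x => q (u x) (n x) (k x)) y v
      = coordCovForm G q (u y) (fderiv ℝ u y v) (n y) (k y)
        + q (u y) (coordCov G u n y v) (k y) + q (u y) (n y) (coordCov G u k y v) := by
  rw [fderiv_bilinear_along hq hu hn hk]
  simp [coordCov, coordCovForm]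
  ring

lemma coordCov_fderiv_symm (hG : IsMetricOn G W) (hy : u y ∈ W) (hu : ContDiffAt ℝ ∞ u y)
    (v w : X) : coordCov G u (fun x => fderiv ℝ u x v) y w
      = coordCov G u (fun x => fderiv ℝ u x w) y v := by
  have hd : DifferentiableAt ℝ (fderiv ℝ u) y :=
    (hu.fderiv_right (m := 1) (by norm_cast)).differentiableAt one_ne_zero
  have h1 : ∀ v w, fderiv ℝ (fun x => fderiv ℝ u x v) y w = fderiv ℝ (fderiv ℝ u) y w v := by
    intro v w
    have := (hd.hasFDerivAt.clm_apply (hasFDerivAt_const v y))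
    rw [this.fderiv]; simp
  have hsymm : IsSymmSndFDerivAt ℝ u y := hu.isSymmSndFDerivAt (by simp; norm_cast)
  simp only [coordCov, h1]
  rw [hsymm.eq v w, hG.christoffel_symm hy]

lemma coordCov_add (hG : IsMetricOn G W) (hy : u y ∈ W) (hn : DifferentiableAt ℝ n y)
    (hk : DifferentiableAt ℝ k y) (v : X) :
    coordCov G u (fun x => n x + k x) y v = coordCov G u n y v + coordCov G u k y v := by
  simp only [coordCov, fderiv_fun_add hn hk, _root_.add_apply, hG.christoffel_add_right hy]
  abel

lemma coordCov_smul (hG : IsMetricOn G W) (hy : u y ∈ W) {r : X → ℝ}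
    (hr : DifferentiableAt ℝ r y) (hn : DifferentiableAt ℝ n y) (v : X) :
    coordCov G u (fun x => r x • n x) y v = fderiv ℝ r y v • n y + r y • coordCov G u n y v := by
  simp only [coordCov, fderiv_fun_smul hr hn, hG.christoffel_smul_right hy]
  simp
  abel

end CoordinateCalculus

/-! ### The divergence identity in a coordinate patch -/

section Patch

variable {ι : Type*} [Fintype ι] [DecidableEq ι]
  {X E : Type*} [NormedAddCommGroup X] [NormedSpace ℝ X]
  [NormedAddCommGroup E] [NormedSpace ℝ E] [FiniteDimensional ℝ E]

/-- A coordinate patch of a spacelike submanifold of codimension two: a smooth map `u` from an open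
set `O` into the domain `W` of the metric `G`, with positive definite induced metric, and an
orthonormal frame `e` (spacelike), `t` (timelike) of its normal bundle. -/
structure IsFramedPatch (b : Module.Basis ι ℝ X) (G : E → E →L[ℝ] E →L[ℝ] ℝ) (W : Set E) (O : Set X)
    (u e t : X → E) : Prop where
  metric : IsMetricOn G W
  isOpen : IsOpen O
  mapsTo : Set.MapsTo u O W
  smooth_u : ContDiffOn ℝ ∞ u O
  smooth_e : ContDiffOn ℝ ∞ e O
  smooth_t : ContDiffOn ℝ ∞ t O
  pos : ∀ y ∈ O, ∀ v, v ≠ 0 → 0 < G (u y) (fderiv ℝ u y v) (fderiv ℝ u y v)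
  normal_e : ∀ y ∈ O, ∀ v, G (u y) (e y) (fderiv ℝ u y v) = 0
  normal_t : ∀ y ∈ O, ∀ v, G (u y) (t y) (fderiv ℝ u y v) = 0
  inner_e_e : ∀ y ∈ O, G (u y) (e y) (e y) = 1
  inner_t_t : ∀ y ∈ O, G (u y) (t y) (t y) = -1
  inner_e_t : ∀ y ∈ O, G (u y) (e y) (t y) = 0
  finrank_eq : Module.finrank ℝ E = Fintype.card ι + 2

/-- The matrix of the induced metric in the coordinate frame. -/
def patchMetric (b : Module.Basis ι ℝ X) (G : E → E →L[ℝ] E →L[ℝ] ℝ) (u : X → E) (y : X) :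
    Matrix ι ι ℝ :=
  Matrix.of fun i j => G (u y) (fderiv ℝ u y (b i)) (fderiv ℝ u y (b j))

/-- The tangent vector, in parameter space, of the component of `w` tangent to the patch. -/
def patchTangent (b : Module.Basis ι ℝ X) (G : E → E →L[ℝ] E →L[ℝ] ℝ) (u : X → E) (y : X) (w : E) :
    X :=
  ∑ i, ∑ j, ((patchMetric b G u y)⁻¹ i j * G (u y) w (fderiv ℝ u y (b j))) • b i

/-- The mean curvature vector of the patch. -/
def patchMeanCurvature (b : Module.Basis ι ℝ X) (G : E → E →L[ℝ] E →L[ℝ] ℝ) (u : X → E) (y : X) :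
    E :=
  ∑ i, ∑ j, (patchMetric b G u y)⁻¹ i j •
    (coordCov G u (fun x => fderiv ℝ u x (b j)) y (b i)
      - fderiv ℝ u y (patchTangent b G u y
          (coordCov G u (fun x => fderiv ℝ u x (b j)) y (b i))))

/-- The reflection of the mean curvature vector in the frame `e`, `t`. -/
def patchReflected (b : Module.Basis ι ℝ X) (G : E → E →L[ℝ] E →L[ℝ] ℝ) (u e t : X → E) (y : X) :
    E :=
  G (u y) (patchMeanCurvature b G u y) (t y) • e y
    - G (u y) (patchMeanCurvature b G u y) (e y) • t y

/-- The length of the mean curvature vector. -/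
def patchNorm (b : Module.Basis ι ℝ X) (G : E → E →L[ℝ] E →L[ℝ] ℝ) (u : X → E) (y : X) : ℝ :=
  √(G (u y) (patchMeanCurvature b G u y) (patchMeanCurvature b G u y))

/-- The connection one-form in the mean curvature gauge. -/
def patchConnection (b : Module.Basis ι ℝ X) (G : E → E →L[ℝ] E →L[ℝ] ℝ) (u e t : X → E)
    (y v : X) : ℝ :=
  G (u y) (coordCov G u (fun x => -((patchNorm b G u x)⁻¹ • patchMeanCurvature b G u x)) y v)
    ((patchNorm b G u y)⁻¹ • patchReflected b G u e t y)

namespace IsFramedPatch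

variable {b : Module.Basis ι ℝ X} {G : E → E →L[ℝ] E →L[ℝ] ℝ} {W : Set E} {O : Set X}
  {u e t : X → E} (hP : IsFramedPatch b G W O u e t) {y : X} (hy : y ∈ O)
include hP hy

lemma contDiffAt_u : ContDiffAt ℝ ∞ u y := hP.smooth_u.contDiffAt (hP.isOpen.mem_nhds hy)
lemma contDiffAt_e : ContDiffAt ℝ ∞ e y := hP.smooth_e.contDiffAt (hP.isOpen.mem_nhds hy)
lemma contDiffAt_t : ContDiffAt ℝ ∞ t y := hP.smooth_t.contDiffAt (hP.isOpen.mem_nhds hy)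

lemma contDiffAt_fderiv (v : X) : ContDiffAt ℝ ∞ (fun x => fderiv ℝ u x v) y :=
  ((hP.contDiffAt_u hy).fderiv_right (m := ∞) (by simp)).clm_apply contDiffAt_const

lemma contDiffAt_inner {n k : X → E} (hn : ContDiffAt ℝ ∞ n y) (hk : ContDiffAt ℝ ∞ k y) :
    ContDiffAt ℝ ∞ (fun x => G (u x) (n x) (k x)) y :=
  ((ContDiffAt.comp y (hP.metric.contDiffAt (hP.mapsTo hy)) (hP.contDiffAt_u hy)).clm_apply
    hn).clm_apply hk

lemma contDiffAt_patchMetric (i j : ι) : ContDiffAt ℝ ∞ (fun x => patchMetric b G u x i j) y :=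
  hP.contDiffAt_inner hy (hP.contDiffAt_fderiv hy _) (hP.contDiffAt_fderiv hy _)

lemma inner_symm (v w : E) : G (u y) v w = G (u y) w v := hP.metric.symm _ (hP.mapsTo hy) v w

lemma isScalarProduct :
    IsScalarProduct fun v w : X => G (u y) (fderiv ℝ u y v) (fderiv ℝ u y w) where
  add_left u v w := by simp
  smul_left a u w := by simp
  symm u v := hP.inner_symm hy _ _
  nondegenerate v hv := by
    by_contra h
    exact (hP.pos y hy v h).ne' (hv v)

lemma patchMetric_inv_symm (i j : ι) : (patchMetric b G u y)⁻¹ i j = (patchMetric b G u y)⁻¹ j i :=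
  (hP.isScalarProduct hy).gram_inv_symm b i j

lemma det_patchMetric_pos : 0 < (patchMetric b G u y).det := by
  refine Matrix.PosDef.det_pos (Matrix.PosDef.of_dotProduct_mulVec_pos ?_ ?_)
  · ext i j
    exact hP.inner_symm hy _ _
  · intro x hx
    have hv : ∑ i, x i • b i ≠ 0 := fun h0 => hx <| funext fun i =>
      Fintype.linearIndependent_iff.1 b.linearIndependent x h0 i
    have := hP.pos y hy _ hv
    simp only [map_sum, map_smul, _root_.sum_apply, _root_.smul_apply, smul_eq_mul] at this
    refine lt_of_lt_of_eq this ?_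
    simp only [patchMetric, dotProduct, Matrix.mulVec, Finset.mul_sum, Matrix.of_apply]
    refine Finset.sum_congr rfl fun i _ => Finset.sum_congr rfl fun j _ => ?_
    rw [hP.inner_symm hy]
    simp only [Pi.star_apply, star_trivial]
    ring

lemma contDiffAt_patchMetric_inv (i j : ι) :
    ContDiffAt ℝ ∞ (fun x => (patchMetric b G u x)⁻¹ i j) y :=
  contDiffAt_matrix_inv (hP.contDiffAt_patchMetric hy) (hP.det_patchMetric_pos hy).ne' i j

lemma contDiffAt_patchTangent {n : X → E} (hn : ContDiffAt ℝ ∞ n y) :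
    ContDiffAt ℝ ∞ (fun x => patchTangent b G u x (n x)) y :=
  ContDiffAt.sum fun i _ => ContDiffAt.sum fun j _ =>
    ((hP.contDiffAt_patchMetric_inv hy i j).mul
      (hP.contDiffAt_inner hy hn (hP.contDiffAt_fderiv hy _))).smul contDiffAt_const

lemma contDiffAt_coordCov {n : X → E} (hn : ContDiffAt ℝ ∞ n y) (v : X) :
    ContDiffAt ℝ ∞ (fun x => coordCov G u n x v) y :=
  ContDiffAt.coordCov hP.metric (hP.mapsTo hy) (hP.contDiffAt_u hy) hn v

lemma contDiffAt_patchMeanCurvature : ContDiffAt ℝ ∞ (patchMeanCurvature b G u) y := by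
  refine ContDiffAt.sum fun i _ => ContDiffAt.sum fun j _ =>
    (hP.contDiffAt_patchMetric_inv hy i j).smul ?_
  have h := hP.contDiffAt_coordCov hy (hP.contDiffAt_fderiv hy (b j)) (b i)
  exact h.sub (((hP.contDiffAt_u hy).fderiv_right (m := ∞) (by simp)).clm_apply
    (hP.contDiffAt_patchTangent hy h))

lemma contDiffAt_patchReflected : ContDiffAt ℝ ∞ (patchReflected b G u e t) y := by
  have hH := hP.contDiffAt_patchMeanCurvature hy
  exact ((hP.contDiffAt_inner hy hH (hP.contDiffAt_t hy)).smul (hP.contDiffAt_e hy)).sub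
    ((hP.contDiffAt_inner hy hH (hP.contDiffAt_e hy)).smul (hP.contDiffAt_t hy))

lemma contDiffAt_patchNorm
    (hH : 0 < G (u y) (patchMeanCurvature b G u y) (patchMeanCurvature b G u y)) :
    ContDiffAt ℝ ∞ (patchNorm b G u) y :=
  (hP.contDiffAt_inner hy (hP.contDiffAt_patchMeanCurvature hy)
    (hP.contDiffAt_patchMeanCurvature hy)).sqrt hH.ne'

lemma inner_tangent (w : E) (v : X) :
    G (u y) (fderiv ℝ u y (patchTangent b G u y w)) (fderiv ℝ u y v)
      = G (u y) w (fderiv ℝ u y v) :=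
  (hP.isScalarProduct hy).sharp_apply b
    ((G (u y) w : E →ₗ[ℝ] ℝ) ∘ₗ (fderiv ℝ u y : X →ₗ[ℝ] E)) v

/-- A vector orthogonal to the coordinate fields and to the normal frame vanishes. -/
lemma eq_zero_of_inner {w : E} (hu : ∀ v, G (u y) w (fderiv ℝ u y v) = 0)
    (he : G (u y) w (e y) = 0) (ht : G (u y) w (t y) = 0) : w = 0 := by
  let f : ι ⊕ Fin 2 → E := Sum.elim (fun i => fderiv ℝ u y (b i)) ![e y, t y]
  have hli : LinearIndependent ℝ f := by
    refine Fintype.linearIndependent_iff.2 fun c hc => ?_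
    simp only [Fintype.sum_sum_type, Fin.sum_univ_two, f, Sum.elim_inl, Sum.elim_inr,
      Matrix.cons_val_zero, Matrix.cons_val_one] at hc
    have hv : ∑ i, c (Sum.inl i) • fderiv ℝ u y (b i)
        = fderiv ℝ u y (∑ i, c (Sum.inl i) • b i) := by simp
    rw [hv] at hc
    have h0 := congrArg (fun x => G (u y) (e y) x) hc
    have h1 := congrArg (fun x => G (u y) (t y) x) hc
    simp only [map_add, map_smul, smul_eq_mul, map_zero, hP.normal_e y hy, hP.normal_t y hy,
      hP.inner_e_e y hy, hP.inner_t_t y hy, hP.inner_e_t y hy,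
      hP.inner_symm hy (t y) (e y)] at h0 h1
    have c0 : c (Sum.inr 0) = 0 := by linarith
    have c1 : c (Sum.inr 1) = 0 := by linarith
    have hz : ∑ i, c (Sum.inl i) • b i = 0 := by
      by_contra hne
      have := hP.pos y hy _ hne
      rw [c0, c1] at hc
      simp only [zero_smul, add_zero] at hc
      rw [hc] at this
      simp at this
    rintro (i | i)
    · exact Fintype.linearIndependent_iff.1 b.linearIndependent (fun i => c (Sum.inl i)) hz i
    · fin_cases i
      · exact c0
      · exact c1
  have hcard : Fintype.card (ι ⊕ Fin 2) = Module.finrank ℝ E := by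
    rw [hP.finrank_eq]; simp
  let B := basisOfLinearIndependentOfCardEqFinrank' f hli hcard
  have hzero : (G (u y) w : E →ₗ[ℝ] ℝ) = 0 := by
    refine B.ext fun k => ?_
    have hB : B k = f k := by simp [B]
    rw [hB]
    rcases k with i | i
    · exact hu _
    · fin_cases i
      · exact he
      · exact ht
  exact hP.metric.nondegenerate _ (hP.mapsTo hy) w fun z => LinearMap.congr_fun hzero z

/-- A vector is the sum of its tangential part and of its components along the normal frame. -/
lemma decomposition (w : E) :
    w = fderiv ℝ u y (patchTangent b G u y w) + (G (u y) w (e y) • e y - G (u y) w (t y) • t y) := by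
  have hne := hP.normal_e y hy
  have hnt := hP.normal_t y hy
  rw [← sub_eq_zero]
  refine hP.eq_zero_of_inner hy (fun v => ?_) ?_ ?_
  · simp [hP.inner_tangent hy, hne, hnt]
  · have h1 : ∀ v, G (u y) (fderiv ℝ u y v) (e y) = 0 := fun v => by rw [hP.inner_symm hy, hne]
    have h2 : G (u y) (t y) (e y) = 0 := by rw [hP.inner_symm hy, hP.inner_e_t y hy]
    simp [h1, h2, hP.inner_e_e y hy]
  · have h1 : ∀ v, G (u y) (fderiv ℝ u y v) (t y) = 0 := fun v => by rw [hP.inner_symm hy, hnt]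
    simp [h1, hP.inner_t_t y hy, hP.inner_e_t y hy]

lemma inner_patchMeanCurvature (v : X) :
    G (u y) (patchMeanCurvature b G u y) (fderiv ℝ u y v) = 0 := by
  simp [patchMeanCurvature, hP.inner_tangent hy]

lemma inner_patchReflected (v : X) :
    G (u y) (patchReflected b G u e t y) (fderiv ℝ u y v) = 0 := by
  simp [patchReflected, hP.normal_e y hy, hP.normal_t y hy]

lemma patchMeanCurvature_eq : patchMeanCurvature b G u y
    = G (u y) (patchMeanCurvature b G u y) (e y) • e y
      - G (u y) (patchMeanCurvature b G u y) (t y) • t y := by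
  conv_lhs => rw [hP.decomposition hy (patchMeanCurvature b G u y)]
  simp [patchTangent, hP.inner_patchMeanCurvature hy]

lemma inner_H_H : G (u y) (patchMeanCurvature b G u y) (patchMeanCurvature b G u y)
    = G (u y) (patchMeanCurvature b G u y) (e y) ^ 2
      - G (u y) (patchMeanCurvature b G u y) (t y) ^ 2 := by
  conv_lhs => arg 2; rw [hP.patchMeanCurvature_eq hy]
  simp; ring

lemma inner_H_J : G (u y) (patchMeanCurvature b G u y) (patchReflected b G u e t y) = 0 := by
  simp [patchReflected]; ring

lemma inner_J_J : G (u y) (patchReflected b G u e t y) (patchReflected b G u e t y)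
    = - G (u y) (patchMeanCurvature b G u y) (patchMeanCurvature b G u y) := by
  rw [hP.inner_H_H hy]
  have := hP.inner_symm hy (e y) (t y)
  simp [patchReflected, hP.inner_e_e y hy, hP.inner_t_t y hy, hP.inner_e_t y hy, ← this]
  ring

/-- The normal part of a vector in the orthogonal frame formed by the mean curvature vector and
its reflection. -/
lemma normal_part_eq (w : E) :
    G (u y) (patchMeanCurvature b G u y) (patchMeanCurvature b G u y) •
        (G (u y) w (e y) • e y - G (u y) w (t y) • t y)
      = G (u y) w (patchMeanCurvature b G u y) • patchMeanCurvature b G u y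
        - G (u y) w (patchReflected b G u e t y) • patchReflected b G u e t y := by
  have hH := hP.patchMeanCurvature_eq hy
  rw [hP.inner_H_H hy, patchReflected]
  generalize G (u y) (patchMeanCurvature b G u y) (e y) = r at hH ⊢
  generalize G (u y) (patchMeanCurvature b G u y) (t y) = q at hH ⊢
  rw [hH]
  simp only [map_sub, map_smul, smul_eq_mul]
  module

end IsFramedPatch
end Patch

section PatchDivergence

variable {ι : Type*} [Fintype ι] [DecidableEq ι]
  {X E : Type*} [NormedAddCommGroup X] [NormedSpace ℝ X]
  [NormedAddCommGroup E] [NormedSpace ℝ E] [FiniteDimensional ℝ E]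

/-- The null normal field `(s H + J) / |H|` for `s = ±1`. -/
def patchNull (b : Module.Basis ι ℝ X) (G : E → E →L[ℝ] E →L[ℝ] ℝ) (u e t : X → E) (s : ℝ)
    (y : X) : E :=
  (patchNorm b G u y)⁻¹ • (s • patchMeanCurvature b G u y + patchReflected b G u e t y)

/-- A contraction of a symmetric with an antisymmetric tensor vanishes. -/
lemma sum_symm_mul_antisymm_eq_zero (A M q : ι → ι → ℝ) (hA : ∀ i j, A i j = A j i)
    (hM : ∀ i j, M i j = M j i) (hq : ∀ i j, q i j = -q j i) :
    ∑ i, ∑ j, ∑ k, ∑ l, A i j * A k l * M i l * q j k = 0 := by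
  have h1 : ∑ i, ∑ j, ∑ k, ∑ l, A i j * A k l * M i l * q j k
      = ∑ p : ι × ι × ι × ι, A p.1 p.2.1 * A p.2.2.1 p.2.2.2 * M p.1 p.2.2.2 * q p.2.1 p.2.2.1 := by
    simp only [Fintype.sum_prod_type]
  let σ : ι × ι × ι × ι ≃ ι × ι × ι × ι :=
    ⟨fun p => (p.2.2.2, p.2.2.1, p.2.1, p.1), fun p => (p.2.2.2, p.2.2.1, p.2.1, p.1),
      fun _ => rfl, fun _ => rfl⟩
  have h2 := Equiv.sum_comp σ fun p : ι × ι × ι × ι =>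
    A p.1 p.2.1 * A p.2.2.1 p.2.2.2 * M p.1 p.2.2.2 * q p.2.1 p.2.2.1
  have h3 : ∀ p : ι × ι × ι × ι, A (σ p).1 (σ p).2.1 * A (σ p).2.2.1 (σ p).2.2.2
      * M (σ p).1 (σ p).2.2.2 * q (σ p).2.1 (σ p).2.2.1
      = -(A p.1 p.2.1 * A p.2.2.1 p.2.2.2 * M p.1 p.2.2.2 * q p.2.1 p.2.2.1) := by
    intro p
    simp only [σ, Equiv.coe_fn_mk]
    rw [hA p.2.2.2 p.2.2.1, hA p.2.1 p.1, hM p.2.2.2 p.1, hq p.2.2.1 p.2.1]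
    ring
  simp only [h3, Finset.sum_neg_distrib] at h2
  rw [h1]
  linarith

namespace IsFramedPatch

variable {b : Module.Basis ι ℝ X} {G : E → E →L[ℝ] E →L[ℝ] ℝ} {W : Set E} {O : Set X}
  {u e t : X → E} (hP : IsFramedPatch b G W O u e t)
  (hH : ∀ y ∈ O, 0 < G (u y) (patchMeanCurvature b G u y) (patchMeanCurvature b G u y))
  {y : X} (hy : y ∈ O)
include hP hH hy

lemma patchNorm_pos : 0 < patchNorm b G u y := Real.sqrt_pos.2 (hH y hy)

lemma patchNorm_sq : patchNorm b G u y ^ 2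
    = G (u y) (patchMeanCurvature b G u y) (patchMeanCurvature b G u y) :=
  Real.sq_sqrt (hH y hy).le

lemma contDiffAt_unitH :
    ContDiffAt ℝ ∞ (fun x => (patchNorm b G u x)⁻¹ • patchMeanCurvature b G u x) y :=
  ((hP.contDiffAt_patchNorm hy (hH y hy)).inv (hP.patchNorm_pos hH hy).ne').smul
    (hP.contDiffAt_patchMeanCurvature hy)

lemma contDiffAt_unitJ :
    ContDiffAt ℝ ∞ (fun x => (patchNorm b G u x)⁻¹ • patchReflected b G u e t x) y :=
  ((hP.contDiffAt_patchNorm hy (hH y hy)).inv (hP.patchNorm_pos hH hy).ne').smul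
    (hP.contDiffAt_patchReflected hy)

lemma patchNull_eq (s : ℝ) : patchNull b G u e t s = fun x =>
    s • ((patchNorm b G u x)⁻¹ • patchMeanCurvature b G u x)
      + (patchNorm b G u x)⁻¹ • patchReflected b G u e t x := by
  ext x; simp only [patchNull]; module

lemma contDiffAt_patchNull (s : ℝ) : ContDiffAt ℝ ∞ (patchNull b G u e t s) y := by
  rw [hP.patchNull_eq hH hy]
  exact (contDiffAt_const.smul (hP.contDiffAt_unitH hH hy)).add (hP.contDiffAt_unitJ hH hy)

lemma contDiffAt_patchConnection (v : X) :
    ContDiffAt ℝ ∞ (fun x => patchConnection b G u e t x v) y :=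
  hP.contDiffAt_inner hy (hP.contDiffAt_coordCov hy (hP.contDiffAt_unitH hH hy).neg v)
    (hP.contDiffAt_unitJ hH hy)

/-- The field `H / |H|` is a unit spacelike field, `J / |H|` a unit timelike field orthogonal to
it. Hence the derivatives of the two fields have no other normal components than the connection
form. -/
lemma inner_coordCov_unit (v : X) :
    let ν := fun x => (patchNorm b G u x)⁻¹ • patchMeanCurvature b G u x
    let μ := fun x => (patchNorm b G u x)⁻¹ • patchReflected b G u e t x
    G (u y) (coordCov G u ν y v) (ν y) = 0 ∧ G (u y) (coordCov G u μ y v) (μ y) = 0 ∧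
      G (u y) (coordCov G u ν y v) (μ y) = -patchConnection b G u e t y v ∧
      G (u y) (coordCov G u μ y v) (ν y) = patchConnection b G u e t y v := by
  intro ν μ
  have hν : DifferentiableAt ℝ ν y := (hP.contDiffAt_unitH hH hy).differentiableAt (by simp)
  have hμ : DifferentiableAt ℝ μ y := (hP.contDiffAt_unitJ hH hy).differentiableAt (by simp)
  have hu : DifferentiableAt ℝ u y := (hP.contDiffAt_u hy).differentiableAt (by simp)
  have hW := hP.mapsTo hy
  have key : ∀ {n k : X → E} {r : ℝ}, DifferentiableAt ℝ n y → DifferentiableAt ℝ k y →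
      (∀ x ∈ O, G (u x) (n x) (k x) = r) →
      G (u y) (coordCov G u n y v) (k y) + G (u y) (n y) (coordCov G u k y v) = 0 := by
    intro n k r hn hk hr
    rw [← fderiv_inner_along hP.metric hW hu hn hk]
    have : (fun x => G (u x) (n x) (k x)) =ᶠ[𝓝 y] fun _ => r := by
      filter_upwards [hP.isOpen.mem_nhds hy] with x hx using hr x hx
    rw [this.fderiv_eq]; simp
  have hνν := key hν hν (r := 1) fun x hx => by
    have := hP.patchNorm_sq hH hx
    have h0 := (hP.patchNorm_pos hH hx).ne'
    simp only [ν, map_smul, _root_.smul_apply, smul_eq_mul, ← this]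
    field_simp
  have hμμ := key hμ hμ (r := -1) fun x hx => by
    have := hP.patchNorm_sq hH hx
    have h0 := (hP.patchNorm_pos hH hx).ne'
    simp only [μ, map_smul, _root_.smul_apply, smul_eq_mul, hP.inner_J_J hx, ← this]
    field_simp
  have hνμ := key hν hμ (r := 0) fun x hx => by
    simp [ν, μ, hP.inner_H_J hx]
  rw [hP.inner_symm hy (ν y)] at hνν hνμ
  rw [hP.inner_symm hy (μ y)] at hμμ
  have hα : G (u y) (coordCov G u ν y v) (μ y) = -patchConnection b G u e t y v := by
    have : coordCov G u (fun x => -ν x) y v = -coordCov G u ν y v := by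
      have := coordCov_smul hP.metric hW (differentiableAt_const (-1 : ℝ)) hν v
      simpa using this
    simp only [patchConnection]
    rw [show (fun x => -((patchNorm b G u x)⁻¹ • patchMeanCurvature b G u x)) = fun x => -ν x from
      rfl, this]
    simp [μ]
  refine ⟨by linarith, by linarith, hα, by linarith⟩

/-- In the mean curvature gauge the null field `ℓ` is a parallel section of the normal bundle up to
the connection form: `D_v ℓ = s α(v) ℓ` modulo tangent vectors. -/
lemma coordCov_patchNull {s : ℝ} (hs : s ^ 2 = 1) (v : X) :
    coordCov G u (patchNull b G u e t s) y v
      = fderiv ℝ u y (patchTangent b G u y (coordCov G u (patchNull b G u e t s) y v))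
        + (s * patchConnection b G u e t y v) • patchNull b G u e t s y := by
  set ν := fun x => (patchNorm b G u x)⁻¹ • patchMeanCurvature b G u x with hνd
  set μ := fun x => (patchNorm b G u x)⁻¹ • patchReflected b G u e t x with hμd
  have hν : DifferentiableAt ℝ ν y := (hP.contDiffAt_unitH hH hy).differentiableAt (by simp)
  have hμ : DifferentiableAt ℝ μ y := (hP.contDiffAt_unitJ hH hy).differentiableAt (by simp)
  have hℓ : patchNull b G u e t s = fun x => s • ν x + μ x := hP.patchNull_eq hH hy s
  have hN := (hP.patchNorm_pos hH hy).ne'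
  obtain ⟨h1, h2, h3, h4⟩ := hP.inner_coordCov_unit hH hy v
  have hw : coordCov G u (patchNull b G u e t s) y v
      = s • coordCov G u ν y v + coordCov G u μ y v := by
    have hsν : DifferentiableAt ℝ (fun x => s • ν x) y := hν.const_smul s
    rw [hℓ, coordCov_add hP.metric (hP.mapsTo hy) hsν hμ,
      coordCov_smul hP.metric (hP.mapsTo hy) (differentiableAt_const s) hν]
    simp
  set w := coordCov G u (patchNull b G u e t s) y v with hwd
  have hnorm : ∀ w, G (u y) w (e y) • e y - G (u y) w (t y) • t y
      = G (u y) w (ν y) • ν y - G (u y) w (μ y) • μ y := by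
    intro w
    have := hP.normal_part_eq hy w
    rw [← hP.patchNorm_sq hH hy] at this
    rw [(eq_inv_smul_iff₀ (pow_ne_zero 2 hN)).2 this, smul_sub]
    simp only [ν, μ, map_smul, smul_eq_mul, smul_smul]
    congr 2 <;> ring
  conv_lhs => rw [hP.decomposition hy w, hnorm]
  congr 1
  have e1 : G (u y) w (ν y) = patchConnection b G u e t y v := by
    rw [hw]
    simp only [map_add, map_smul, _root_.add_apply, _root_.smul_apply, smul_eq_mul]
    rw [h1, h4]; ring
  have e2 : G (u y) w (μ y) = -(s * patchConnection b G u e t y v) := by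
    rw [hw]
    simp only [map_add, map_smul, _root_.add_apply, _root_.smul_apply, smul_eq_mul]
    rw [h2, h3]; ring
  rw [e1, e2, hℓ]
  simp only [smul_add, smul_smul]
  rw [show s * patchConnection b G u e t y v * s = s ^ 2 * patchConnection b G u e t y v by ring,
    hs]
  module

/-- The trace of the conformal Killing-Yano equation over the tangent space of the patch. -/
lemma trace_coordCovForm {q : E → E →L[ℝ] E →L[ℝ] ℝ} {κ : ℝ} {ξ ℓ : E}
    (hℓ : ∀ v, G (u y) (fderiv ℝ u y v) ℓ = 0)
    (hq : ∀ a c d, coordCovForm G q (u y) a c d + coordCovForm G q (u y) c a d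
      = κ * (G (u y) a c * G (u y) ξ d - 1 / 2 * (G (u y) a d * G (u y) ξ c)
        - 1 / 2 * (G (u y) c d * G (u y) ξ a))) :
    ∑ i, ∑ j, (patchMetric b G u y)⁻¹ i j *
        coordCovForm G q (u y) (fderiv ℝ u y (b i)) (fderiv ℝ u y (b j)) ℓ
      = κ / 2 * Fintype.card ι * G (u y) ξ ℓ := by
  set T := ∑ i, ∑ j, (patchMetric b G u y)⁻¹ i j *
        coordCovForm G q (u y) (fderiv ℝ u y (b i)) (fderiv ℝ u y (b j)) ℓ with hT
  have hT' : T = ∑ i, ∑ j, (patchMetric b G u y)⁻¹ i j *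
        coordCovForm G q (u y) (fderiv ℝ u y (b j)) (fderiv ℝ u y (b i)) ℓ := by
    rw [hT, Finset.sum_comm]
    exact Finset.sum_congr rfl fun i _ => Finset.sum_congr rfl fun j _ => by
      rw [hP.patchMetric_inv_symm hy]
  have h2 : T + T = ∑ i, κ * G (u y) ξ ℓ * ∑ j, (patchMetric b G u y)⁻¹ i j *
      G (u y) (fderiv ℝ u y (b j)) (fderiv ℝ u y (b i)) := by
    conv_lhs => arg 2; rw [hT']
    rw [hT, ← Finset.sum_add_distrib]
    refine Finset.sum_congr rfl fun i _ => ?_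
    rw [← Finset.sum_add_distrib, Finset.mul_sum]
    refine Finset.sum_congr rfl fun j _ => ?_
    rw [← mul_add, hq, hℓ, hℓ, hP.inner_symm hy (fderiv ℝ u y (b i))]
    ring
  have h3 : ∀ i, ∑ j, (patchMetric b G u y)⁻¹ i j *
      G (u y) (fderiv ℝ u y (b j)) (fderiv ℝ u y (b i)) = 1 := fun i => by
    have := (hP.isScalarProduct hy).sum_gram_inv_mul b i i
    rw [if_pos rfl] at this
    exact this
  simp only [h3, mul_one, Finset.sum_const, Finset.card_univ, nsmul_eq_mul] at h2
  linarith

lemma inner_patchNull (s : ℝ) (v : X) :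
    G (u y) (fderiv ℝ u y v) (patchNull b G u e t s y) = 0 := by
  rw [hP.inner_symm hy]
  simp [patchNull, hP.inner_patchMeanCurvature hy, hP.inner_patchReflected hy]

/-- The divergence of the one-form `φ Q(·, ℓ)`, in coordinates. Here `κ = 2 / n` is the constant of
the conformal Killing-Yano equation. -/
theorem sum_fderiv_eq {q : E → E →L[ℝ] E →L[ℝ] ℝ} (hqd : DifferentiableAt ℝ q (u y))
    (hqa : ∀ a, q (u y) a a = 0) {κ : ℝ} {ξ : E}
    (hq : ∀ a c d, coordCovForm G q (u y) a c d + coordCovForm G q (u y) c a d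
      = κ * (G (u y) a c * G (u y) ξ d - 1 / 2 * (G (u y) a d * G (u y) ξ c)
        - 1 / 2 * (G (u y) c d * G (u y) ξ a)))
    {s : ℝ} (hs : s ^ 2 = 1) {φ : X → ℝ} (hφ : DifferentiableAt ℝ φ y) :
    ∑ i, fderiv ℝ (fun x => √(patchMetric b G u x).det * ∑ j, (patchMetric b G u x)⁻¹ i j *
        (φ x * q (u x) (fderiv ℝ u x (b j)) (patchNull b G u e t s x))) y (b i)
      = √(patchMetric b G u y).det *
        (κ / 2 * Fintype.card ι * (φ y * G (u y) ξ (patchNull b G u e t s y))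
          + φ y * q (u y) (patchMeanCurvature b G u y) (patchNull b G u e t s y)
          + q (u y) (fderiv ℝ u y
              ((∑ i, ∑ j, ((patchMetric b G u y)⁻¹ i j * fderiv ℝ φ y (b j)) • b i)
                + (s * φ y) • ∑ i, ∑ j, ((patchMetric b G u y)⁻¹ i j *
                  patchConnection b G u e t y (b j)) • b i)) (patchNull b G u e t s y)) := by
  have hW := hP.mapsTo hy
  have hu : DifferentiableAt ℝ u y := (hP.contDiffAt_u hy).differentiableAt (by simp)
  have hU : ∀ j, DifferentiableAt ℝ (fun x => fderiv ℝ u x (b j)) y := fun j =>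
    (hP.contDiffAt_fderiv hy (b j)).differentiableAt (by simp)
  have hL : DifferentiableAt ℝ (patchNull b G u e t s) y :=
    (hP.contDiffAt_patchNull hH hy s).differentiableAt (by simp)
  have hqq : ∀ a c, q (u y) a c = -q (u y) c a := fun a c => by
    have := hqa (a + c)
    simp only [map_add, _root_.add_apply, hqa] at this
    linarith
  have hqj : ∀ j, DifferentiableAt ℝ
      (fun x => q (u x) (fderiv ℝ u x (b j)) (patchNull b G u e t s x)) y := fun j =>
    ((hqd.comp y hu).clm_apply (hU j)).clm_apply hL
  set ℓ := patchNull b G u e t s with hℓ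
  set A := fun i j => (patchMetric b G u y)⁻¹ i j with hA
  have hAs : ∀ i j, A i j = A j i := hP.patchMetric_inv_symm hy
  set U := fun j => fderiv ℝ u y (b j) with hUd
  set D := fun i j => coordCov G u (fun x => fderiv ℝ u x (b j)) y (b i) with hD
  have hDs : ∀ i j, D i j = D j i := fun i j =>
    coordCov_fderiv_symm hP.metric hW (hP.contDiffAt_u hy) _ _
  have hT : ∀ w, fderiv ℝ u y (patchTangent b G u y w) = ∑ k, ∑ l, (A k l * G (u y) w (U l)) • U k :=
    fun w => by simp [patchTangent, A, U]
  -- By the Gauss formula, `⟨D i j, U l⟩` are the Christoffel symbols of the induced metric, of the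
  -- first kind, so no intrinsic connection of the patch is needed.
  rw [sum_fderiv_sqrt_det_mul_inv_mul b
    (fun i j => (hP.contDiffAt_patchMetric hy i j).of_le (by norm_cast))
    (fun j => hφ.fun_mul (hqj j)) (hP.det_patchMetric_pos hy)
    (hP.patchMetric_inv_symm hy) (fun i j l => G (u y) (D i j) (U l))
    (fun i j l => by rw [hDs]) (fun i j l => by
      have := fderiv_inner_along hP.metric hW hu (hU j) (hU l) (b i)
      refine this.trans ?_
      rw [hP.inner_symm hy (fderiv ℝ u y (b j))])]
  congr 1
  have hder : ∀ i j, fderiv ℝ (fun x => φ x * q (u x) (fderiv ℝ u x (b j)) (ℓ x)) y (b i)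
      = fderiv ℝ φ y (b i) * q (u y) (U j) (ℓ y) + φ y * (coordCovForm G q (u y) (U i) (U j) (ℓ y)
        + q (u y) (D i j) (ℓ y) + q (u y) (U j) (coordCov G u ℓ y (b i))) := by
    intro i j
    rw [fderiv_fun_mul hφ (hqj j)]
    simp only [_root_.add_apply, _root_.smul_apply, smul_eq_mul]
    rw [fderiv_form_along (G := G) hqd hu (hU j) hL]
    ring
  have hchr : ∀ i j, ∑ k, ∑ l, (patchMetric b G u y)⁻¹ l k * G (u y) (D i j) (U l) *
      (φ y * q (u y) (U k) (ℓ y)) = φ y * q (u y) (fderiv ℝ u y (patchTangent b G u y (D i j))) (ℓ y) := by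
    intro i j
    rw [hT]
    simp only [map_sum, map_smul, _root_.sum_apply, _root_.smul_apply, smul_eq_mul, Finset.mul_sum]
    refine Finset.sum_congr rfl fun k _ => Finset.sum_congr rfl fun l _ => ?_
    rw [hP.patchMetric_inv_symm hy l k]
    ring
  have htr := hP.trace_coordCovForm hH hy (hP.inner_patchNull hH hy s) hq
  -- Subtracting the tangential part, which is what `hchr` produces, leaves the trace of the second
  -- fundamental form.
  have hHq : q (u y) (patchMeanCurvature b G u y) (ℓ y) = ∑ i, ∑ j, A i j *
      (q (u y) (D i j) (ℓ y) - q (u y) (fderiv ℝ u y (patchTangent b G u y (D i j))) (ℓ y)) := by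
    simp [patchMeanCurvature, A, D]
  have hcov : ∑ i, ∑ j, A i j * q (u y) (U j) (coordCov G u ℓ y (b i))
      = s * ∑ i, ∑ j, A i j * patchConnection b G u e t y (b i) * q (u y) (U j) (ℓ y) := by
    -- The tangential part of `D ℓ` does not contribute: it is self-adjoint and `q` is alternating.
    have htan : ∑ i, ∑ j, ∑ k, ∑ l, A i j * A k l * G (u y) (coordCov G u ℓ y (b i)) (U l)
        * q (u y) (U j) (U k) = 0 := by
      refine sum_symm_mul_antisymm_eq_zero A (fun i l => G (u y) (coordCov G u ℓ y (b i)) (U l))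
        (fun j k => q (u y) (U j) (U k)) hAs (fun i l => ?_) (fun j k => hqq _ _)
      -- The tangential part of `D ℓ` is minus the second fundamental form along `ℓ`.
      have hsff : ∀ i l, G (u y) (coordCov G u ℓ y (b i)) (U l) = -G (u y) (D i l) (ℓ y) := by
        intro i l
        have h0 := fderiv_inner_along hP.metric hW hu (hU l) hL (b i)
        have : (fun x => G (u x) (fderiv ℝ u x (b l)) (ℓ x)) =ᶠ[𝓝 y] fun _ => 0 := by
          filter_upwards [hP.isOpen.mem_nhds hy] with x hx using hP.inner_patchNull hH hx s _
        rw [this.fderiv_eq] at h0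
        simp only [fderiv_fun_const, Pi.zero_apply, _root_.zero_apply] at h0
        rw [hP.inner_symm hy]
        linarith
      rw [hsff, hsff, hDs]
    have hsplit : ∀ i j, A i j * q (u y) (U j) (coordCov G u ℓ y (b i))
        = (∑ k, ∑ l, A i j * A k l * G (u y) (coordCov G u ℓ y (b i)) (U l) * q (u y) (U j) (U k))
          + s * (A i j * patchConnection b G u e t y (b i) * q (u y) (U j) (ℓ y)) := by
      intro i j
      conv_lhs => rw [hP.coordCov_patchNull hH hy hs (b i)]
      rw [hT]
      simp only [map_add, map_sum, map_smul, smul_eq_mul, mul_add, Finset.mul_sum]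
      congr 1
      · exact Finset.sum_congr rfl fun k _ => Finset.sum_congr rfl fun l _ => by ring
      · ring
    simp only [hsplit, Finset.sum_add_distrib, htan, Finset.mul_sum, zero_add]
  have hflip : ∀ a : ι → ℝ, q (u y) (fderiv ℝ u y (∑ i, ∑ j, (A i j * a j) • b i)) (ℓ y)
      = ∑ i, ∑ j, A i j * a i * q (u y) (U j) (ℓ y) := by
    intro a
    simp only [map_sum, map_smul, _root_.sum_apply, _root_.smul_apply, smul_eq_mul]
    rw [Finset.sum_comm]
    exact Finset.sum_congr rfl fun i _ => Finset.sum_congr rfl fun j _ => by rw [hAs]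
  simp only [map_add, map_smul, _root_.add_apply, _root_.smul_apply, smul_eq_mul]
  rw [show (∑ i, ∑ j, ((patchMetric b G u y)⁻¹ i j * fderiv ℝ φ y (b j)) • b i)
      = ∑ i, ∑ j, (A i j * fderiv ℝ φ y (b j)) • b i from rfl,
    show (∑ i, ∑ j, ((patchMetric b G u y)⁻¹ i j * patchConnection b G u e t y (b j)) • b i)
      = ∑ i, ∑ j, (A i j * patchConnection b G u e t y (b j)) • b i from rfl,
    hflip fun i => fderiv ℝ φ y (b i), hflip fun i => patchConnection b G u e t y (b i),
    mul_assoc s, mul_left_comm s, ← hcov, hHq,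
    show κ / 2 * Fintype.card ι * (φ y * G (u y) ξ (ℓ y))
      = φ y * (κ / 2 * Fintype.card ι * G (u y) ξ (ℓ y)) by ring, ← htr]
  refine Eq.trans (Finset.sum_congr rfl fun i _ => Finset.sum_congr rfl fun j _ =>
    congrArg (A i j * ·) (congrArg₂ (· - ·) (hder i j) (hchr i j))) ?_
  simp only [Finset.mul_sum, ← Finset.sum_add_distrib]
  refine Finset.sum_congr rfl fun i _ => Finset.sum_congr rfl fun j _ => ?_
  simp only [A, U, ← hℓ]
  ring

end IsFramedPatch
end PatchDivergence

/-! ### Tangent vectors and vector fields in a chart -/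

section ChartCoordinates

variable {k : ℕ} {M : Type*} [TopologicalSpace M] [ChartedSpace (EuclideanSpace ℝ (Fin k)) M]
  [IsManifold (𝓡 k) ∞ M] {F : Type*} [NormedAddCommGroup F] [NormedSpace ℝ F]

/-- The components of tangent vectors at `x` in the chart at `d`. -/
def chartCoord (d x : M) : TangentSpace (𝓡 k) x →L[ℝ] EuclideanSpace ℝ (Fin k) :=
  (trivializationAt (EuclideanSpace ℝ (Fin k)) (TangentSpace (𝓡 k) : M → Type _)
    d).continuousLinearMapAt ℝ x

/-- The tangent vector at `x` with given components in the chart at `d`. -/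
def chartFrame (d x : M) : EuclideanSpace ℝ (Fin k) →L[ℝ] TangentSpace (𝓡 k) x :=
  (trivializationAt (EuclideanSpace ℝ (Fin k)) (TangentSpace (𝓡 k) : M → Type _) d).symmL ℝ x

variable {d x : M} (hx : x ∈ (chartAt (EuclideanSpace ℝ (Fin k)) d).source)
include hx

lemma chartCoord_chartFrame (a : EuclideanSpace ℝ (Fin k)) :
    chartCoord d x (chartFrame d x a) = a :=
  Trivialization.continuousLinearMapAt_symmL _ (by simpa using hx) a

lemma chartFrame_chartCoord (v : TangentSpace (𝓡 k) x) :
    chartFrame d x (chartCoord d x v) = v :=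
  Trivialization.symmL_continuousLinearMapAt _ (by simpa using hx) v

lemma chartCoord_eq_mfderiv :
    chartCoord d x = mfderiv (𝓡 k) 𝓘(ℝ, EuclideanSpace ℝ (Fin k)) (extChartAt (𝓡 k) d) x :=
  TangentBundle.continuousLinearMapAt_trivializationAt hx

lemma chartFrame_eq_mfderiv :
    chartFrame d x = mfderiv 𝓘(ℝ, EuclideanSpace ℝ (Fin k)) (𝓡 k) (extChartAt (𝓡 k) d).symm
      (extChartAt (𝓡 k) d x) := by
  have := TangentBundle.symmL_trivializationAt (I := 𝓡 k) hx
  rw [ModelWithCorners.range_eq_univ, mfderivWithin_univ] at this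
  exact this

lemma extChartAt_mem_target : extChartAt (𝓡 k) d x ∈ (extChartAt (𝓡 k) d).target :=
  (extChartAt (𝓡 k) d).map_source (by rwa [extChartAt_source])

lemma extChartAt_symm_extChartAt : (extChartAt (𝓡 k) d).symm (extChartAt (𝓡 k) d x) = x :=
  (extChartAt (𝓡 k) d).left_inv (by rwa [extChartAt_source])

lemma target_mem_nhds : (extChartAt (𝓡 k) d).target ∈ 𝓝 (extChartAt (𝓡 k) d x) :=
  (isOpen_extChartAt_target d).mem_nhds (extChartAt_mem_target hx)

lemma mdifferentiableAt_iff_chart {f : M → F} : MDifferentiableAt (𝓡 k) 𝓘(ℝ, F) f x ↔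
    DifferentiableAt ℝ (f ∘ (extChartAt (𝓡 k) d).symm) (extChartAt (𝓡 k) d x) := by
  rw [mdifferentiableAt_iff_source_of_mem_source hx, ModelWithCorners.range_eq_univ,
    mdifferentiableWithinAt_univ, mdifferentiableAt_iff_differentiableAt]

lemma contMDiffAt_iff_chart {f : M → F} : ContMDiffAt (𝓡 k) 𝓘(ℝ, F) ∞ f x ↔
    ContDiffAt ℝ ∞ (f ∘ (extChartAt (𝓡 k) d).symm) (extChartAt (𝓡 k) d x) := by
  rw [contMDiffAt_iff_source_of_mem_source hx, ModelWithCorners.range_eq_univ,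
    contMDiffWithinAt_univ, contMDiffAt_iff_contDiffAt]

lemma mvfderiv_eq_fderiv_chart {f : M → F} (hf : MDifferentiableAt (𝓡 k) 𝓘(ℝ, F) f x)
    (v : TangentSpace (𝓡 k) x) : mvfderiv (𝓡 k) f x v
      = fderiv ℝ (f ∘ (extChartAt (𝓡 k) d).symm) (extChartAt (𝓡 k) d x) (chartCoord d x v) := by
  have hg := (mdifferentiableAt_iff_chart hx).1 hf
  have hφ : MDifferentiableAt (𝓡 k) 𝓘(ℝ, EuclideanSpace ℝ (Fin k)) (extChartAt (𝓡 k) d) x :=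
    mdifferentiableAt_extChartAt hx
  have hev : f =ᶠ[𝓝 x] (f ∘ (extChartAt (𝓡 k) d).symm) ∘ extChartAt (𝓡 k) d := by
    filter_upwards [(chartAt (EuclideanSpace ℝ (Fin k)) d).open_source.mem_nhds hx] with y hy
    simp only [Function.comp_apply]
    rw [extChartAt_symm_extChartAt hy]
  have h1 := (hg.hasFDerivAt.hasMFDerivAt.comp x hφ.hasMFDerivAt).congr_of_eventuallyEq hev
  rw [chartCoord_eq_mfderiv hx, mvfderiv, h1.mfderiv]
  rfl

/-- A vector field is differentiable iff its components in a chart are. -/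
lemma vectorFieldDiffAt_iff_chart {Y : Π y : M, TangentSpace (𝓡 k) y} : VectorFieldDiffAt Y x ↔
    DifferentiableAt ℝ (fun z => chartCoord d ((extChartAt (𝓡 k) d).symm z)
      (Y ((extChartAt (𝓡 k) d).symm z))) (extChartAt (𝓡 k) d x) := by
  have hb : x ∈ (trivializationAt (EuclideanSpace ℝ (Fin k)) (TangentSpace (𝓡 k) : M → Type _)
    d).baseSet := by simpa using hx
  rw [VectorFieldDiffAt]
  refine (Trivialization.mdifferentiableAt_section_iff (𝓡 k) (trivializationAt
    (EuclideanSpace ℝ (Fin k)) (TangentSpace (𝓡 k) : M → Type _) d) Y hb).trans ?_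
  rw [mdifferentiableAt_iff_chart hx]
  refine Filter.EventuallyEq.differentiableAt_iff ?_
  filter_upwards [target_mem_nhds hx] with z hz
  have hz' : (extChartAt (𝓡 k) d).symm z ∈ (chartAt (EuclideanSpace ℝ (Fin k)) d).source := by
    rw [← extChartAt_source (𝓡 k)]
    exact (extChartAt (𝓡 k) d).map_target hz
  rw [chartCoord, Trivialization.continuousLinearMapAt_apply,
    Trivialization.coe_linearMapAt_of_mem]
  · rfl
  · simpa using hz'

omit hx in
lemma symm_mem_source {z : EuclideanSpace ℝ (Fin k)} (hz : z ∈ (extChartAt (𝓡 k) d).target) :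
    (extChartAt (𝓡 k) d).symm z ∈ (chartAt (EuclideanSpace ℝ (Fin k)) d).source := by
  rw [← extChartAt_source (𝓡 k)]
  exact (extChartAt (𝓡 k) d).map_target hz

lemma vectorFieldDiffAt_chartFrame (a : EuclideanSpace ℝ (Fin k)) :
    VectorFieldDiffAt (fun y : M => chartFrame d y a) x := by
  rw [vectorFieldDiffAt_iff_chart hx]
  refine (differentiableAt_const a).congr_of_eventuallyEq ?_
  filter_upwards [target_mem_nhds hx] with z hz
  exact chartCoord_chartFrame (symm_mem_source hz) a

omit hx in
/-- The constant vector field on a Euclidean space, seen as a section of its tangent bundle. -/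
def constField (a : EuclideanSpace ℝ (Fin k)) :
    Π z : EuclideanSpace ℝ (Fin k), TangentSpace 𝓘(ℝ, EuclideanSpace ℝ (Fin k)) z :=
  fun _ => a

/-- Coordinate vector fields commute. -/
lemma mlieBracket_chartFrame (a b : EuclideanSpace ℝ (Fin k)) :
    VectorField.mlieBracket (𝓡 k) (fun y : M => chartFrame d y a) (fun y => chartFrame d y b) x
      = 0 := by
  have key : ∀ a : EuclideanSpace ℝ (Fin k), (fun y : M => chartFrame d y a) =ᶠ[𝓝 x]
      VectorField.mpullback (𝓡 k) 𝓘(ℝ, EuclideanSpace ℝ (Fin k)) (extChartAt (𝓡 k) d)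
        (constField a) := by
    intro a
    filter_upwards [(chartAt (EuclideanSpace ℝ (Fin k)) d).open_source.mem_nhds hx] with y hy
    have hinv : (mfderiv (𝓡 k) 𝓘(ℝ, EuclideanSpace ℝ (Fin k))
        (extChartAt (𝓡 k) d) y).IsInvertible :=
      isInvertible_mfderiv_extChartAt (by rwa [extChartAt_source])
    refine Eq.trans ?_ VectorField.mpullback_apply.symm
    refine (hinv.inverse_apply_eq.2 ?_).symm
    rw [← chartCoord_eq_mfderiv hy]
    exact (chartCoord_chartFrame hy a).symm
  have : IsManifold (𝓡 k) (minSmoothness ℝ 2) M := by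
    rw [minSmoothness_of_isRCLikeNormedField]
    exact IsManifold.of_le (n := ∞) (by norm_cast)
  rw [(key a).mlieBracket_vectorField_eq (key b)]
  have hd : ∀ a : EuclideanSpace ℝ (Fin k), MDifferentiableAt 𝓘(ℝ, EuclideanSpace ℝ (Fin k))
      (𝓘(ℝ, EuclideanSpace ℝ (Fin k)).prod 𝓘(ℝ, EuclideanSpace ℝ (Fin k)))
      (fun z => (⟨z, constField a z⟩ : TangentBundle 𝓘(ℝ, EuclideanSpace ℝ (Fin k))
        (EuclideanSpace ℝ (Fin k)))) (extChartAt (𝓡 k) d x) := fun a =>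
    ((contMDiffAt_vectorSpace_iff_contDiffAt (n := 1) (V := constField a)).2
      contDiffAt_const).mdifferentiableAt one_ne_zero
  have h := VectorField.mpullback_mlieBracket (I := 𝓡 k) (I' := 𝓘(ℝ, EuclideanSpace ℝ (Fin k)))
    (f := extChartAt (𝓡 k) d) (V := constField a) (W := constField b) (x₀ := x) (n := ∞)
    (hd a) (hd b) (contMDiffAt_extChartAt' hx)
    (by rw [minSmoothness_of_isRCLikeNormedField]; norm_cast)
  rw [← h, VectorField.mpullback_apply]
  have : VectorField.mlieBracket 𝓘(ℝ, EuclideanSpace ℝ (Fin k))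
      (constField a) (constField b) (extChartAt (𝓡 k) d x) = 0 := by
    rw [← VectorField.mlieBracketWithin_univ, VectorField.mlieBracketWithin_eq_lieBracketWithin]
    exact (by simp [VectorField.lieBracketWithin] : VectorField.lieBracketWithin ℝ
      (fun _ : EuclideanSpace ℝ (Fin k) => a) (fun _ => b) Set.univ (extChartAt (𝓡 k) d x) = 0)
  rw [this, map_zero]

end ChartCoordinates

/-! ### Bilinear forms and connections in a chart -/

section FormChart

variable {k : ℕ} {M : Type*} [TopologicalSpace M] [ChartedSpace (EuclideanSpace ℝ (Fin k)) M]
  [IsManifold (𝓡 k) ∞ M]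

/-- The components of a field of bilinear forms in the chart at `d`, as a function on the target of
that chart. -/
def formChart (B : Π x : M, TangentSpace (𝓡 k) x →L[ℝ] TangentSpace (𝓡 k) x →L[ℝ] ℝ) (d : M)
    (z : EuclideanSpace ℝ (Fin k)) :
    EuclideanSpace ℝ (Fin k) →L[ℝ] EuclideanSpace ℝ (Fin k) →L[ℝ] ℝ :=
  (ContinuousLinearMap.precomp ℝ (chartFrame d ((extChartAt (𝓡 k) d).symm z))).comp
    ((B ((extChartAt (𝓡 k) d).symm z)).comp (chartFrame d ((extChartAt (𝓡 k) d).symm z)))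

lemma formChart_apply (B : Π x : M, TangentSpace (𝓡 k) x →L[ℝ] TangentSpace (𝓡 k) x →L[ℝ] ℝ)
    (d : M) (z a b : EuclideanSpace ℝ (Fin k)) :
    formChart B d z a b = B ((extChartAt (𝓡 k) d).symm z)
      (chartFrame d ((extChartAt (𝓡 k) d).symm z) a)
      (chartFrame d ((extChartAt (𝓡 k) d).symm z) b) := rfl

lemma formChart_extChartAt (B : Π x : M, TangentSpace (𝓡 k) x →L[ℝ] TangentSpace (𝓡 k) x →L[ℝ] ℝ)
    {d x : M} (hx : x ∈ (chartAt (EuclideanSpace ℝ (Fin k)) d).source)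
    (a b : EuclideanSpace ℝ (Fin k)) :
    formChart B d (extChartAt (𝓡 k) d x) a b = B x (chartFrame d x a) (chartFrame d x b) := by
  rw [formChart_apply, extChartAt_symm_extChartAt hx]

lemma formChart_chartCoord (B : Π x : M, TangentSpace (𝓡 k) x →L[ℝ] TangentSpace (𝓡 k) x →L[ℝ] ℝ)
    {d x : M} (hx : x ∈ (chartAt (EuclideanSpace ℝ (Fin k)) d).source)
    (v w : TangentSpace (𝓡 k) x) :
    formChart B d (extChartAt (𝓡 k) d x) (chartCoord d x v) (chartCoord d x w) = B x v w := by
  rw [formChart_extChartAt B hx, chartFrame_chartCoord hx, chartFrame_chartCoord hx]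

lemma contMDiffAt_chartFrame {d x : M} (hx : x ∈ (chartAt (EuclideanSpace ℝ (Fin k)) d).source)
    (a : EuclideanSpace ℝ (Fin k)) :
    ContMDiffAt (𝓡 k) ((𝓡 k).prod 𝓘(ℝ, EuclideanSpace ℝ (Fin k))) ∞
      (fun y => TotalSpace.mk' (EuclideanSpace ℝ (Fin k))
        (E := (TangentSpace (𝓡 k) : M → Type _)) y (chartFrame d y a)) x := by
  have hb : x ∈ (trivializationAt (EuclideanSpace ℝ (Fin k)) (TangentSpace (𝓡 k) : M → Type _)
    d).baseSet := by simpa using hx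
  refine (Trivialization.contMDiffAt_section_iff (IB := 𝓡 k) (e := trivializationAt
    (EuclideanSpace ℝ (Fin k)) (TangentSpace (𝓡 k) : M → Type _) d)
    (s := fun y => chartFrame d y a) hb).2 ?_
  refine (contMDiffAt_const (c := a)).congr_of_eventuallyEq ?_
  filter_upwards [(chartAt (EuclideanSpace ℝ (Fin k)) d).open_source.mem_nhds hx] with y hy
  have h := chartCoord_chartFrame hy a
  rw [chartCoord, Trivialization.continuousLinearMapAt_apply,
    Trivialization.coe_linearMapAt_of_mem] at h
  · exact h
  · simpa using hy

lemma contDiffOn_formChart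
    {B : Π x : M, TangentSpace (𝓡 k) x →L[ℝ] TangentSpace (𝓡 k) x →L[ℝ] ℝ}
    (hB : ContMDiff (𝓡 k) ((𝓡 k).prod 𝓘(ℝ, EuclideanSpace ℝ (Fin k) →L[ℝ]
      EuclideanSpace ℝ (Fin k) →L[ℝ] ℝ)) ∞
    (fun x => TotalSpace.mk' (EuclideanSpace ℝ (Fin k) →L[ℝ] EuclideanSpace ℝ (Fin k) →L[ℝ] ℝ)
      (E := fun x : M => TangentSpace (𝓡 k) x →L[ℝ] TangentSpace (𝓡 k) x →L[ℝ] ℝ) x (B x)))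
    (d : M) : ContDiffOn ℝ ∞ (formChart B d) (extChartAt (𝓡 k) d).target := by
  refine contDiffOn_clm_apply.2 fun a => contDiffOn_clm_apply.2 fun b => ?_
  intro z hz
  refine ContDiffAt.contDiffWithinAt ?_
  have hx := symm_mem_source hz
  have h : ContMDiffAt (𝓡 k) ((𝓡 k).prod 𝓘(ℝ, ℝ)) ∞ (fun y : M =>
      TotalSpace.mk' ℝ (E := Bundle.Trivial M ℝ) y (B y (chartFrame d y a) (chartFrame d y b)))
      ((extChartAt (𝓡 k) d).symm z) :=
    ContMDiffAt.clm_bundle_apply₂ (F₁ := EuclideanSpace ℝ (Fin k))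
      (F₂ := EuclideanSpace ℝ (Fin k)) (hB _) (contMDiffAt_chartFrame hx a)
      (contMDiffAt_chartFrame hx b)
  simp only [contMDiffAt_totalSpace] at h
  have h2 := (contMDiffAt_iff_chart hx).1 h.2
  rw [(extChartAt (𝓡 k) d).right_inv hz] at h2
  exact h2

end FormChart

section ChristoffelChart

variable {k : ℕ} {V : Type*} [TopologicalSpace V] [ChartedSpace (EuclideanSpace ℝ (Fin k)) V]
  [IsManifold (𝓡 k) ∞ V]

lemma PseudoRiemannianMetric.isMetricOn_formChart (g : PseudoRiemannianMetric k V) (d : V) :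
    IsMetricOn (formChart g.inner d) (extChartAt (𝓡 k) d).target where
  isOpen := isOpen_extChartAt_target d
  contDiffOn := contDiffOn_formChart g.contMDiff d
  symm z _ a b := by rw [formChart_apply, g.symm, ← formChart_apply]
  nondegenerate z hz a ha := by
    have hx := symm_mem_source hz
    rw [← chartCoord_chartFrame hx a, g.nondegenerate _ (chartFrame d _ a) fun w => ?_, map_zero]
    rw [← chartFrame_chartCoord hx w, ← formChart_apply]
    exact ha _

variable {g : PseudoRiemannianMetric k V}
  {D : CovariantDerivative (𝓡 k) (EuclideanSpace ℝ (Fin k)) (TangentSpace (𝓡 k) : V → Type _)}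

/-- The components of the Levi-Civita connection in the coordinate frame are the Christoffel
symbols. -/
lemma IsLeviCivita.chartFrame_eq (hD : IsLeviCivita g D) {d x : V}
    (hx : x ∈ (chartAt (EuclideanSpace ℝ (Fin k)) d).source) (a b : EuclideanSpace ℝ (Fin k)) :
    chartCoord d x (D (fun y => chartFrame d y b) x (chartFrame d x a))
      = christoffel (formChart g.inner d) (extChartAt (𝓡 k) d x) a b := by
  have hG := g.isMetricOn_formChart d
  have hz := extChartAt_mem_target hx
  refine hG.eq_christoffel hz (Γ := fun a b =>
    chartCoord d x (D (fun y => chartFrame d y b) x (chartFrame d x a))) ?_ ?_ a b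
  · intro a b
    have := hD.torsion_free (fun y => chartFrame d y a) (fun y => chartFrame d y b) x
      (vectorFieldDiffAt_chartFrame hx a) (vectorFieldDiffAt_chartFrame hx b)
    rw [mlieBracket_chartFrame hx, sub_eq_zero] at this
    exact congrArg (chartCoord d x) this
  · intro a b c
    have h := hD.metric (fun y => chartFrame d y b) (fun y => chartFrame d y c) x
      (vectorFieldDiffAt_chartFrame hx b) (vectorFieldDiffAt_chartFrame hx c) (chartFrame d x a)
    have hd : DifferentiableAt ℝ (fun z => formChart g.inner d z b c) (extChartAt (𝓡 k) d x) :=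
      ((hG.differentiableAt hz).clm_apply (differentiableAt_const b)).clm_apply
        (differentiableAt_const c)
    have hm : MDifferentiableAt (𝓡 k) 𝓘(ℝ, ℝ)
        (fun y => g.inner y (chartFrame d y b) (chartFrame d y c)) x :=
      (mdifferentiableAt_iff_chart hx).2 hd
    rw [mvfderiv_eq_fderiv_chart hx hm, chartCoord_chartFrame hx] at h
    have h1 : fderiv ℝ ((fun y => g.inner y (chartFrame d y b) (chartFrame d y c)) ∘
        (extChartAt (𝓡 k) d).symm) (extChartAt (𝓡 k) d x) a
        = fderiv ℝ (formChart g.inner d) (extChartAt (𝓡 k) d x) a b c := by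
      have := fderiv_bilinear_along (u := id) (n := fun _ => b) (k := fun _ => c)
        (y := extChartAt (𝓡 k) d x) (hG.differentiableAt hz) differentiableAt_id
        (differentiableAt_const b) (differentiableAt_const c) a
      rw [fderiv_const_apply, fderiv_const_apply, fderiv_id] at this
      simp only [_root_.zero_apply, map_zero, add_zero, ContinuousLinearMap.id_apply, id] at this
      exact this
    rw [h1] at h
    rw [h]
    rw [formChart_extChartAt _ hx, formChart_extChartAt _ hx, chartFrame_chartCoord hx,
      chartFrame_chartCoord hx]


omit [IsManifold (𝓡 k) ∞ V] in
lemma chart_preimage_mem_nhds {d x : V} (hx : x ∈ (chartAt (EuclideanSpace ℝ (Fin k)) d).source)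
    {U : Set V} (hU : U ∈ 𝓝 x) : (extChartAt (𝓡 k) d).symm ⁻¹' U ∈ 𝓝 (extChartAt (𝓡 k) d x) := by
  refine (continuousAt_extChartAt_symm' ?_).preimage_mem_nhds ?_
  · rwa [extChartAt_source]
  · rwa [(extChartAt (𝓡 k) d).left_inv (by rwa [extChartAt_source])]

/-- Components of tangent vectors in the charts at `a` and `b` are related by a matrix depending
smoothly on the point. -/
lemma contDiffAt_frameChange {d a b x : V}
    (hd : x ∈ (chartAt (EuclideanSpace ℝ (Fin k)) d).source)
    (ha : x ∈ (chartAt (EuclideanSpace ℝ (Fin k)) a).source)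
    (hb : x ∈ (chartAt (EuclideanSpace ℝ (Fin k)) b).source) :
    ContDiffAt ℝ ∞ (fun z => (chartCoord (k := k) b ((extChartAt (𝓡 k) d).symm z)).comp
      (chartFrame (k := k) a ((extChartAt (𝓡 k) d).symm z))) (extChartAt (𝓡 k) d x) := by
  obtain ⟨O, hO, hOo, hOx⟩ := mem_nhds_iff.1 (Filter.inter_mem (target_mem_nhds hd)
    (chart_preimage_mem_nhds (k := k) hd (Filter.inter_mem
      ((chartAt (EuclideanSpace ℝ (Fin k)) a).open_source.mem_nhds ha)
      ((chartAt (EuclideanSpace ℝ (Fin k)) b).open_source.mem_nhds hb))))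
  refine ContDiffOn.contDiffAt (s := O) ?_ (hOo.mem_nhds hOx)
  refine contDiffOn_clm_apply.2 fun v z hz => ContDiffAt.contDiffWithinAt ?_
  obtain ⟨hz, hza, hzb⟩ := hO hz
  have hzd := symm_mem_source hz
  have h := contMDiffAt_chartFrame (k := k) (M := V) hza v
  rw [Trivialization.contMDiffAt_section_iff (IB := 𝓡 k) (e := trivializationAt
    (EuclideanSpace ℝ (Fin k)) (TangentSpace (𝓡 k) : V → Type _) b)
    (s := fun y => chartFrame a y v) (by simpa using hzb), contMDiffAt_iff_chart hzd,
    (extChartAt (𝓡 k) d).right_inv hz] at h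
  refine h.congr_of_eventuallyEq ?_
  filter_upwards [hOo.mem_nhds (show z ∈ O from ‹_›)] with y hy
  rw [ContinuousLinearMap.comp_apply, chartCoord, Trivialization.continuousLinearMapAt_apply,
    Trivialization.coe_linearMapAt_of_mem]
  · rfl
  · simpa using (hO hy).2.2

lemma extend_eq_chartFrame {x y : V} (hy : y ∈ (chartAt (EuclideanSpace ℝ (Fin k)) x).source)
    (v : TangentSpace (𝓡 k) x) :
    extend (EuclideanSpace ℝ (Fin k)) v y = chartFrame x y (chartCoord x x v) := by
  rw [chartCoord, Trivialization.continuousLinearMapAt_apply,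
    Trivialization.coe_linearMapAt_of_mem _ (by simp), chartFrame,
    Trivialization.symmL_apply (R := ℝ) _ (by simpa using hy)]
  rfl

/-- The Levi-Civita connection in coordinates. -/
lemma IsLeviCivita.chartCoord_apply (hD : IsLeviCivita g D) {d x : V}
    (hx : x ∈ (chartAt (EuclideanSpace ℝ (Fin k)) d).source) {Y : Π y : V, TangentSpace (𝓡 k) y}
    (hY : VectorFieldDiffAt Y x) (w : TangentSpace (𝓡 k) x) :
    chartCoord d x (D Y x w)
      = mvfderiv (𝓡 k) (fun y => chartCoord d y (Y y)) x w
        + christoffel (formChart g.inner d) (extChartAt (𝓡 k) d x) (chartCoord d x w)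
          (chartCoord d x (Y x)) := by
  have hdiff : ∀ {Y : Π y : V, TangentSpace (𝓡 k) y}, VectorFieldDiffAt Y x →
      MDifferentiableAt (𝓡 k) 𝓘(ℝ, EuclideanSpace ℝ (Fin k)) (fun y => chartCoord d y (Y y)) x :=
    fun hY => (mdifferentiableAt_iff_chart hx).2 ((vectorFieldDiffAt_iff_chart hx).1 hY)
  -- The flat connection of the chart; its difference from `D` is tensorial.
  have hflat : IsCovariantDerivativeOn (I := 𝓡 k) (EuclideanSpace ℝ (Fin k))
      (fun (Y : Π y : V, TangentSpace (𝓡 k) y) z =>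
        (chartFrame d z).comp (mvfderiv (𝓡 k) (fun y => chartCoord d y (Y y)) z)) {x} := by
    constructor
    · rintro σ σ' z hσ hσ' rfl
      have h := mvfderiv_add (hdiff hσ) (hdiff hσ')
      have h' : (fun y => chartCoord d y ((σ + σ') y))
          = (fun y => chartCoord d y (σ y)) + fun y => chartCoord d y (σ' y) :=
        funext fun y => map_add (chartCoord d y) (σ y) (σ' y)
      rw [h', h, ContinuousLinearMap.comp_add]
    · rintro σ f z hσ hf rfl
      have h := mvfderiv_smul hf (hdiff hσ)
      have h' : (fun y => chartCoord d y ((f • σ) y)) = f • fun y => chartCoord d y (σ y) :=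
        funext fun y => map_smul (chartCoord d y) (f y) (σ y)
      rw [h', h]
      refine ContinuousLinearMap.ext fun v => ?_
      have h1 := chartFrame_chartCoord hx (σ z)
      simp only [ContinuousLinearMap.comp_apply, _root_.add_apply, _root_.smul_apply, map_add,
        map_smul, ContinuousLinearMap.smulRight_apply, h1]
  have h1 := IsCovariantDerivativeOn.difference_apply (D.isCovariantDerivativeOn (s := {x}))
    hflat (x := x) rfl hY
  have h2 := IsCovariantDerivativeOn.difference_apply (D.isCovariantDerivativeOn (s := {x}))
    hflat (x := x) rfl (vectorFieldDiffAt_chartFrame hx (chartCoord d x (Y x)))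
  rw [chartFrame_chartCoord hx] at h2
  have hconst : mvfderiv (𝓡 k) (fun y => chartCoord d y
      (chartFrame d y (chartCoord d x (Y x)))) x w = 0 := by
    rw [mvfderiv_eq_fderiv_chart hx (hdiff (vectorFieldDiffAt_chartFrame hx _))]
    have : (fun y => chartCoord d y (chartFrame d y (chartCoord d x (Y x)))) ∘
        (extChartAt (𝓡 k) d).symm =ᶠ[𝓝 (extChartAt (𝓡 k) d x)]
        fun _ => chartCoord d x (Y x) := by
      filter_upwards [target_mem_nhds hx] with z hz
      exact chartCoord_chartFrame (symm_mem_source hz) _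
    rw [this.fderiv_eq, fderiv_const_apply, _root_.zero_apply]
  have h3 := congrArg (fun L : TangentSpace (𝓡 k) x →L[ℝ] TangentSpace (𝓡 k) x =>
    chartCoord d x (L w)) (h1.symm.trans h2)
  simp only [_root_.sub_apply, map_sub, ContinuousLinearMap.comp_apply,
    chartCoord_chartFrame hx] at h3
  rw [hconst, sub_zero, sub_eq_iff_eq_add] at h3
  refine h3.trans ((add_comm _ _).trans (congrArg _ ?_))
  rw [← hD.chartFrame_eq hx, chartFrame_chartCoord hx]

end ChristoffelChart

/-! ### Maps and vector fields along maps in charts -/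

section CovDerivChart

variable {k : ℕ} {V : Type*} [TopologicalSpace V] [ChartedSpace (EuclideanSpace ℝ (Fin k)) V]
  [IsManifold (𝓡 k) ∞ V] {g : PseudoRiemannianMetric k V}
  {D : CovariantDerivative (𝓡 k) (EuclideanSpace ℝ (Fin k)) (TangentSpace (𝓡 k) : V → Type _)}

lemma VectorFieldDiffAt.mvfderiv_chartCoord {d x : V}
    (hx : x ∈ (chartAt (EuclideanSpace ℝ (Fin k)) d).source) {Y : Π y : V, TangentSpace (𝓡 k) y}
    (hY : VectorFieldDiffAt Y x) (w : TangentSpace (𝓡 k) x) :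
    mvfderiv (𝓡 k) (fun y => chartCoord d y (Y y)) x w
      = fderiv ℝ (fun z => chartCoord d ((extChartAt (𝓡 k) d).symm z)
        (Y ((extChartAt (𝓡 k) d).symm z))) (extChartAt (𝓡 k) d x) (chartCoord d x w) :=
  mvfderiv_eq_fderiv_chart hx
    ((mdifferentiableAt_iff_chart (f := fun y => chartCoord d y (Y y)) hx).2 ((vectorFieldDiffAt_iff_chart hx).1 hY)) w

lemma TwoForm.covDeriv_eq_coordCovForm (Q : TwoForm k V) (hD : IsLeviCivita g D) {d x : V}
    (hx : x ∈ (chartAt (EuclideanSpace ℝ (Fin k)) d).source) (u v w : TangentSpace (𝓡 k) x) :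
    Q.covDeriv D x u v w = coordCovForm (formChart g.inner d) (formChart Q.form d)
      (extChartAt (𝓡 k) d x) (chartCoord d x u) (chartCoord d x v) (chartCoord d x w) := by
  have hv : ∀ v : TangentSpace (𝓡 k) x,
      VectorFieldDiffAt (extend (EuclideanSpace ℝ (Fin k)) v) x := fun v =>
    mdifferentiableAt_extend (𝓡 k) _ v
  have hv' := fun v => (vectorFieldDiffAt_iff_chart hx).1 (hv v)
  have hq : DifferentiableAt ℝ (formChart Q.form d) (extChartAt (𝓡 k) d x) :=
    ((contDiffOn_formChart Q.contMDiff d).contDiffAt (target_mem_nhds hx)).differentiableAt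
      (by simp)
  have hcov : ∀ v, chartCoord d x (D (extend (EuclideanSpace ℝ (Fin k)) v) x u) = _ :=
    fun v => hD.chartCoord_apply hx (hv v) u
  have hd := fun v => (hv v).mvfderiv_chartCoord hx u
  have hval : ∀ v : TangentSpace (𝓡 k) x,
      chartCoord d ((extChartAt (𝓡 k) d).symm (extChartAt (𝓡 k) d x))
        (extend (EuclideanSpace ℝ (Fin k)) v ((extChartAt (𝓡 k) d).symm (extChartAt (𝓡 k) d x)))
        = chartCoord d x v := fun v => by
    rw [extChartAt_symm_extChartAt hx, extend_apply_self]
  have hev : (fun y => Q.form y (extend (EuclideanSpace ℝ (Fin k)) v y)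
      (extend (EuclideanSpace ℝ (Fin k)) w y)) ∘ (extChartAt (𝓡 k) d).symm
      =ᶠ[𝓝 (extChartAt (𝓡 k) d x)] fun z => formChart Q.form d z
        (chartCoord d ((extChartAt (𝓡 k) d).symm z)
          (extend (EuclideanSpace ℝ (Fin k)) v ((extChartAt (𝓡 k) d).symm z)))
        (chartCoord d ((extChartAt (𝓡 k) d).symm z)
          (extend (EuclideanSpace ℝ (Fin k)) w ((extChartAt (𝓡 k) d).symm z))) := by
    filter_upwards [target_mem_nhds hx] with z hz
    rw [formChart_apply, chartFrame_chartCoord (symm_mem_source hz),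
      chartFrame_chartCoord (symm_mem_source hz)]
    rfl
  have hdiff : DifferentiableAt ℝ ((fun y => Q.form y (extend (EuclideanSpace ℝ (Fin k)) v y)
      (extend (EuclideanSpace ℝ (Fin k)) w y)) ∘ (extChartAt (𝓡 k) d).symm)
      (extChartAt (𝓡 k) d x) :=
    ((hq.clm_apply (hv' v)).clm_apply (hv' w)).congr_of_eventuallyEq hev
  rw [TwoForm.covDeriv, mvfderiv_eq_fderiv_chart hx ((mdifferentiableAt_iff_chart hx).2 hdiff),
    hev.fderiv_eq]
  have := fderiv_bilinear_along (u := id) (y := extChartAt (𝓡 k) d x) hq differentiableAt_id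
    (hv' v) (hv' w) (chartCoord d x u)
  refine (congrArg (fun r => r - _ - _) this).trans ?_
  rw [← formChart_chartCoord Q.form hx, ← formChart_chartCoord Q.form hx, hcov, hcov, hd, hd]
  simp only [hval, extend_apply_self, id, fderiv_id,
    ContinuousLinearMap.id_apply, coordCovForm, map_add, _root_.add_apply]
  ring

end CovDerivChart

section AlongChart

variable {m k : ℕ} {S : Type*} [TopologicalSpace S] [ChartedSpace (EuclideanSpace ℝ (Fin m)) S]
  [IsManifold (𝓡 m) ∞ S]
  {V : Type*} [TopologicalSpace V] [ChartedSpace (EuclideanSpace ℝ (Fin k)) V]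
  [IsManifold (𝓡 k) ∞ V]

/-- The expression of `F` in the charts at `c` and `d`. -/
def mapChart (F : S → V) (c : S) (d : V) (y : EuclideanSpace ℝ (Fin m)) :
    EuclideanSpace ℝ (Fin k) :=
  extChartAt (𝓡 k) d (F ((extChartAt (𝓡 m) c).symm y))

/-- The components of a vector field along `F` in the charts at `c` and `d`. -/
def alongChart (F : S → V) (c : S) (d : V) (N : Π p : S, TangentSpace (𝓡 k) (F p))
    (y : EuclideanSpace ℝ (Fin m)) : EuclideanSpace ℝ (Fin k) :=
  chartCoord d (F ((extChartAt (𝓡 m) c).symm y)) (N ((extChartAt (𝓡 m) c).symm y))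

variable {F : S → V} {c p : S} {d : V} (hp : p ∈ (chartAt (EuclideanSpace ℝ (Fin m)) c).source)
  (hd : F p ∈ (chartAt (EuclideanSpace ℝ (Fin k)) d).source)
include hp

lemma mapChart_extChartAt : mapChart (k := k) F c d (extChartAt (𝓡 m) c p)
    = extChartAt (𝓡 k) d (F p) := by
  rw [mapChart, extChartAt_symm_extChartAt hp]

lemma alongChart_extChartAt (N : Π p : S, TangentSpace (𝓡 k) (F p)) :
    alongChart F c d N (extChartAt (𝓡 m) c p) = chartCoord d (F p) (N p) := by
  rw [alongChart, extChartAt_symm_extChartAt hp]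

include hd

lemma contDiffAt_mapChart (hF : ContMDiffAt (𝓡 m) (𝓡 k) ∞ F p) :
    ContDiffAt ℝ ∞ (mapChart (k := k) F c d) (extChartAt (𝓡 m) c p) :=
  (contMDiffAt_iff_chart hp).1 ((contMDiffAt_extChartAt' hd).comp p hF)

lemma chartCoord_mfderiv (hF : ContMDiffAt (𝓡 m) (𝓡 k) ∞ F p) (v : TangentSpace (𝓡 m) p) :
    chartCoord d (F p) (mfderiv (𝓡 m) (𝓡 k) F p v)
      = fderiv ℝ (mapChart (k := k) F c d) (extChartAt (𝓡 m) c p) (chartCoord c p v) := by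
  have h := mvfderiv_eq_fderiv_chart hp (f := extChartAt (𝓡 k) d ∘ F)
    ((mdifferentiableAt_extChartAt hd).comp p (hF.mdifferentiableAt (by simp))) v
  rw [chartCoord_eq_mfderiv hd]
  refine Eq.trans ?_ h
  rw [mvfderiv, mfderiv_comp p (mdifferentiableAt_extChartAt hd) (hF.mdifferentiableAt (by simp))]
  rfl

lemma SmoothAlongOn.contDiffAt_alongChart {U : Set S} {N : Π p : S, TangentSpace (𝓡 k) (F p)}
    (hN : SmoothAlongOn (m := m) F U N) (hU : U ∈ 𝓝 p) :
    ContDiffAt ℝ ∞ (alongChart F c d N) (extChartAt (𝓡 m) c p) := by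
  have h := hN.contMDiffAt hU
  have hb : F p ∈ (trivializationAt (EuclideanSpace ℝ (Fin k)) (TangentSpace (𝓡 k) : V → Type _)
    d).baseSet := by simpa using hd
  have h2 := (((trivializationAt (EuclideanSpace ℝ (Fin k)) (TangentSpace (𝓡 k) : V → Type _)
    d).contMDiffAt_iff ((Trivialization.mem_source _).2 hb)).1 h)
  have hF : ContinuousAt F p := h2.1.continuousAt
  refine ((contMDiffAt_iff_chart hp).1 h2.2).congr_of_eventuallyEq ?_
  filter_upwards [chart_preimage_mem_nhds hp (hF.preimage_mem_nhds
    ((chartAt (EuclideanSpace ℝ (Fin k)) d).open_source.mem_nhds hd))] with y hy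
  rw [alongChart, chartCoord, Trivialization.continuousLinearMapAt_apply,
    Trivialization.coe_linearMapAt_of_mem]
  · rfl
  · simpa using hy

variable {g : PseudoRiemannianMetric k V}
  {D : CovariantDerivative (𝓡 k) (EuclideanSpace ℝ (Fin k)) (TangentSpace (𝓡 k) : V → Type _)}

/-- The pulled back connection in arbitrary charts. -/
lemma chartCoord_covAlong (hD : IsLeviCivita g D) (hF : ContMDiffAt (𝓡 m) (𝓡 k) ∞ F p)
    {N : Π p : S, TangentSpace (𝓡 k) (F p)}
    (hN : DifferentiableAt ℝ (alongChart F c d N) (extChartAt (𝓡 m) c p))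
    (v : TangentSpace (𝓡 m) p) :
    chartCoord d (F p) (covAlong D F N p v)
      = coordCov (formChart g.inner d) (mapChart (k := k) F c d) (alongChart F c d N)
        (extChartAt (𝓡 m) c p) (chartCoord c p v) := by
  have hd0 : F p ∈ (chartAt (EuclideanSpace ℝ (Fin k)) (F p)).source := mem_chart_source _ _
  -- Components in the chart at `F p`, used in the definition of `covAlong`, and in the chart at
  -- `d` are related by the frame change `T`.
  obtain ⟨T, hT⟩ : ∃ T, T = fun z => (chartCoord (k := k) d ((extChartAt (𝓡 k) d).symm z)).comp
      (chartFrame (F p) ((extChartAt (𝓡 k) d).symm z)) := ⟨_, rfl⟩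
  obtain ⟨T', hT'⟩ : ∃ T, T = fun z => (chartCoord (k := k) (F p)
      ((extChartAt (𝓡 k) d).symm z)).comp
      (chartFrame d ((extChartAt (𝓡 k) d).symm z)) := ⟨_, rfl⟩
  have hTd : DifferentiableAt ℝ T (mapChart (k := k) F c d (extChartAt (𝓡 m) c p)) := by
    rw [mapChart_extChartAt hp, hT]
    exact (contDiffAt_frameChange hd hd0 hd).differentiableAt (by simp)
  have hTd' : DifferentiableAt ℝ T' (mapChart (k := k) F c d (extChartAt (𝓡 m) c p)) := by
    rw [mapChart_extChartAt hp, hT']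
    exact (contDiffAt_frameChange hd hd hd0).differentiableAt (by simp)
  have hu : DifferentiableAt ℝ (mapChart (k := k) F c d) (extChartAt (𝓡 m) c p) :=
    (contDiffAt_mapChart hp hd hF).differentiableAt (by simp)
  have hnear : ∀ᶠ y in 𝓝 (extChartAt (𝓡 m) c p), F ((extChartAt (𝓡 m) c).symm y) ∈
      (chartAt (EuclideanSpace ℝ (Fin k)) d).source ∩
      (chartAt (EuclideanSpace ℝ (Fin k)) (F p)).source :=
    chart_preimage_mem_nhds hp (hF.continuousAt.preimage_mem_nhds (Filter.inter_mem
      ((chartAt (EuclideanSpace ℝ (Fin k)) d).open_source.mem_nhds hd)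
      ((chartAt (EuclideanSpace ℝ (Fin k)) (F p)).open_source.mem_nhds hd0)))
  have hN0 : DifferentiableAt ℝ (alongChart F c (F p) N) (extChartAt (𝓡 m) c p) := by
    refine ((DifferentiableAt.fun_comp' _ hTd' hu).clm_apply hN).congr_of_eventuallyEq ?_
    filter_upwards [hnear] with y hy
    simp only [hT', mapChart, alongChart, ContinuousLinearMap.comp_apply]
    rw [extChartAt_symm_extChartAt hy.1, chartFrame_chartCoord hy.1]
  have hNT : alongChart F c d N =ᶠ[𝓝 (extChartAt (𝓡 m) c p)]
      fun y => T (mapChart (k := k) F c d y) (alongChart F c (F p) N y) := by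
    filter_upwards [hnear] with y hy
    simp only [hT, mapChart, alongChart, ContinuousLinearMap.comp_apply]
    rw [extChartAt_symm_extChartAt hy.1, chartFrame_chartCoord hy.2]
  have hY : VectorFieldDiffAt (extend (EuclideanSpace ℝ (Fin k)) (N p)) (F p) :=
    mdifferentiableAt_extend (𝓡 k) _ _
  have h1 := hD.chartCoord_apply hd hY (mfderiv (𝓡 m) (𝓡 k) F p v)
  rw [hY.mvfderiv_chartCoord hd, extend_apply_self, chartCoord_mfderiv hp hd hF] at h1
  have hYT : (fun z => chartCoord d ((extChartAt (𝓡 k) d).symm z)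
      (extend (EuclideanSpace ℝ (Fin k)) (N p) ((extChartAt (𝓡 k) d).symm z))) =ᶠ[𝓝 (extChartAt (𝓡 k) d (F p))]
      fun z => T z (chartCoord (F p) (F p) (N p)) := by
    filter_upwards [chart_preimage_mem_nhds hd
      ((chartAt (EuclideanSpace ℝ (Fin k)) (F p)).open_source.mem_nhds hd0)] with z hz
    simp only [hT, ContinuousLinearMap.comp_apply]
    rw [extend_eq_chartFrame hz]
  rw [hYT.fderiv_eq] at h1
  have h2 : mvfderiv (𝓡 m) (fun q => chartCoord (F p) (F q) (N q)) p v
      = fderiv ℝ (alongChart F c (F p) N) (extChartAt (𝓡 m) c p) (chartCoord c p v) :=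
    mvfderiv_eq_fderiv_chart hp ((mdifferentiableAt_iff_chart
      (f := fun q => chartCoord (F p) (F q) (N q)) hp).2 hN0) v
  have h3 : covAlong D F N p v = chartFrame (F p) (F p)
      (mvfderiv (𝓡 m) (fun q => chartCoord (F p) (F q) (N q)) p v)
      + D (extend (EuclideanSpace ℝ (Fin k)) (N p)) (F p) (mfderiv (𝓡 m) (𝓡 k) F p v) := rfl
  have hTp : T (mapChart (k := k) F c d (extChartAt (𝓡 m) c p))
      = (chartCoord d (F p)).comp (chartFrame (F p) (F p)) := by
    rw [mapChart_extChartAt hp, hT]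
    beta_reduce
    rw [extChartAt_symm_extChartAt hd]
  have h4 := ((hTd.hasFDerivAt.comp _ hu.hasFDerivAt).clm_apply hN0.hasFDerivAt)
  have h5 : HasFDerivAt (fun y => T (mapChart (k := k) F c d y) (alongChart F c (F p) N y)) _
    (extChartAt (𝓡 m) c p) := h4
  have h6 : fderiv ℝ (fun z => T z (chartCoord (F p) (F p) (N p))) (extChartAt (𝓡 k) d (F p))
      = (fderiv ℝ T (extChartAt (𝓡 k) d (F p))).flip (chartCoord (F p) (F p) (N p)) := by
    rw [mapChart_extChartAt hp] at hTd
    rw [fderiv_clm_apply hTd (differentiableAt_const _), fderiv_const_apply,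
      ContinuousLinearMap.comp_zero, zero_add]
  rw [h3, map_add, h1, h2, coordCov, hNT.fderiv_eq, h5.fderiv, h6, mapChart_extChartAt hp,
    alongChart_extChartAt hp, alongChart_extChartAt hp]
  simp only [_root_.add_apply, ContinuousLinearMap.comp_apply, ContinuousLinearMap.flip_apply,
    Function.comp_apply, hTp]
  abel

end AlongChart

/-! ### The geometry of the submanifold in charts -/

/-- The standard basis of a Euclidean space. -/
abbrev stdBasis (m : ℕ) : Module.Basis (Fin m) ℝ (EuclideanSpace ℝ (Fin m)) :=
  (EuclideanSpace.basisFun (Fin m) ℝ).toBasis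

section Geometry

variable {m k : ℕ} {S : Type*} [TopologicalSpace S] [ChartedSpace (EuclideanSpace ℝ (Fin m)) S]
  [IsManifold (𝓡 m) ∞ S]
  {V : Type*} [TopologicalSpace V] [ChartedSpace (EuclideanSpace ℝ (Fin k)) V]
  [IsManifold (𝓡 k) ∞ V]

/-- The coordinate basis of the tangent space at `p` in the chart at `c`. -/
def chartBasis {c p : S} (hp : p ∈ (chartAt (EuclideanSpace ℝ (Fin m)) c).source) :
    Module.Basis (Fin m) ℝ (TangentSpace (𝓡 m) p) :=
  (stdBasis m).map (ContinuousLinearEquiv.equivOfInverse (chartFrame c p) (chartCoord c p)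
    (chartCoord_chartFrame hp) (chartFrame_chartCoord hp)).toLinearEquiv

lemma chartBasis_apply {c p : S} (hp : p ∈ (chartAt (EuclideanSpace ℝ (Fin m)) c).source)
    (i : Fin m) : chartBasis hp i = chartFrame c p (stdBasis m i) := rfl

variable {g : PseudoRiemannianMetric k V}
  {D : CovariantDerivative (𝓡 k) (EuclideanSpace ℝ (Fin k)) (TangentSpace (𝓡 k) : V → Type _)}
  {F : S → V}

lemma IsSpacelikeImmersion.isScalarProduct (hF : IsSpacelikeImmersion (m := m) g F) (p : S) :
    IsScalarProduct (inducedMetric (m := m) g F p) where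
  add_left u v w := by simp [inducedMetric]
  smul_left a u w := by simp [inducedMetric]
  symm u v := g.symm _ _ _
  nondegenerate v hv := by
    by_contra h
    exact (hF.pos p v h).ne' (hv v)

/-- Projection of vectors along a patch onto the normal space. -/
def patchNormal (G : EuclideanSpace ℝ (Fin k) → EuclideanSpace ℝ (Fin k) →L[ℝ]
      EuclideanSpace ℝ (Fin k) →L[ℝ] ℝ)
    (u : EuclideanSpace ℝ (Fin m) → EuclideanSpace ℝ (Fin k)) (y : EuclideanSpace ℝ (Fin m))
    (w : EuclideanSpace ℝ (Fin k)) : EuclideanSpace ℝ (Fin k) :=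
  w - fderiv ℝ u y (patchTangent (stdBasis m) G u y w)

variable {c p : S} {d : V} (hp : p ∈ (chartAt (EuclideanSpace ℝ (Fin m)) c).source)
  (hd : F p ∈ (chartAt (EuclideanSpace ℝ (Fin k)) d).source)
include hp hd

lemma formChart_mapChart (B : Π x : V, TangentSpace (𝓡 k) x →L[ℝ] TangentSpace (𝓡 k) x →L[ℝ] ℝ)
    (v w : TangentSpace (𝓡 k) (F p)) :
    formChart B d (mapChart F c d (extChartAt (𝓡 m) c p)) (chartCoord d (F p) v)
      (chartCoord d (F p) w) = B (F p) v w := by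
  rw [mapChart_extChartAt hp, formChart_chartCoord B hd]

lemma inducedMetric_eq (hF : ContMDiffAt (𝓡 m) (𝓡 k) ∞ F p) (v w : TangentSpace (𝓡 m) p) :
    inducedMetric g F p v w
      = formChart g.inner d (mapChart F c d (extChartAt (𝓡 m) c p))
        (fderiv ℝ (mapChart (k := k) F c d) (extChartAt (𝓡 m) c p) (chartCoord c p v))
        (fderiv ℝ (mapChart (k := k) F c d) (extChartAt (𝓡 m) c p) (chartCoord c p w)) := by
  rw [← chartCoord_mfderiv hp hd hF, ← chartCoord_mfderiv hp hd hF, formChart_mapChart hp hd]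
  rfl

lemma gram_chartBasis (hF : ContMDiffAt (𝓡 m) (𝓡 k) ∞ F p) :
    gram (chartBasis hp) (inducedMetric g F p)
      = patchMetric (stdBasis m) (formChart g.inner d) (mapChart F c d) (extChartAt (𝓡 m) c p) := by
  ext i j
  simp only [gram, patchMetric, Matrix.of_apply, chartBasis_apply]
  rw [inducedMetric_eq hp hd hF, chartCoord_chartFrame hp, chartCoord_chartFrame hp]

lemma chartCoord_sharp (hF : IsSpacelikeImmersion (m := m) g F)
    (φ : TangentSpace (𝓡 m) p →ₗ[ℝ] ℝ) :
    chartCoord c p (sharp (tangentBasis p) (inducedMetric g F p) φ)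
      = ∑ i, ∑ j, ((patchMetric (stdBasis m) (formChart g.inner d) (mapChart F c d)
        (extChartAt (𝓡 m) c p))⁻¹ i j * φ (chartFrame c p (stdBasis m j))) • stdBasis m i := by
  rw [(hF.isScalarProduct p).sharp_eq (tangentBasis p) (chartBasis hp), sharp,
    gram_chartBasis hp hd (hF.contMDiff p)]
  simp only [map_sum, map_smul, chartBasis_apply, chartCoord_chartFrame hp]

lemma chartCoord_normalPart (hF : IsSpacelikeImmersion (m := m) g F)
    (w : TangentSpace (𝓡 k) (F p)) :
    chartCoord d (F p) (normalPart (m := m) g F p w)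
      = patchNormal (formChart g.inner d) (mapChart F c d) (extChartAt (𝓡 m) c p)
        (chartCoord d (F p) w) := by
  have h := chartCoord_sharp (g := g) hp hd hF
    ((g.inner (F p) w).comp (mfderiv (𝓡 m) (𝓡 k) F p)).toLinearMap
  rw [normalPart, map_sub, chartCoord_mfderiv hp hd (hF.contMDiff p), patchNormal, patchTangent]
  refine congrArg (fun a => _ - fderiv ℝ (mapChart (k := k) F c d) _ a) (h.trans ?_)
  refine Finset.sum_congr rfl fun i _ => Finset.sum_congr rfl fun j _ => ?_
  congr 2
  change g.inner (F p) w (mfderiv (𝓡 m) (𝓡 k) F p (chartFrame c p (stdBasis m j))) = _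
  rw [← formChart_mapChart hp hd g.inner, chartCoord_mfderiv hp hd (hF.contMDiff p),
    chartCoord_chartFrame hp]

omit hd in
lemma differentiableAt_chartCoord_extend (v : TangentSpace (𝓡 m) p) :
    DifferentiableAt ℝ (fun x => chartCoord c ((extChartAt (𝓡 m) c).symm x)
      (extend (EuclideanSpace ℝ (Fin m)) v ((extChartAt (𝓡 m) c).symm x)))
      (extChartAt (𝓡 m) c p) :=
  (vectorFieldDiffAt_iff_chart hp).1 (mdifferentiableAt_extend (𝓡 m) _ v)

/-- Tangential vectors have no normal component. -/
lemma patchNormal_fderiv (hF : IsSpacelikeImmersion (m := m) g F) (a : EuclideanSpace ℝ (Fin m)) :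
    patchNormal (formChart g.inner d) (mapChart (k := k) F c d) (extChartAt (𝓡 m) c p)
      (fderiv ℝ (mapChart (k := k) F c d) (extChartAt (𝓡 m) c p) a) = 0 := by
  have h := chartCoord_normalPart hp hd hF (mfderiv (𝓡 m) (𝓡 k) F p (chartFrame c p a))
  rw [chartCoord_mfderiv hp hd (hF.contMDiff p), chartCoord_chartFrame hp] at h
  rw [← h, normalPart]
  have : sharp (tangentBasis p) (inducedMetric g F p) (fun u =>
      g.inner (F p) (mfderiv (𝓡 m) (𝓡 k) F p (chartFrame c p a)) (mfderiv (𝓡 m) (𝓡 k) F p u))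
      = chartFrame c p a :=
    (hF.isScalarProduct p).ext_basis (tangentBasis p) fun i => by
      rw [(hF.isScalarProduct p).sharp_apply_basis]; rfl
  rw [this, sub_self, map_zero]

/-- The second fundamental form in charts; the extension of the second argument is immaterial. -/
lemma chartCoord_secondFundamentalForm (hD : IsLeviCivita g D)
    (hF : IsSpacelikeImmersion (m := m) g F) (v w : TangentSpace (𝓡 m) p) :
    chartCoord d (F p) (secondFundamentalForm g D F p v w)
      = patchNormal (formChart g.inner d) (mapChart F c d) (extChartAt (𝓡 m) c p)
        (coordCov (formChart g.inner d) (mapChart F c d)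
          (fun x => fderiv ℝ (mapChart (k := k) F c d) x (chartCoord c p w))
          (extChartAt (𝓡 m) c p) (chartCoord c p v)) := by
  have hu := contDiffAt_mapChart hp hd (hF.contMDiff p)
  have hu' : DifferentiableAt ℝ (fderiv ℝ (mapChart (k := k) F c d)) (extChartAt (𝓡 m) c p) :=
    (hu.fderiv_right (m := 1) (by norm_cast)).differentiableAt one_ne_zero
  have hτ := differentiableAt_chartCoord_extend hp w
  obtain ⟨τ, hτ'⟩ : ∃ τ, τ = (fun x => chartCoord c ((extChartAt (𝓡 m) c).symm x)
      (extend (EuclideanSpace ℝ (Fin m)) w ((extChartAt (𝓡 m) c).symm x))) := ⟨_, rfl⟩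
  rw [← hτ'] at hτ
  have hτp : τ (extChartAt (𝓡 m) c p) = chartCoord c p w := by
    rw [hτ']
    beta_reduce
    rw [extChartAt_symm_extChartAt hp, extend_apply_self]
  have hev : alongChart F c d (fun q => mfderiv (𝓡 m) (𝓡 k) F q
      (extend (EuclideanSpace ℝ (Fin m)) w q)) =ᶠ[𝓝 (extChartAt (𝓡 m) c p)]
      fun x => fderiv ℝ (mapChart (k := k) F c d) x (τ x) := by
    filter_upwards [target_mem_nhds hp, chart_preimage_mem_nhds hp
      ((hF.contMDiff p).continuousAt.preimage_mem_nhds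
        ((chartAt (EuclideanSpace ℝ (Fin k)) d).open_source.mem_nhds hd))] with x hx hx'
    have := chartCoord_mfderiv (symm_mem_source hx) hx' (hF.contMDiff _)
      (extend (EuclideanSpace ℝ (Fin m)) w ((extChartAt (𝓡 m) c).symm x))
    rw [(extChartAt (𝓡 m) c).right_inv hx] at this
    rw [alongChart, this, hτ']
  have hN : DifferentiableAt ℝ (alongChart F c d (fun q => mfderiv (𝓡 m) (𝓡 k) F q
      (extend (EuclideanSpace ℝ (Fin m)) w q))) (extChartAt (𝓡 m) c p) :=
    (hu'.clm_apply hτ).congr_of_eventuallyEq hev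
  rw [secondFundamentalForm, chartCoord_normalPart hp hd hF,
    chartCoord_covAlong hp hd hD (hF.contMDiff p) hN, coordCov, hev.fderiv_eq, hev.eq_of_nhds,
    fderiv_clm_apply hu' hτ, hτp, coordCov,
    fderiv_clm_apply hu' (differentiableAt_const _), fderiv_const_apply]
  have hlin : ∀ a b, patchNormal (formChart g.inner d) (mapChart (k := k) F c d)
      (extChartAt (𝓡 m) c p) (a + b) = patchNormal (formChart g.inner d) (mapChart (k := k) F c d)
      (extChartAt (𝓡 m) c p) a + patchNormal (formChart g.inner d) (mapChart (k := k) F c d)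
      (extChartAt (𝓡 m) c p) b := by
    intro a b
    simp only [patchNormal, patchTangent, map_add, _root_.add_apply, mul_add, add_smul,
      Finset.sum_add_distrib]
    abel
  simp only [_root_.add_apply, ContinuousLinearMap.comp_apply, ContinuousLinearMap.comp_zero,
    zero_add, add_assoc]
  rw [hlin, patchNormal_fderiv hp hd hF, zero_add]

end Geometry

/-! ### The mean curvature vector in charts -/

section MeanCurvatureChart

variable {m k : ℕ} {S : Type*} [TopologicalSpace S] [ChartedSpace (EuclideanSpace ℝ (Fin m)) S]
  [IsManifold (𝓡 m) ∞ S]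
  {V : Type*} [TopologicalSpace V] [ChartedSpace (EuclideanSpace ℝ (Fin k)) V]
  [IsManifold (𝓡 k) ∞ V] {g : PseudoRiemannianMetric k V}
  {D : CovariantDerivative (𝓡 k) (EuclideanSpace ℝ (Fin k)) (TangentSpace (𝓡 k) : V → Type _)}
  {F : S → V} {c p : S} {d : V} (hp : p ∈ (chartAt (EuclideanSpace ℝ (Fin m)) c).source)
  (hd : F p ∈ (chartAt (EuclideanSpace ℝ (Fin k)) d).source)
include hp hd

lemma chartCoord_meanCurvature (hD : IsLeviCivita g D) (hF : IsSpacelikeImmersion (m := m) g F) :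
    chartCoord d (F p) (meanCurvature (m := m) g D F p)
      = patchMeanCurvature (stdBasis m) (formChart g.inner d) (mapChart F c d)
        (extChartAt (𝓡 m) c p) := by
  have hG := g.isMetricOn_formChart d
  have hu := contDiffAt_mapChart hp hd (hF.contMDiff p)
  have hW : mapChart (k := k) F c d (extChartAt (𝓡 m) c p) ∈ (extChartAt (𝓡 k) d).target := by
    rw [mapChart_extChartAt hp]
    exact extChartAt_mem_target hd
  obtain ⟨u, hu'⟩ : ∃ u, u = mapChart (m := m) (k := k) F c d := ⟨_, rfl⟩
  obtain ⟨y, hy⟩ : ∃ y, y = extChartAt (𝓡 m) c p := ⟨_, rfl⟩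
  obtain ⟨G, hG'⟩ : ∃ G, G = formChart g.inner d := ⟨_, rfl⟩
  have hII := chartCoord_secondFundamentalForm hp hd hD hF
  have hgr := gram_chartBasis (g := g) hp hd (hF.contMDiff p)
  simp only [← hu', ← hy, ← hG'] at hG hu hW hII hgr ⊢
  have hdd : ∀ a, DifferentiableAt ℝ (fun x => fderiv ℝ u x a) y := fun a =>
    ((hu.fderiv_right (m := 1) (by norm_cast)).clm_apply contDiffAt_const).differentiableAt
      one_ne_zero
  have hNadd : ∀ a b, patchNormal G u y (a + b) = patchNormal G u y a + patchNormal G u y b := by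
    intro a b
    simp only [patchNormal, patchTangent, map_add, _root_.add_apply, mul_add, add_smul,
      Finset.sum_add_distrib]
    abel
  have hNsmul : ∀ (r : ℝ) a, patchNormal G u y (r • a) = r • patchNormal G u y a := by
    intro r a
    simp only [patchNormal, patchTangent, map_smul, _root_.smul_apply, smul_eq_mul,
      mul_left_comm _ r, mul_smul r, ← Finset.smul_sum, smul_sub]
  have hcadd : ∀ n v w, coordCov G u n y (v + w) = coordCov G u n y v + coordCov G u n y w := by
    intro n v w
    simp only [coordCov, map_add, hG.christoffel_symm hW _ (n y), hG.christoffel_add_right hW]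
    abel
  have hcsmul : ∀ n (r : ℝ) v, coordCov G u n y (r • v) = r • coordCov G u n y v := by
    intro n r v
    simp only [coordCov, map_smul, hG.christoffel_symm hW _ (n y), hG.christoffel_smul_right hW,
      smul_add]
  -- In the chart the second fundamental form is bilinear, so its trace may be taken in the basis
  -- of coordinate vectors.
  obtain ⟨B, hB⟩ : ∃ B : TangentSpace (𝓡 m) p →ₗ[ℝ] TangentSpace (𝓡 m) p →ₗ[ℝ]
      EuclideanSpace ℝ (Fin k), ∀ v w, B v w = chartCoord d (F p)
        (secondFundamentalForm g D F p v w) := by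
    refine ⟨LinearMap.mk₂ ℝ (fun v w => chartCoord d (F p) (secondFundamentalForm g D F p v w))
      ?_ ?_ ?_ ?_, fun v w => rfl⟩
    · intro v w z
      rw [hII, hII, hII, map_add, hcadd, hNadd]
    · intro r v w
      rw [hII, hII, map_smul, hcsmul, hNsmul]
    · intro v w z
      simp only [hII, map_add]
      rw [coordCov_add hG hW (hdd _) (hdd _), hNadd]
    · intro r v w
      simp only [hII, map_smul]
      rw [coordCov_smul hG hW (differentiableAt_const r) (hdd _), fderiv_const_apply,
        _root_.zero_apply, zero_smul, zero_add, hNsmul]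
  have h1 : chartCoord d (F p) (meanCurvature (m := m) g D F p)
      = metricTrace (tangentBasis p) (inducedMetric g F p) fun v w => B v w := by
    simp only [meanCurvature, metricTrace, map_sum, map_smul, hB]
  rw [h1, (hF.isScalarProduct p).metricTrace_eq (tangentBasis p) (chartBasis hp), metricTrace, hgr]
  simp only [hB, hII, chartBasis_apply, chartCoord_chartFrame hp]
  rfl

lemma meanCurvatureNorm_eq (hD : IsLeviCivita g D) (hF : IsSpacelikeImmersion (m := m) g F) :
    meanCurvatureNorm m g D F p
      = patchNorm (stdBasis m) (formChart g.inner d) (mapChart F c d) (extChartAt (𝓡 m) c p) := by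
  rw [meanCurvatureNorm, patchNorm, ← chartCoord_meanCurvature hp hd hD hF,
    formChart_mapChart hp hd]

end MeanCurvatureChart

/-! ### Independence of the normal frame -/

/-- Two orthonormal frames of a Lorentzian plane that are related by a matrix of positive
determinant are related by a hyperbolic rotation. -/
lemma hyperbolic_rotation {a b c d : ℝ} (h1 : a ^ 2 - b ^ 2 = 1) (h2 : c ^ 2 - d ^ 2 = -1)
    (h3 : a * c - b * d = 0) (h4 : 0 < a * d - b * c) : c = b ∧ d = a := by
  -- The rows form a Lorentz matrix, whose determinant squares to one.
  have h5 : a * d - b * c = 1 := by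
    have : (a * d - b * c - 1) * (a * d - b * c + 1) = 0 := by
      linear_combination (-(c ^ 2 - d ^ 2)) * h1 - h2 + (a * c - b * d) * h3
    rcases mul_eq_zero.1 this with h | h <;> linarith
  constructor
  · linear_combination (-c) * h1 + a * h3 + b * h5
  · linear_combination (-d) * h1 + b * h3 + a * h5

section Frames

variable {ι : Type*} [Fintype ι] [DecidableEq ι]
  {X E : Type*} [NormedAddCommGroup X] [NormedSpace ℝ X]
  [NormedAddCommGroup E] [NormedSpace ℝ E] [FiniteDimensional ℝ E]
  {b : Module.Basis ι ℝ X} {G : E → E →L[ℝ] E →L[ℝ] ℝ} {W : Set E} {O : Set X}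
  {u e t : X → E}

/-- The reflected mean curvature vector can be computed in any positively oriented frame. -/
lemma IsFramedPatch.patchReflected_eq (hP : IsFramedPatch b G W O u e t) {y : X} (hy : y ∈ O)
    {e' t' : E} (hne : ∀ v, G (u y) e' (fderiv ℝ u y v) = 0)
    (hnt : ∀ v, G (u y) t' (fderiv ℝ u y v) = 0) (hee : G (u y) e' e' = 1)
    (htt : G (u y) t' t' = -1) (het : G (u y) e' t' = 0)
    (hor : 0 < G (u y) e' (t y) * G (u y) t' (e y) - G (u y) e' (e y) * G (u y) t' (t y)) :
    patchReflected b G u e t y = G (u y) (patchMeanCurvature b G u y) t' • e'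
      - G (u y) (patchMeanCurvature b G u y) e' • t' := by
  have hE := hP.decomposition hy e'
  have hT := hP.decomposition hy t'
  simp only [patchTangent, hne, hnt, mul_zero, zero_smul, Finset.sum_const_zero, map_zero,
    zero_add] at hE hT
  generalize G (u y) e' (e y) = α at *
  generalize G (u y) e' (t y) = β at *
  generalize G (u y) t' (e y) = γ at *
  generalize G (u y) t' (t y) = δ at *
  have h1 := hP.inner_e_e y hy
  have h2 := hP.inner_t_t y hy
  have h3 := hP.inner_e_t y hy
  have h4 : G (u y) (t y) (e y) = 0 := by rw [hP.inner_symm hy, h3]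
  rw [hE] at hee het
  rw [hT] at htt het
  simp only [map_sub, map_smul, _root_.sub_apply, _root_.smul_apply, smul_eq_mul, h1, h2, h3, h4]
    at hee htt het
  obtain ⟨h5, h6⟩ := hyperbolic_rotation (a := α) (b := -β) (c := γ) (d := -δ)
    (by linarith) (by linarith) (by linarith) (by linarith)
  have h7 : α ^ 2 - β ^ 2 = 1 := by linarith
  have hδ : δ = -α := by linarith
  subst h5 hδ
  have hH := hP.patchMeanCurvature_eq hy
  rw [patchReflected, hE, hT]
  generalize patchMeanCurvature b G u y = H at *
  simp only [map_sub, map_smul, smul_eq_mul]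
  match_scalars
  · linear_combination (-G (u y) H (t y)) * h7
  · linear_combination (G (u y) H (e y)) * h7

end Frames

/-! ### The integrands in charts -/

section Integrands

variable {m : ℕ} {S : Type*} [TopologicalSpace S] [ChartedSpace (EuclideanSpace ℝ (Fin m)) S]
  [IsManifold (𝓡 m) ∞ S]
  {V : Type*} [TopologicalSpace V] [ChartedSpace (EuclideanSpace ℝ (Fin (m + 2))) V]
  [IsManifold (𝓡 (m + 2)) ∞ V] {g : PseudoRiemannianMetric (m + 2) V}
  {D : CovariantDerivative (𝓡 (m + 2)) (EuclideanSpace ℝ (Fin (m + 2)))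
    (TangentSpace (𝓡 (m + 2)) : V → Type _)}
  {F : S → V}

/-- The points of the chart domain at `c` over which `F` has values in the chart at `F c` and the
normal frame at `c` is defined. -/
def patchSet (o : NormalOrientation (m := m) g F) (c : S) : Set S :=
  (chartAt (EuclideanSpace ℝ (Fin m)) c).source ∩
    (F ⁻¹' (chartAt (EuclideanSpace ℝ (Fin (m + 2))) (F c)).source ∩ o.dom c)

/-- The set of coordinates of points of `patchSet o c`. -/
def patchDomain (o : NormalOrientation (m := m) g F) (c : S) : Set (EuclideanSpace ℝ (Fin m)) :=
  (extChartAt (𝓡 m) c).target ∩ (extChartAt (𝓡 m) c).symm ⁻¹'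
    (F ⁻¹' (chartAt (EuclideanSpace ℝ (Fin (m + 2))) (F c)).source ∩ o.dom c)

variable (o : NormalOrientation (m := m) g F) {c p : S}

lemma mem_patchSet_self (c : S) : c ∈ patchSet o c :=
  ⟨mem_chart_source _ _, mem_chart_source (EuclideanSpace ℝ (Fin (m + 2))) (F c), o.mem_dom c⟩

variable (hF : IsSpacelikeImmersion (m := m) g F)
include hF

lemma isOpen_patchSet (c : S) : IsOpen (patchSet o c) :=
  (chartAt (EuclideanSpace ℝ (Fin m)) c).open_source.inter
    (((chartAt (EuclideanSpace ℝ (Fin (m + 2))) (F c)).open_source.preimage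
      hF.contMDiff.continuous).inter (o.isOpen_dom c))

lemma isOpen_patchDomain (c : S) : IsOpen (patchDomain o c) :=
  (continuousOn_extChartAt_symm c).isOpen_inter_preimage (isOpen_extChartAt_target c)
    (((chartAt (EuclideanSpace ℝ (Fin (m + 2))) (F c)).open_source.preimage
      hF.contMDiff.continuous).inter (o.isOpen_dom c))

omit hF in
lemma extChartAt_mem_patchDomain (hp : p ∈ patchSet o c) :
    extChartAt (𝓡 m) c p ∈ patchDomain o c := by
  refine ⟨extChartAt_mem_target hp.1, ?_⟩
  rw [Set.mem_preimage, extChartAt_symm_extChartAt hp.1]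
  exact hp.2

omit hF in
lemma exists_mem_patchSet {y : EuclideanSpace ℝ (Fin m)} (hy : y ∈ patchDomain o c) :
    (extChartAt (𝓡 m) c).symm y ∈ patchSet o c ∧
      extChartAt (𝓡 m) c ((extChartAt (𝓡 m) c).symm y) = y :=
  ⟨⟨symm_mem_source hy.1, hy.2⟩, (extChartAt (𝓡 m) c).right_inv hy.1⟩

/-- The submanifold, seen in charts, is a framed patch. -/
lemma isFramedPatch (c : S) :
    IsFramedPatch (stdBasis m) (formChart g.inner (F c)) (extChartAt (𝓡 (m + 2)) (F c)).target
      (patchDomain o c) (mapChart F c (F c)) (alongChart F c (F c) (o.e c))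
      (alongChart F c (F c) (o.t c)) := by
  have key : ∀ {P : EuclideanSpace ℝ (Fin m) → Prop},
      (∀ p ∈ patchSet o c, P (extChartAt (𝓡 m) c p)) → ∀ y ∈ patchDomain o c, P y := by
    intro P h y hy
    obtain ⟨h1, h2⟩ := exists_mem_patchSet o hy
    rw [← h2]
    exact h _ h1
  have hfr := o.isNormalFrameOn c
  have hev : ∀ p ∈ patchSet o c, o.dom c ∈ 𝓝 p := fun p hp => (o.isOpen_dom c).mem_nhds hp.2.2
  constructor
  · exact g.isMetricOn_formChart (F c)
  · exact isOpen_patchDomain o hF c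
  · exact key fun p hp => by
      rw [mapChart_extChartAt hp.1]
      exact extChartAt_mem_target hp.2.1
  · exact key fun p hp => (contDiffAt_mapChart hp.1 hp.2.1 (hF.contMDiff p)).contDiffWithinAt
  · exact key fun p hp =>
      (hfr.smooth_e.contDiffAt_alongChart hp.1 hp.2.1 (hev p hp)).contDiffWithinAt
  · exact key fun p hp =>
      (hfr.smooth_t.contDiffAt_alongChart hp.1 hp.2.1 (hev p hp)).contDiffWithinAt
  · refine key fun p hp v hv => ?_
    have h := inducedMetric_eq (g := g) hp.1 hp.2.1 (hF.contMDiff p) (chartFrame c p v)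
      (chartFrame c p v)
    rw [chartCoord_chartFrame hp.1] at h
    rw [← h]
    refine hF.pos p _ fun h0 => hv ?_
    rw [← chartCoord_chartFrame hp.1 v, h0, map_zero]
  · refine key fun p hp v => ?_
    rw [← hfr.normal_e p hp.2.2 (chartFrame c p v), ← formChart_mapChart hp.1 hp.2.1 g.inner,
      chartCoord_mfderiv hp.1 hp.2.1 (hF.contMDiff p), chartCoord_chartFrame hp.1,
      alongChart_extChartAt hp.1]
  · refine key fun p hp v => ?_
    rw [← hfr.normal_t p hp.2.2 (chartFrame c p v), ← formChart_mapChart hp.1 hp.2.1 g.inner,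
      chartCoord_mfderiv hp.1 hp.2.1 (hF.contMDiff p), chartCoord_chartFrame hp.1,
      alongChart_extChartAt hp.1]
  · refine key fun p hp => ?_
    rw [alongChart_extChartAt hp.1, formChart_mapChart hp.1 hp.2.1, hfr.inner_e_e p hp.2.2]
  · refine key fun p hp => ?_
    rw [alongChart_extChartAt hp.1, formChart_mapChart hp.1 hp.2.1, hfr.inner_t_t p hp.2.2]
  · refine key fun p hp => ?_
    rw [alongChart_extChartAt hp.1, alongChart_extChartAt hp.1, formChart_mapChart hp.1 hp.2.1,
      hfr.inner_e_t p hp.2.2]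
  · simp

variable (hD : IsLeviCivita g D) (hp : p ∈ patchSet o c)
include hD hp

lemma chartCoord_reflectedMeanCurvature :
    chartCoord (F c) (F p) (o.reflectedMeanCurvature D p)
      = patchReflected (stdBasis m) (formChart g.inner (F c)) (mapChart F c (F c))
        (alongChart F c (F c) (o.e c)) (alongChart F c (F c) (o.t c)) (extChartAt (𝓡 m) c p) := by
  have hfr := o.isNormalFrameOn p
  have hpp := o.mem_dom p
  have hG := formChart_mapChart hp.1 hp.2.1 g.inner
  rw [(isFramedPatch o hF c).patchReflected_eq (extChartAt_mem_patchDomain o hp)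
    (e' := chartCoord (F c) (F p) (o.e p p)) (t' := chartCoord (F c) (F p) (o.t p p))]
  · rw [← chartCoord_meanCurvature hp.1 hp.2.1 hD hF, hG, hG]
    simp only [NormalOrientation.reflectedMeanCurvature, map_sub, map_smul]
  · intro v
    rw [← chartCoord_chartFrame hp.1 v, ← chartCoord_mfderiv hp.1 hp.2.1 (hF.contMDiff p), hG]
    exact hfr.normal_e p hpp _
  · intro v
    rw [← chartCoord_chartFrame hp.1 v, ← chartCoord_mfderiv hp.1 hp.2.1 (hF.contMDiff p), hG]
    exact hfr.normal_t p hpp _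
  · rw [hG, hfr.inner_e_e p hpp]
  · rw [hG, hfr.inner_t_t p hpp]
  · rw [hG, hfr.inner_e_t p hpp]
  · rw [alongChart_extChartAt hp.1, alongChart_extChartAt hp.1, hG, hG, hG, hG]
    exact o.oriented c p p hp.2.2 hpp

variable (hH : ∀ p : S, 0 < g.inner (F p) (meanCurvature (m := m) g D F p)
      (meanCurvature (m := m) g D F p))
include hH

omit hp in
lemma patchMeanCurvature_pos : ∀ y ∈ patchDomain o c,
    0 < formChart g.inner (F c) (mapChart F c (F c) y)
      (patchMeanCurvature (stdBasis m) (formChart g.inner (F c)) (mapChart F c (F c)) y)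
      (patchMeanCurvature (stdBasis m) (formChart g.inner (F c)) (mapChart F c (F c)) y) := by
  intro y hy
  obtain ⟨h1, h2⟩ := exists_mem_patchSet o hy
  rw [← h2, ← chartCoord_meanCurvature h1.1 h1.2.1 hD hF, formChart_mapChart h1.1 h1.2.1]
  exact hH _

lemma connectionForm_eq (v : TangentSpace (𝓡 m) p) :
    o.connectionForm D p v
      = patchConnection (stdBasis m) (formChart g.inner (F c)) (mapChart F c (F c))
        (alongChart F c (F c) (o.e c)) (alongChart F c (F c) (o.t c)) (extChartAt (𝓡 m) c p)
        (chartCoord c p v) := by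
  have hP := isFramedPatch o hF c
  have hy := extChartAt_mem_patchDomain o hp
  have hH' := patchMeanCurvature_pos o hF hD hH (c := c)
  have hev : alongChart F c (F c)
      (fun q => -((meanCurvatureNorm m g D F q)⁻¹ • meanCurvature (m := m) g D F q))
      =ᶠ[𝓝 (extChartAt (𝓡 m) c p)] fun x => -((patchNorm (stdBasis m) (formChart g.inner (F c))
        (mapChart F c (F c)) x)⁻¹ • patchMeanCurvature (stdBasis m) (formChart g.inner (F c))
        (mapChart F c (F c)) x) := by
    filter_upwards [hP.isOpen.mem_nhds hy] with x hx
    obtain ⟨h1, h2⟩ := exists_mem_patchSet o hx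
    rw [← h2, alongChart_extChartAt h1.1, map_neg, map_smul, meanCurvatureNorm_eq h1.1 h1.2.1 hD hF,
      chartCoord_meanCurvature h1.1 h1.2.1 hD hF]
  have hN : DifferentiableAt ℝ (alongChart F c (F c)
      (fun q => -((meanCurvatureNorm m g D F q)⁻¹ • meanCurvature (m := m) g D F q)))
      (extChartAt (𝓡 m) c p) :=
    ((hP.contDiffAt_unitH hH' hy).neg.differentiableAt (by simp)).congr_of_eventuallyEq hev
  rw [NormalOrientation.connectionForm, ← formChart_mapChart hp.1 hp.2.1 g.inner,
    chartCoord_covAlong hp.1 hp.2.1 hD (hF.contMDiff p) hN, map_smul,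
    chartCoord_reflectedMeanCurvature o hF hD hp, meanCurvatureNorm_eq hp.1 hp.2.1 hD hF,
    patchConnection, coordCov, coordCov, hev.fderiv_eq, hev.eq_of_nhds]

lemma chartCoord_connectionVector :
    chartCoord c p (o.connectionVector D p)
      = ∑ i, ∑ j, ((patchMetric (stdBasis m) (formChart g.inner (F c)) (mapChart F c (F c))
        (extChartAt (𝓡 m) c p))⁻¹ i j *
        patchConnection (stdBasis m) (formChart g.inner (F c)) (mapChart F c (F c))
        (alongChart F c (F c) (o.e c)) (alongChart F c (F c) (o.t c)) (extChartAt (𝓡 m) c p)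
        (stdBasis m j)) • stdBasis m i := by
  obtain ⟨φ, hφ⟩ : ∃ φ : TangentSpace (𝓡 m) p →ₗ[ℝ] ℝ, ∀ v, φ v = o.connectionForm D p v :=
    ⟨⟨⟨fun v => o.connectionForm D p v, fun v w => by
        simp [NormalOrientation.connectionForm]; ring⟩, fun r v => by
        simp [NormalOrientation.connectionForm]; ring⟩, fun v => rfl⟩
  have h := chartCoord_sharp (g := g) hp.1 hp.2.1 hF φ
  have h' : (⇑φ) = o.connectionForm D p := funext hφ
  rw [h'] at h
  refine h.trans ?_
  simp only [connectionForm_eq o hF hD hp hH, chartCoord_chartFrame hp.1]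

end Integrands

section IntegrandsChart

variable {m : ℕ} {S : Type*} [TopologicalSpace S] [ChartedSpace (EuclideanSpace ℝ (Fin m)) S]
  [IsManifold (𝓡 m) ∞ S]
  {V : Type*} [TopologicalSpace V] [ChartedSpace (EuclideanSpace ℝ (Fin (m + 2))) V]
  [IsManifold (𝓡 (m + 2)) ∞ V] {g : PseudoRiemannianMetric (m + 2) V}
  (D : CovariantDerivative (𝓡 (m + 2)) (EuclideanSpace ℝ (Fin (m + 2)))
    (TangentSpace (𝓡 (m + 2)) : V → Type _))
  (Q : TwoForm (m + 2) V) {F : S → V} (o : NormalOrientation (m := m) g F)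
  (f : S → ℝ) (s : ℝ)

/-- The integrand containing the divergence `ξ`. -/
def divergenceIntegrand (p : S) : ℝ :=
  f p / meanCurvatureNorm m g D F p * g.inner (F p) (Q.divergence g D (F p))
    (s • meanCurvature (m := m) g D F p + o.reflectedMeanCurvature D p)

/-- The integrand `f Q(H, J) / |H|`. -/
def normalIntegrand (p : S) : ℝ :=
  f p / meanCurvatureNorm m g D F p *
    Q.form (F p) (meanCurvature (m := m) g D F p) (o.reflectedMeanCurvature D p)

/-- The integrand containing the gradient of `f` and the connection form. -/
def gradientIntegrand (p : S) : ℝ :=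
  1 / meanCurvatureNorm m g D F p * Q.form (F p)
    (mfderiv (𝓡 m) (𝓡 (m + 2)) F p (inducedGradient g F f p + (s * f p) • o.connectionVector D p))
    (s • meanCurvature (m := m) g D F p + o.reflectedMeanCurvature D p)

/-- The components `√(det h) θ^i` of the vector density on the patch at `c` whose divergence is the
total integrand; here `θ` is the one-form `f Q(dF(·), (s H + J) / |H|)`. -/
def fluxDensity (c : S) (i : Fin m) (y : EuclideanSpace ℝ (Fin m)) : ℝ :=
  √(patchMetric (stdBasis m) (formChart g.inner (F c)) (mapChart F c (F c)) y).det *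
    ∑ j, (patchMetric (stdBasis m) (formChart g.inner (F c)) (mapChart F c (F c)) y)⁻¹ i j *
      (f ((extChartAt (𝓡 m) c).symm y) * formChart Q.form (F c) (mapChart F c (F c) y)
        (fderiv ℝ (mapChart (k := m + 2) F c (F c)) y (stdBasis m j))
        (patchNull (stdBasis m) (formChart g.inner (F c)) (mapChart F c (F c))
          (alongChart F c (F c) (o.e c)) (alongChart F c (F c) (o.t c)) s y))

variable {D Q o f s} {c p : S} (hF : IsSpacelikeImmersion (m := m) g F) (hD : IsLeviCivita g D)
  (hp : p ∈ patchSet o c)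
include hF hD hp

lemma chartCoord_nullVector :
    chartCoord (F c) (F p) ((meanCurvatureNorm m g D F p)⁻¹ •
      (s • meanCurvature (m := m) g D F p + o.reflectedMeanCurvature D p))
      = patchNull (stdBasis m) (formChart g.inner (F c)) (mapChart F c (F c))
        (alongChart F c (F c) (o.e c)) (alongChart F c (F c) (o.t c)) s
        (extChartAt (𝓡 m) c p) := by
  rw [map_smul, map_add, map_smul, chartCoord_reflectedMeanCurvature o hF hD hp,
    chartCoord_meanCurvature hp.1 hp.2.1 hD hF, meanCurvatureNorm_eq hp.1 hp.2.1 hD hF, patchNull]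

lemma divergenceIntegrand_eq : divergenceIntegrand D Q o f s p
    = f p * formChart g.inner (F c) (mapChart F c (F c) (extChartAt (𝓡 m) c p))
      (chartCoord (F c) (F p) (Q.divergence g D (F p)))
      (patchNull (stdBasis m) (formChart g.inner (F c)) (mapChart F c (F c))
        (alongChart F c (F c) (o.e c)) (alongChart F c (F c) (o.t c)) s
        (extChartAt (𝓡 m) c p)) := by
  rw [← chartCoord_nullVector hF hD hp, formChart_mapChart hp.1 hp.2.1, map_smul,
    divergenceIntegrand, smul_eq_mul]
  ring

lemma normalIntegrand_eq : normalIntegrand D Q o f p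
    = f p * formChart Q.form (F c) (mapChart F c (F c) (extChartAt (𝓡 m) c p))
      (patchMeanCurvature (stdBasis m) (formChart g.inner (F c)) (mapChart F c (F c))
        (extChartAt (𝓡 m) c p))
      (patchNull (stdBasis m) (formChart g.inner (F c)) (mapChart F c (F c))
        (alongChart F c (F c) (o.e c)) (alongChart F c (F c) (o.t c)) s
        (extChartAt (𝓡 m) c p)) := by
  rw [← chartCoord_nullVector hF hD hp, ← chartCoord_meanCurvature hp.1 hp.2.1 hD hF,
    formChart_mapChart hp.1 hp.2.1, map_smul, map_add, map_smul, Q.alternating,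
    normalIntegrand, smul_eq_mul, smul_zero, zero_add]
  ring

omit hF hD hp in
lemma contDiffAt_comp_chart (hf : ContMDiff (𝓡 m) 𝓘(ℝ, ℝ) ∞ f)
    (hp : p ∈ (chartAt (EuclideanSpace ℝ (Fin m)) c).source) :
    ContDiffAt ℝ ∞ (fun y => f ((extChartAt (𝓡 m) c).symm y)) (extChartAt (𝓡 m) c p) :=
  (contMDiffAt_iff_chart hp).1 (hf p)

variable (hH : ∀ p : S, 0 < g.inner (F p) (meanCurvature (m := m) g D F p)
      (meanCurvature (m := m) g D F p)) (hf : ContMDiff (𝓡 m) 𝓘(ℝ, ℝ) ∞ f)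
include hH hf

lemma gradientIntegrand_eq : gradientIntegrand D Q o f s p
    = formChart Q.form (F c) (mapChart F c (F c) (extChartAt (𝓡 m) c p))
      (fderiv ℝ (mapChart (k := m + 2) F c (F c)) (extChartAt (𝓡 m) c p)
        ((∑ i, ∑ j, ((patchMetric (stdBasis m) (formChart g.inner (F c)) (mapChart F c (F c))
            (extChartAt (𝓡 m) c p))⁻¹ i j *
            fderiv ℝ (fun y => f ((extChartAt (𝓡 m) c).symm y)) (extChartAt (𝓡 m) c p)
              (stdBasis m j)) • stdBasis m i)
          + (s * f p) • ∑ i, ∑ j, ((patchMetric (stdBasis m) (formChart g.inner (F c))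
            (mapChart F c (F c)) (extChartAt (𝓡 m) c p))⁻¹ i j *
            patchConnection (stdBasis m) (formChart g.inner (F c)) (mapChart F c (F c))
              (alongChart F c (F c) (o.e c)) (alongChart F c (F c) (o.t c))
              (extChartAt (𝓡 m) c p) (stdBasis m j)) • stdBasis m i))
      (patchNull (stdBasis m) (formChart g.inner (F c)) (mapChart F c (F c))
        (alongChart F c (F c) (o.e c)) (alongChart F c (F c) (o.t c)) s
        (extChartAt (𝓡 m) c p)) := by
  have hgrad : chartCoord c p (inducedGradient g F f p) = ∑ i, ∑ j,
      ((patchMetric (stdBasis m) (formChart g.inner (F c)) (mapChart F c (F c))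
        (extChartAt (𝓡 m) c p))⁻¹ i j * fderiv ℝ (fun y => f ((extChartAt (𝓡 m) c).symm y))
          (extChartAt (𝓡 m) c p) (stdBasis m j)) • stdBasis m i := by
    have h := chartCoord_sharp (g := g) hp.1 hp.2.1 hF (mvfderiv (𝓡 m) f p).toLinearMap
    refine h.trans ?_
    refine Finset.sum_congr rfl fun i _ => Finset.sum_congr rfl fun j _ => ?_
    congr 2
    refine (mvfderiv_eq_fderiv_chart hp.1 ((hf p).mdifferentiableAt (by simp)) _).trans ?_
    rw [chartCoord_chartFrame hp.1]
    rfl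
  rw [← chartCoord_connectionVector o hF hD hp hH, ← hgrad, ← map_smul, ← map_add,
    ← chartCoord_mfderiv hp.1 hp.2.1 (hF.contMDiff p), ← chartCoord_nullVector hF hD hp,
    formChart_mapChart hp.1 hp.2.1, map_smul, gradientIntegrand, smul_eq_mul, one_div]

variable (hQ : Q.IsConformalKillingYano g D)
include hQ

omit hf hH in
lemma coordCovForm_cky (a b e : EuclideanSpace ℝ (Fin (m + 2))) :
    coordCovForm (formChart g.inner (F c)) (formChart Q.form (F c))
        (mapChart F c (F c) (extChartAt (𝓡 m) c p)) a b e
      + coordCovForm (formChart g.inner (F c)) (formChart Q.form (F c))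
        (mapChart F c (F c) (extChartAt (𝓡 m) c p)) b a e
      = 2 / ((m : ℝ) + 1) *
        (formChart g.inner (F c) (mapChart F c (F c) (extChartAt (𝓡 m) c p)) a b *
          formChart g.inner (F c) (mapChart F c (F c) (extChartAt (𝓡 m) c p))
            (chartCoord (F c) (F p) (Q.divergence g D (F p))) e
        - 1 / 2 * (formChart g.inner (F c) (mapChart F c (F c) (extChartAt (𝓡 m) c p)) a e *
          formChart g.inner (F c) (mapChart F c (F c) (extChartAt (𝓡 m) c p))
            (chartCoord (F c) (F p) (Q.divergence g D (F p))) b)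
        - 1 / 2 * (formChart g.inner (F c) (mapChart F c (F c) (extChartAt (𝓡 m) c p)) b e *
          formChart g.inner (F c) (mapChart F c (F c) (extChartAt (𝓡 m) c p))
            (chartCoord (F c) (F p) (Q.divergence g D (F p))) a)) := by
  have hk : ((m + 2 : ℕ) : ℝ) - 1 = (m : ℝ) + 1 := by push_cast; ring
  have h := hQ (F p) (chartFrame (F c) (F p) a) (chartFrame (F c) (F p) b)
    (chartFrame (F c) (F p) e)
  rw [Q.covDeriv_eq_coordCovForm hD hp.2.1, Q.covDeriv_eq_coordCovForm hD hp.2.1, hk] at h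
  simp only [← formChart_mapChart hp.1 hp.2.1 g.inner, chartCoord_chartFrame hp.2.1] at h
  rw [mapChart_extChartAt hp.1] at h ⊢
  exact h

omit hf hH hQ hF hD in
lemma contDiffAt_formChart_mapChart :
    ContDiffAt ℝ ∞ (formChart Q.form (F c)) (mapChart F c (F c) (extChartAt (𝓡 m) c p)) := by
  rw [mapChart_extChartAt hp.1]
  exact (contDiffOn_formChart Q.contMDiff (F c)).contDiffAt (target_mem_nhds hp.2.1)

/-- The total integrand is a divergence. -/
theorem sum_fderiv_fluxDensity (hs : s ^ 2 = 1) :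
    ∑ i, fderiv ℝ (fluxDensity Q o f s c i) (extChartAt (𝓡 m) c p) (stdBasis m i)
      = √(patchMetric (stdBasis m) (formChart g.inner (F c)) (mapChart F c (F c))
          (extChartAt (𝓡 m) c p)).det *
        ((m : ℝ) / ((m : ℝ) + 1) * divergenceIntegrand D Q o f s p + normalIntegrand D Q o f p
          + gradientIntegrand D Q o f s p) := by
  have h := (isFramedPatch o hF c).sum_fderiv_eq (patchMeanCurvature_pos o hF hD hH)
    (extChartAt_mem_patchDomain o hp)
    ((contDiffAt_formChart_mapChart hp (Q := Q)).differentiableAt (by simp))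
    (fun a => Q.alternating _ _) (coordCovForm_cky hF hD hp hQ) hs
    ((contDiffAt_comp_chart hf hp.1).differentiableAt (by simp))
  refine h.trans ?_
  rw [divergenceIntegrand_eq hF hD hp, normalIntegrand_eq hF hD hp (s := s),
    gradientIntegrand_eq hF hD hp hH hf, extChartAt_symm_extChartAt hp.1, Fintype.card_fin,
    show 2 / ((m : ℝ) + 1) / 2 * m = m / (m + 1) by field_simp]

omit hQ in
lemma contDiffAt_fluxDensity (i : Fin m) :
    ContDiffAt ℝ ∞ (fluxDensity Q o f s c i) (extChartAt (𝓡 m) c p) := by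
  have hP := isFramedPatch o hF c
  have hH' := patchMeanCurvature_pos o hF hD hH (c := c)
  have hy := extChartAt_mem_patchDomain o hp
  have hdet := contDiffAt_matrix_det (fun i j => hP.contDiffAt_patchMetric hy i j)
  refine (hdet.sqrt (hP.det_patchMetric_pos hy).ne').mul (ContDiffAt.sum fun j _ =>
    (hP.contDiffAt_patchMetric_inv hy i j).mul ((contDiffAt_comp_chart hf hp.1).mul ?_))
  exact ((ContDiffAt.comp _ (contDiffAt_formChart_mapChart hp)
    (hP.contDiffAt_u hy)).clm_apply (hP.contDiffAt_fderiv hy _)).clm_apply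
    (hP.contDiffAt_patchNull hH' hy s)

end IntegrandsChart

/-! ### Continuity of the integrands -/

section Continuity

variable {m : ℕ} {S : Type*} [TopologicalSpace S] [ChartedSpace (EuclideanSpace ℝ (Fin m)) S]
  [IsManifold (𝓡 m) ∞ S]
  {V : Type*} [TopologicalSpace V] [ChartedSpace (EuclideanSpace ℝ (Fin (m + 2))) V]
  [IsManifold (𝓡 (m + 2)) ∞ V] {g : PseudoRiemannianMetric (m + 2) V}
  {D : CovariantDerivative (𝓡 (m + 2)) (EuclideanSpace ℝ (Fin (m + 2)))
    (TangentSpace (𝓡 (m + 2)) : V → Type _)}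
  {Q : TwoForm (m + 2) V} {F : S → V} {o : NormalOrientation (m := m) g F}
  {f : S → ℝ} {s : ℝ}
  (hF : IsSpacelikeImmersion (m := m) g F) (hD : IsLeviCivita g D)
  (hH : ∀ p : S, 0 < g.inner (F p) (meanCurvature (m := m) g D F p)
      (meanCurvature (m := m) g D F p)) (hf : ContMDiff (𝓡 m) 𝓘(ℝ, ℝ) ∞ f)

/-- A function which near every point is continuous in the coordinates of a patch is continuous. -/
lemma continuous_of_patch {I : S → ℝ} (o : NormalOrientation (m := m) g F)
    (hF : IsSpacelikeImmersion (m := m) g F)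
    (J : S → EuclideanSpace ℝ (Fin m) → ℝ)
    (hJ : ∀ c, ContinuousAt (J c) (extChartAt (𝓡 m) c c))
    (hI : ∀ c, ∀ p ∈ patchSet o c, I p = J c (extChartAt (𝓡 m) c p)) : Continuous I := by
  refine continuous_iff_continuousAt.2 fun c => ?_
  have hev : I =ᶠ[𝓝 c] fun p => J c (extChartAt (𝓡 m) c p) := by
    filter_upwards [(isOpen_patchSet o hF c).mem_nhds (mem_patchSet_self o c)] with p hp
    exact hI c p hp
  exact (ContinuousAt.comp (hJ c) (continuousAt_extChartAt c)).congr hev.symm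

include hF hD hH

omit hF hD in
/-- The mean curvature vector of a zero-dimensional submanifold vanishes, as an empty sum. -/
lemma dim_ne_zero (p : S) : m ≠ 0 := by
  rintro rfl
  have := hH p
  simp [meanCurvature, metricTrace] at this

include hf

lemma continuous_normalIntegrand : Continuous (normalIntegrand D Q o f) := by
  refine continuous_of_patch o hF (fun c y => f ((extChartAt (𝓡 m) c).symm y) *
      formChart Q.form (F c) (mapChart F c (F c) y)
        (patchMeanCurvature (stdBasis m) (formChart g.inner (F c)) (mapChart F c (F c)) y)
        (patchNull (stdBasis m) (formChart g.inner (F c)) (mapChart F c (F c))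
          (alongChart F c (F c) (o.e c)) (alongChart F c (F c) (o.t c)) 1 y)) (fun c => ?_) fun c p hp => ?_
  rotate_left
  · rw [normalIntegrand_eq hF hD hp (s := 1), extChartAt_symm_extChartAt hp.1]
  · have hc := mem_patchSet_self o c
    have hP := isFramedPatch o hF c
    have hH' := patchMeanCurvature_pos o hF hD hH (c := c)
    have hy := extChartAt_mem_patchDomain o hc
    exact ContDiffAt.continuousAt (n := ∞) (𝕜 := ℝ) ((contDiffAt_comp_chart hf hc.1).mul
      (((ContDiffAt.comp _ (contDiffAt_formChart_mapChart hc)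
        (hP.contDiffAt_u hy)).clm_apply (hP.contDiffAt_patchMeanCurvature hy)).clm_apply
        (hP.contDiffAt_patchNull hH' hy 1)))

lemma continuous_gradientIntegrand : Continuous (gradientIntegrand D Q o f s) := by
  refine continuous_of_patch o hF (fun c y => formChart Q.form (F c) (mapChart F c (F c) y)
      (fderiv ℝ (mapChart (k := m + 2) F c (F c)) y
        ((∑ i, ∑ j, ((patchMetric (stdBasis m) (formChart g.inner (F c)) (mapChart F c (F c))
            y)⁻¹ i j * fderiv ℝ (fun y => f ((extChartAt (𝓡 m) c).symm y)) y
              (stdBasis m j)) • stdBasis m i)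
          + (s * f ((extChartAt (𝓡 m) c).symm y)) • ∑ i, ∑ j,
            ((patchMetric (stdBasis m) (formChart g.inner (F c)) (mapChart F c (F c)) y)⁻¹ i j *
            patchConnection (stdBasis m) (formChart g.inner (F c)) (mapChart F c (F c))
              (alongChart F c (F c) (o.e c)) (alongChart F c (F c) (o.t c)) y
              (stdBasis m j)) • stdBasis m i))
        (patchNull (stdBasis m) (formChart g.inner (F c)) (mapChart F c (F c))
          (alongChart F c (F c) (o.e c)) (alongChart F c (F c) (o.t c)) s y)) (fun c => ?_) fun c p hp => ?_
  rotate_left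
  · rw [gradientIntegrand_eq hF hD hp hH hf, extChartAt_symm_extChartAt hp.1]
  · have hc := mem_patchSet_self o c
    have hP := isFramedPatch o hF c
    have hH' := patchMeanCurvature_pos o hF hD hH (c := c)
    have hy := extChartAt_mem_patchDomain o hc
    have hfy := contDiffAt_comp_chart hf hc.1
    exact ContDiffAt.continuousAt (n := ∞) (𝕜 := ℝ)
      (((ContDiffAt.comp _ (contDiffAt_formChart_mapChart hc)
        (hP.contDiffAt_u hy)).clm_apply
        (((hP.contDiffAt_u hy).fderiv_right (m := ∞) (by simp)).clm_apply
          ((ContDiffAt.sum fun i _ => ContDiffAt.sum fun j _ =>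
            ((hP.contDiffAt_patchMetric_inv hy i j).mul
              ((hfy.fderiv_right (m := ∞) (by simp)).clm_apply contDiffAt_const)).smul
              contDiffAt_const).add
            ((contDiffAt_const.mul hfy).smul
              (ContDiffAt.sum fun i _ => ContDiffAt.sum fun j _ =>
                ((hP.contDiffAt_patchMetric_inv hy i j).mul
                  (hP.contDiffAt_patchConnection hH' hy _)).smul contDiffAt_const))))).clm_apply
        (hP.contDiffAt_patchNull hH' hy s))

/-- The divergence of a conformal Killing-Yano form is controlled by its covariant derivative
along the submanifold, which is continuous. -/
lemma continuous_divergenceIntegrand (hQ : Q.IsConformalKillingYano g D) :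
    Continuous (divergenceIntegrand D Q o f s) := by
  refine continuous_of_patch o hF (fun c y => f ((extChartAt (𝓡 m) c).symm y) *
    (((m : ℝ) + 1) / m * ∑ i, ∑ j, (patchMetric (stdBasis m) (formChart g.inner (F c))
      (mapChart F c (F c)) y)⁻¹ i j * coordCovForm (formChart g.inner (F c))
        (formChart Q.form (F c)) (mapChart F c (F c) y)
        (fderiv ℝ (mapChart (k := m + 2) F c (F c)) y (stdBasis m i))
        (fderiv ℝ (mapChart (k := m + 2) F c (F c)) y (stdBasis m j))
        (patchNull (stdBasis m) (formChart g.inner (F c)) (mapChart F c (F c))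
          (alongChart F c (F c) (o.e c)) (alongChart F c (F c) (o.t c)) s y))) (fun c => ?_)
    fun c p hp => ?_
  · have hc := mem_patchSet_self o c
    have hP := isFramedPatch o hF c
    have hH' := patchMeanCurvature_pos o hF hD hH (c := c)
    have hy := extChartAt_mem_patchDomain o hc
    have hq := contDiffAt_formChart_mapChart hc (Q := Q)
    have hL := hP.contDiffAt_patchNull hH' hy s
    have hU := fun i => hP.contDiffAt_fderiv hy (stdBasis m i)
    have hqu := ContDiffAt.comp _ hq (hP.contDiffAt_u hy)
    have hchr := fun {a b} ha hb => hP.metric.contDiffAt_christoffel (hP.mapsTo hy) (a := a)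
      (b := b) rfl (hP.contDiffAt_u hy) ha hb
    have hdq := ContDiffAt.comp _ (hq.fderiv_right (m := ∞) (by simp)) (hP.contDiffAt_u hy)
    exact ContDiffAt.continuousAt (n := ∞) (𝕜 := ℝ) ((contDiffAt_comp_chart hf hc.1).mul
      (contDiffAt_const.mul (ContDiffAt.sum fun i _ => ContDiffAt.sum fun j _ =>
        (hP.contDiffAt_patchMetric_inv hy i j).mul
          (((((hdq.clm_apply (hU i)).clm_apply (hU j)).clm_apply hL).sub
            ((hqu.clm_apply (hchr (hU i) (hU j))).clm_apply hL)).sub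
            ((hqu.clm_apply (hU j)).clm_apply (hchr (hU i) hL))))))
  · have hm : (m : ℝ) ≠ 0 := by exact_mod_cast dim_ne_zero hH p
    have hP := isFramedPatch o hF c
    have hH' := patchMeanCurvature_pos o hF hD hH (c := c)
    have hy := extChartAt_mem_patchDomain o hp
    have htr := hP.trace_coordCovForm hH' hy (hP.inner_patchNull hH' hy s)
      (coordCovForm_cky hF hD hp hQ)
    beta_reduce
    rw [htr, divergenceIntegrand_eq hF hD hp, extChartAt_symm_extChartAt hp.1, Fintype.card_fin]
    field_simp

end Continuity

/-! ### The Riemannian measure in a chart -/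

section RiemannianMeasure

variable {m : ℕ} {S : Type*} [TopologicalSpace S] [ChartedSpace (EuclideanSpace ℝ (Fin m)) S]

/-- The density `√(det h_{ij})` of the Riemannian measure in the chart at `c`. -/
def chartDensity (h : Π p : S, TangentSpace (𝓡 m) p → TangentSpace (𝓡 m) p → ℝ) (c : S)
    (y : EuclideanSpace ℝ (Fin m)) : ℝ :=
  Real.sqrt (Matrix.det (Matrix.of fun i j : Fin m =>
    h ((extChartAt (𝓡 m) c).symm y)
      (mfderiv 𝓘(ℝ, EuclideanSpace ℝ (Fin m)) (𝓡 m) (extChartAt (𝓡 m) c).symm y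
        (EuclideanSpace.basisFun (Fin m) ℝ i))
      (mfderiv 𝓘(ℝ, EuclideanSpace ℝ (Fin m)) (𝓡 m) (extChartAt (𝓡 m) c).symm y
        (EuclideanSpace.basisFun (Fin m) ℝ j))))

/-- A symmetric bilinear form changes its Gram determinant by the square of the determinant of the
change of basis. -/
lemma IsScalarProduct.sqrt_det_comp {T : Type*} [AddCommGroup T] [Module ℝ T] {g : T → T → ℝ}
    (hg : IsScalarProduct g) (A : EuclideanSpace ℝ (Fin m) →ₗ[ℝ] T)
    (L : EuclideanSpace ℝ (Fin m) →ₗ[ℝ] EuclideanSpace ℝ (Fin m)) :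
    √(Matrix.of fun i j => g (A (L (stdBasis m i))) (A (L (stdBasis m j)))).det
      = |LinearMap.det L| * √(Matrix.of fun i j => g (A (stdBasis m i)) (A (stdBasis m j))).det := by
  have h1 : (Matrix.of fun i j => g (A (L (stdBasis m i))) (A (L (stdBasis m j))))
      = (LinearMap.toMatrix (stdBasis m) (stdBasis m) L).transpose *
        (Matrix.of fun i j => g (A (stdBasis m i)) (A (stdBasis m j))) *
        LinearMap.toMatrix (stdBasis m) (stdBasis m) L := by
    have hL : ∀ i, L (stdBasis m i) = ∑ k, LinearMap.toMatrix (stdBasis m) (stdBasis m) L k i •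
        stdBasis m k := fun i => by
      conv_lhs => rw [← (stdBasis m).sum_repr (L (stdBasis m i))]
      simp only [LinearMap.toMatrix_apply]
    ext i j
    simp only [Matrix.mul_apply, Matrix.transpose_apply, Matrix.of_apply, Finset.sum_mul]
    rw [hL i, hL j, map_sum, map_sum, hg.symm, hg.sum_left]
    refine Finset.sum_congr rfl fun k _ => ?_
    rw [hg.symm, hg.sum_left]
    refine Finset.sum_congr rfl fun l _ => ?_
    rw [map_smul, map_smul, hg.smul_left, hg.symm, hg.smul_left, hg.symm]
    ring
  rw [h1, Matrix.det_mul, Matrix.det_mul, Matrix.det_transpose, LinearMap.det_toMatrix,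
    show ∀ a b : ℝ, a * b * a = a ^ 2 * b from fun a b => by ring,
    Real.sqrt_mul (sq_nonneg _), Real.sqrt_sq_eq_abs]

variable [IsManifold (𝓡 m) ∞ S]

lemma chartDensity_eq (h : Π p : S, TangentSpace (𝓡 m) p → TangentSpace (𝓡 m) p → ℝ) {c p : S}
    (hp : p ∈ (chartAt (EuclideanSpace ℝ (Fin m)) c).source) :
    chartDensity h c (extChartAt (𝓡 m) c p) = √(Matrix.of fun i j =>
      h p (chartFrame c p (stdBasis m i)) (chartFrame c p (stdBasis m j))).det := by
  rw [chartFrame_eq_mfderiv hp, chartDensity]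
  simp only [stdBasis, OrthonormalBasis.coe_toBasis]
  rw [extChartAt_symm_extChartAt hp]
  rfl

/-- The transition map between two charts. -/
lemma hasFDerivAt_transition {c c' p : S}
    (hp : p ∈ (chartAt (EuclideanSpace ℝ (Fin m)) c).source)
    (hp' : p ∈ (chartAt (EuclideanSpace ℝ (Fin m)) c').source) :
    HasFDerivAt (fun y => extChartAt (𝓡 m) c' ((extChartAt (𝓡 m) c).symm y))
      ((chartCoord c' p).comp (chartFrame c p)) (extChartAt (𝓡 m) c p) := by
  have h1 := (contDiffAt_mapChart (F := (id : S → S)) hp hp'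
    contMDiffAt_id).differentiableAt (by simp)
  have h2 : fderiv ℝ (mapChart (F := (id : S → S)) (k := m) c c') (extChartAt (𝓡 m) c p)
      = (chartCoord c' p).comp (chartFrame c p) := by
    ext1 v
    have := chartCoord_mfderiv (F := (id : S → S)) hp hp' contMDiffAt_id (chartFrame c p v)
    rw [chartCoord_chartFrame hp, mfderiv_id] at this
    exact this.symm
  rw [← h2]
  exact h1.hasFDerivAt

lemma chartDensity_transition {h : Π p : S, TangentSpace (𝓡 m) p → TangentSpace (𝓡 m) p → ℝ}
    (hh : ∀ p, IsScalarProduct (h p)) {c c' p : S}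
    (hp : p ∈ (chartAt (EuclideanSpace ℝ (Fin m)) c).source)
    (hp' : p ∈ (chartAt (EuclideanSpace ℝ (Fin m)) c').source) :
    chartDensity h c (extChartAt (𝓡 m) c p) = |((chartCoord (k := m) c' p).comp (chartFrame c p)).det| *
      chartDensity h c' (extChartAt (𝓡 m) c' p) := by
  rw [chartDensity_eq h hp, chartDensity_eq h hp']
  have := (hh p).sqrt_det_comp (chartFrame c' p).toLinearMap
    ((chartCoord c' p).comp (chartFrame c p)).toLinearMap
  refine Eq.trans ?_ this
  simp only [ContinuousLinearMap.coe_coe, ContinuousLinearMap.comp_apply,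
    chartFrame_chartCoord hp']

variable [MeasurableSpace S] [BorelSpace S]
  (h : Π p : S, TangentSpace (𝓡 m) p → TangentSpace (𝓡 m) p → ℝ) (c : S)

lemma aemeasurable_symm_restrict : AEMeasurable (extChartAt (𝓡 m) c).symm
    ((volume : Measure (EuclideanSpace ℝ (Fin m))).restrict (extChartAt (𝓡 m) c).target) :=
  (continuousOn_extChartAt_symm c).aemeasurable (isOpen_extChartAt_target c).measurableSet

lemma aemeasurable_symm (ρ : EuclideanSpace ℝ (Fin m) → ENNReal) :
    AEMeasurable (extChartAt (𝓡 m) c).symm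
      (((volume : Measure (EuclideanSpace ℝ (Fin m))).restrict
        (extChartAt (𝓡 m) c).target).withDensity ρ) :=
  (aemeasurable_symm_restrict c).mono_ac (withDensity_absolutelyContinuous _ _)

lemma chartVolume_apply {A : Set S} (hA : MeasurableSet A) : chartVolume h c A =
    ∫⁻ y in (extChartAt (𝓡 m) c).symm ⁻¹' A ∩ (extChartAt (𝓡 m) c).target,
      ENNReal.ofReal (chartDensity h c y) := by
  rw [chartVolume, Measure.map_apply_of_aemeasurable (aemeasurable_symm c _) hA,
    withDensity_apply' _ _, Measure.restrict_restrict' (isOpen_extChartAt_target c).measurableSet]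
  rfl

lemma measurableSet_preimage_inter {A : Set S} (hA : MeasurableSet A) :
    MeasurableSet ((extChartAt (𝓡 m) c).symm ⁻¹' A ∩ (extChartAt (𝓡 m) c).target) := by
  have h1 := (continuousOn_extChartAt_symm (I := 𝓡 m) c).domRestrict.measurable hA
  have h2 := (isOpen_extChartAt_target (I := 𝓡 m) c).measurableSet.subtype_image h1
  convert h2 using 1
  ext y
  simp [and_comm]

lemma chartVolume_source : chartVolume h c (chartAt (EuclideanSpace ℝ (Fin m)) c).sourceᶜ = 0 := by
  rw [chartVolume_apply h c
    (chartAt (EuclideanSpace ℝ (Fin m)) c).open_source.measurableSet.compl]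
  have : (extChartAt (𝓡 m) c).symm ⁻¹' (chartAt (EuclideanSpace ℝ (Fin m)) c).sourceᶜ ∩
      (extChartAt (𝓡 m) c).target = ∅ :=
    Set.eq_empty_of_forall_notMem fun y hy => hy.1 (symm_mem_source hy.2)
  rw [this, Measure.restrict_empty, lintegral_zero_measure]

variable {h c} {c' : S} (hh : ∀ p, IsScalarProduct (h p))
include hh

/-- The chart measures agree on overlaps. -/
lemma chartVolume_overlap {A : Set S} (hA : MeasurableSet A)
    (hc : A ⊆ (chartAt (EuclideanSpace ℝ (Fin m)) c).source)
    (hc' : A ⊆ (chartAt (EuclideanSpace ℝ (Fin m)) c').source) :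
    chartVolume h c A = chartVolume h c' A := by
  rw [chartVolume_apply h c hA, chartVolume_apply h c' hA]
  have hset : (extChartAt (𝓡 m) c').symm ⁻¹' A ∩ (extChartAt (𝓡 m) c').target
      = (fun y => extChartAt (𝓡 m) c' ((extChartAt (𝓡 m) c).symm y)) ''
        ((extChartAt (𝓡 m) c).symm ⁻¹' A ∩ (extChartAt (𝓡 m) c).target) := by
    ext z
    constructor
    · rintro ⟨hz, hz'⟩
      refine ⟨extChartAt (𝓡 m) c ((extChartAt (𝓡 m) c').symm z), ⟨?_, ?_⟩, ?_⟩
      · rw [Set.mem_preimage, extChartAt_symm_extChartAt (hc hz)]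
        exact hz
      · exact extChartAt_mem_target (hc hz)
      · beta_reduce
        rw [extChartAt_symm_extChartAt (hc hz), (extChartAt (𝓡 m) c').right_inv hz']
    · rintro ⟨y, ⟨hy, hy'⟩, rfl⟩
      refine ⟨?_, extChartAt_mem_target (hc' hy)⟩
      rw [Set.mem_preimage, extChartAt_symm_extChartAt (hc' hy)]
      exact hy
  rw [hset, lintegral_image_eq_lintegral_abs_det_fderiv_mul volume
    (measurableSet_preimage_inter c hA)
    (f' := fun y => (chartCoord c' ((extChartAt (𝓡 m) c).symm y)).comp
      (chartFrame c ((extChartAt (𝓡 m) c).symm y)))]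
  · refine setLIntegral_congr_fun (measurableSet_preimage_inter c hA) fun y hy => ?_
    have := chartDensity_transition hh (hc hy.1) (hc' hy.1)
    rw [(extChartAt (𝓡 m) c).right_inv hy.2] at this
    rw [this, ENNReal.ofReal_mul (abs_nonneg _)]
  · intro y hy
    have := hasFDerivAt_transition (hc hy.1) (hc' hy.1)
    rw [(extChartAt (𝓡 m) c).right_inv hy.2] at this
    exact this.hasFDerivWithinAt
  · intro y hy z hz hyz
    have h1 := congrArg (extChartAt (𝓡 m) c').symm hyz
    beta_reduce at h1
    rw [extChartAt_symm_extChartAt (hc' hy.1), extChartAt_symm_extChartAt (hc' hz.1)] at h1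
    rw [← (extChartAt (𝓡 m) c).right_inv hy.2, ← (extChartAt (𝓡 m) c).right_inv hz.2, h1]

/-- On a chart domain the Riemannian measure is the chart measure. -/
lemma riemannianVolume_apply {A : Set S} (hA : MeasurableSet A)
    (hc : A ⊆ (chartAt (EuclideanSpace ℝ (Fin m)) c).source) :
    riemannianVolume h A = chartVolume h c A := by
  have hsrc : ∀ c : S, MeasurableSet (chartAt (EuclideanSpace ℝ (Fin m)) c).source :=
    fun c => (chartAt (EuclideanSpace ℝ (Fin m)) c).open_source.measurableSet
  refine le_antisymm ?_ (Measure.le_iff'.1 (le_iSup (chartVolume h) c) A)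
  -- The chart measure at `c`, completed by the Riemannian measure off the chart domain, dominates
  -- all the chart measures.
  have hle : riemannianVolume h ≤ (chartVolume h c).restrict
      (chartAt (EuclideanSpace ℝ (Fin m)) c).source + (riemannianVolume h).restrict
      (chartAt (EuclideanSpace ℝ (Fin m)) c).sourceᶜ := by
    refine iSup_le fun c' => Measure.le_iff.2 fun B hB => ?_
    rw [Measure.add_apply, Measure.restrict_apply hB, Measure.restrict_apply hB]
    rw [← measure_inter_add_sdiff B (hsrc c)]
    refine add_le_add ?_ ?_
    · rw [← measure_inter_add_sdiff (μ := chartVolume h c') (B ∩ _) (hsrc c')]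
      have h0 : chartVolume h c' ((B ∩ (chartAt (EuclideanSpace ℝ (Fin m)) c).source) \
          (chartAt (EuclideanSpace ℝ (Fin m)) c').source) = 0 :=
        measure_mono_null (fun x hx => hx.2) (chartVolume_source h c')
      rw [h0, add_zero, chartVolume_overlap hh ((hB.inter (hsrc c)).inter (hsrc c'))
        (fun x hx => hx.2) (c' := c) (fun x hx => hx.1.2)]
      exact measure_mono Set.inter_subset_left
    · exact Measure.le_iff'.1 (le_iSup (chartVolume h) c') _
  refine (Measure.le_iff'.1 hle A).trans ?_
  rw [Measure.add_apply, Measure.restrict_apply hA, Measure.restrict_apply hA,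
    Set.inter_eq_left.2 hc, (Set.disjoint_compl_right_iff_subset.2 hc).inter_eq, measure_empty,
    add_zero]

lemma riemannianVolume_restrict :
    (riemannianVolume h).restrict (chartAt (EuclideanSpace ℝ (Fin m)) c).source
      = chartVolume h c := by
  have hsrc := (chartAt (EuclideanSpace ℝ (Fin m)) c).open_source.measurableSet
  ext A hA
  rw [Measure.restrict_apply hA, riemannianVolume_apply hh (hA.inter hsrc) Set.inter_subset_right,
    ← measure_inter_add_sdiff (μ := chartVolume h c) A hsrc,
    measure_mono_null (s := A \ _) (fun x hx => hx.2) (chartVolume_source h c), add_zero]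

/-- Finiteness of the Riemannian measure of a compact manifold. -/
lemma isFiniteMeasure_riemannianVolume [CompactSpace S]
    (hc : ∀ c, ContinuousOn (chartDensity h c) (extChartAt (𝓡 m) c).target) :
    IsFiniteMeasure (riemannianVolume h) := by
  have : IsLocallyFiniteMeasure (riemannianVolume h) := by
    refine ⟨fun c => ?_⟩
    have hcs := mem_chart_source (EuclideanSpace ℝ (Fin m)) c
    have hcont := (hc c).continuousAt (target_mem_nhds hcs)
    obtain ⟨N, hN, hNo, hNc⟩ := mem_nhds_iff.1 (Filter.inter_mem (Filter.inter_mem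
      (target_mem_nhds hcs) (hcont.eventually_lt continuousAt_const (lt_add_one _)))
      (Metric.ball_mem_nhds _ one_pos))
    have hAo : IsOpen ((extChartAt (𝓡 m) c).source ∩ extChartAt (𝓡 m) c ⁻¹' N) :=
      (continuousOn_extChartAt c).isOpen_inter_preimage (isOpen_extChartAt_source c) hNo
    refine ⟨_, hAo.mem_nhds ⟨mem_extChartAt_source c, hNc⟩, ?_⟩
    rw [riemannianVolume_apply hh hAo.measurableSet (c := c)
      (fun x hx => by simpa using hx.1), chartVolume_apply h c hAo.measurableSet]
    have hsub : (extChartAt (𝓡 m) c).symm ⁻¹' ((extChartAt (𝓡 m) c).source ∩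
        extChartAt (𝓡 m) c ⁻¹' N) ∩ (extChartAt (𝓡 m) c).target ⊆ N := by
      rintro y ⟨hy, hy'⟩
      have := hy.2
      rwa [Set.mem_preimage, (extChartAt (𝓡 m) c).right_inv hy'] at this
    refine (lintegral_mono_set hsub).trans_lt ?_
    refine (setLIntegral_mono measurable_const fun y hy =>
      ENNReal.ofReal_le_ofReal (le_of_lt (hN hy).1.2)).trans_lt ?_
    rw [setLIntegral_const]
    exact ENNReal.mul_lt_top ENNReal.ofReal_lt_top
      ((measure_mono fun y hy => (hN hy).2).trans_lt Metric.isBounded_ball.measure_lt_top)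
  exact CompactSpace.isFiniteMeasure

/-- Integration in a chart. -/
lemma integral_riemannianVolume
    (hc : ContinuousOn (chartDensity h c) (extChartAt (𝓡 m) c).target) {I : S → ℝ}
    (hI : Continuous I) (hsupp : ∀ p ∉ (chartAt (EuclideanSpace ℝ (Fin m)) c).source, I p = 0) :
    ∫ p, I p ∂riemannianVolume h = ∫ y in (extChartAt (𝓡 m) c).target,
      chartDensity h c y * I ((extChartAt (𝓡 m) c).symm y) := by
  rw [← setIntegral_eq_integral_of_forall_compl_eq_zero hsupp, riemannianVolume_restrict hh,
    chartVolume, integral_map (aemeasurable_symm c _) hI.aestronglyMeasurable]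
  have hm : AEMeasurable (fun y => (chartDensity h c y).toNNReal)
      ((volume : Measure (EuclideanSpace ℝ (Fin m))).restrict (extChartAt (𝓡 m) c).target) :=
    (hc.aemeasurable (isOpen_extChartAt_target c).measurableSet).real_toNNReal
  refine (integral_withDensity_eq_integral_smul₀ hm _).trans ?_
  refine integral_congr_ae (Filter.Eventually.of_forall fun y => ?_)
  simp only [NNReal.smul_def, smul_eq_mul, chartDensity, Real.coe_toNNReal _ (Real.sqrt_nonneg _)]

end RiemannianMeasure

/-! ### The divergence theorem and the integral formula -/

/-- The integral of a directional derivative of a compactly supported function vanishes. -/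
lemma integral_fderiv_eq_zero {m : ℕ} {ψ : EuclideanSpace ℝ (Fin m) → ℝ} (hψ : ContDiff ℝ ∞ ψ)
    (hc : HasCompactSupport ψ) (v : EuclideanSpace ℝ (Fin m)) : ∫ y, fderiv ℝ ψ y v = 0 := by
  have hi : Integrable (fun y => fderiv ℝ ψ y v) :=
    ((hψ.continuous_fderiv (by simp)).clm_apply continuous_const).integrable_of_hasCompactSupport
      (hc.fderiv_apply ℝ v)
  have h := integral_mul_fderiv_eq_neg_fderiv_mul_of_integrable
    (μ := (volume : Measure (EuclideanSpace ℝ (Fin m)))) (f := fun _ => (1 : ℝ)) (g := ψ) (v := v)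
    (by simp) (by simpa using hi)
    (by simpa using hψ.continuous.integrable_of_hasCompactSupport hc)
    (fun _ _ => differentiableAt_const _) (fun x _ => hψ.differentiable (by simp) x)
  simpa using h

section Density

variable {m k : ℕ} {S : Type*} [TopologicalSpace S] [ChartedSpace (EuclideanSpace ℝ (Fin m)) S]
  [IsManifold (𝓡 m) ∞ S]
  {V : Type*} [TopologicalSpace V] [ChartedSpace (EuclideanSpace ℝ (Fin k)) V]
  [IsManifold (𝓡 k) ∞ V] {g : PseudoRiemannianMetric k V} {F : S → V} {c p : S} {d : V}

lemma chartDensity_inducedMetric (hp : p ∈ (chartAt (EuclideanSpace ℝ (Fin m)) c).source)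
    (hd : F p ∈ (chartAt (EuclideanSpace ℝ (Fin k)) d).source)
    (hF : IsSpacelikeImmersion (m := m) g F) :
    chartDensity (inducedMetric (m := m) g F) c (extChartAt (𝓡 m) c p)
      = √(patchMetric (stdBasis m) (formChart g.inner d) (mapChart F c d)
        (extChartAt (𝓡 m) c p)).det := by
  rw [chartDensity_eq _ hp, ← gram_chartBasis hp hd (hF.contMDiff p)]
  rfl

lemma continuousOn_chartDensity (hF : IsSpacelikeImmersion (m := m) g F) (c : S) :
    ContinuousOn (chartDensity (inducedMetric (m := m) g F) c) (extChartAt (𝓡 m) c).target := by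
  intro y hy
  refine ContinuousAt.continuousWithinAt ?_
  obtain ⟨p, hp, rfl⟩ : ∃ p ∈ (chartAt (EuclideanSpace ℝ (Fin m)) c).source,
      extChartAt (𝓡 m) c p = y := ⟨_, symm_mem_source hy, (extChartAt (𝓡 m) c).right_inv hy⟩
  have hd : F p ∈ (chartAt (EuclideanSpace ℝ (Fin k)) (F p)).source := mem_chart_source _ _
  have hev : chartDensity (inducedMetric (m := m) g F) c =ᶠ[𝓝 (extChartAt (𝓡 m) c p)] fun y =>
      √(patchMetric (stdBasis m) (formChart g.inner (F p)) (mapChart F c (F p)) y).det := by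
    filter_upwards [target_mem_nhds hp, chart_preimage_mem_nhds hp
      (hF.contMDiff.continuous.continuousAt.preimage_mem_nhds
        ((chartAt (EuclideanSpace ℝ (Fin k)) (F p)).open_source.mem_nhds hd))] with x hx hx'
    have := chartDensity_inducedMetric (symm_mem_source hx) hx' hF
    rwa [(extChartAt (𝓡 m) c).right_inv hx] at this
  refine ContinuousAt.congr ?_ hev.symm
  have hu := contDiffAt_mapChart hp hd (hF.contMDiff p)
  have hU : ∀ v, ContDiffAt ℝ ∞ (fun x => fderiv ℝ (mapChart (k := k) F c (F p)) x v)
      (extChartAt (𝓡 m) c p) := fun v =>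
    (hu.fderiv_right (m := ∞) (by simp)).clm_apply contDiffAt_const
  have hG : ContDiffAt ℝ ∞ (fun x => formChart g.inner (F p) (mapChart F c (F p) x))
      (extChartAt (𝓡 m) c p) := by
    refine ContDiffAt.comp _ ((g.isMetricOn_formChart (F p)).contDiffAt ?_) hu
    rw [mapChart_extChartAt hp]
    exact extChartAt_mem_target hd
  exact (contDiffAt_matrix_det fun i j =>
    ((hG.clm_apply (hU _)).clm_apply (hU _))).continuousAt.sqrt

end Density

section IntegralFormula

variable {m : ℕ} {S : Type*} [TopologicalSpace S] [ChartedSpace (EuclideanSpace ℝ (Fin m)) S]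
  [IsManifold (𝓡 m) ∞ S]
  {V : Type*} [TopologicalSpace V] [ChartedSpace (EuclideanSpace ℝ (Fin (m + 2))) V]
  [IsManifold (𝓡 (m + 2)) ∞ V] {g : PseudoRiemannianMetric (m + 2) V}
  (D : CovariantDerivative (𝓡 (m + 2)) (EuclideanSpace ℝ (Fin (m + 2)))
    (TangentSpace (𝓡 (m + 2)) : V → Type _))
  (Q : TwoForm (m + 2) V) {F : S → V} (o : NormalOrientation (m := m) g F)
  (f : S → ℝ) (s : ℝ)

/-- The sum of the three integrands. -/
def totalIntegrand (p : S) : ℝ :=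
  (m : ℝ) / ((m : ℝ) + 1) * divergenceIntegrand D Q o f s p + normalIntegrand D Q o f p
    + gradientIntegrand D Q o f s p

variable {D Q o f s}

lemma totalIntegrand_add {f₁ f₂ : S → ℝ} (h₁ : ContMDiff (𝓡 m) 𝓘(ℝ, ℝ) ∞ f₁)
    (h₂ : ContMDiff (𝓡 m) 𝓘(ℝ, ℝ) ∞ f₂) (p : S) :
    totalIntegrand D Q o (f₁ + f₂) s p
      = totalIntegrand D Q o f₁ s p + totalIntegrand D Q o f₂ s p := by
  have hgrad : inducedGradient (m := m) g F (f₁ + f₂) p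
      = inducedGradient g F f₁ p + inducedGradient g F f₂ p := by
    have h := mvfderiv_add ((h₁ p).mdifferentiableAt (by simp))
      ((h₂ p).mdifferentiableAt (by simp))
    simp only [inducedGradient, h, sharp, _root_.add_apply, mul_add, add_smul,
      Finset.sum_add_distrib]
  have h3 : gradientIntegrand D Q o (f₁ + f₂) s p
      = gradientIntegrand D Q o f₁ s p + gradientIntegrand D Q o f₂ s p := by
    simp only [gradientIntegrand, hgrad, Pi.add_apply, mul_add, add_smul, map_add, _root_.add_apply]
    ring
  simp only [totalIntegrand, h3, divergenceIntegrand, normalIntegrand, Pi.add_apply]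
  ring

lemma totalIntegrand_eq_zero {p : S} (hp : p ∉ tsupport f) : totalIntegrand D Q o f s p = 0 := by
  have hev : f =ᶠ[𝓝 p] fun _ => (0 : ℝ) := notMem_tsupport_iff_eventuallyEq.1 hp
  have hd : mvfderiv (𝓡 m) f p = 0 := by
    rw [mvfderiv, hev.mfderiv_eq, mfderiv_const]
    rfl
  have hfp : f p = 0 := hev.eq_of_nhds
  simp [totalIntegrand, divergenceIntegrand, normalIntegrand, gradientIntegrand, inducedGradient,
    hd, hfp, sharp]

variable (hF : IsSpacelikeImmersion (m := m) g F) (hD : IsLeviCivita g D)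
  (hH : ∀ p : S, 0 < g.inner (F p) (meanCurvature (m := m) g D F p)
      (meanCurvature (m := m) g D F p)) (hf : ContMDiff (𝓡 m) 𝓘(ℝ, ℝ) ∞ f)
  (hQ : Q.IsConformalKillingYano g D)
include hF hD hH hf hQ

lemma continuous_totalIntegrand : Continuous (totalIntegrand D Q o f s) :=
  ((continuous_const.mul (continuous_divergenceIntegrand hF hD hH hf hQ)).add
    (continuous_normalIntegrand hF hD hH hf)).add (continuous_gradientIntegrand hF hD hH hf)

variable [CompactSpace S] [MeasurableSpace S] [BorelSpace S]

/-- The integral formula for functions supported in one patch. -/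
lemma integral_totalIntegrand_of_patch (hs : s ^ 2 = 1) {c : S} (hc : tsupport f ⊆ patchSet o c) :
    ∫ p, totalIntegrand D Q o f s p ∂riemannianVolume (inducedMetric (m := m) g F) = 0 := by
  -- The flux density, extended by zero from the patch to all of Euclidean space; its support lies in
  -- the compact image `K` of the support of `f`.
  obtain ⟨ψ, hψ⟩ : ∃ ψ : Fin m → EuclideanSpace ℝ (Fin m) → ℝ, ψ = fun i =>
    (patchDomain o c).indicator (fluxDensity Q o f s c i) := ⟨_, rfl⟩
  obtain ⟨K, hK⟩ : ∃ K, K = extChartAt (𝓡 m) c '' tsupport f := ⟨_, rfl⟩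
  have hKc : IsCompact K := by
    rw [hK]
    refine (isClosed_tsupport f).isCompact.image_of_continuousOn
      ((continuousOn_extChartAt c).mono fun p hp => ?_)
    rw [extChartAt_source]
    exact (hc hp).1
  have hKd : K ⊆ patchDomain o c := by
    rw [hK]
    rintro _ ⟨p, hp, rfl⟩
    exact extChartAt_mem_patchDomain o (hc hp)
  have hzero : ∀ i, ∀ y ∉ K, ψ i y = 0 := by
    intro i y hy
    rw [hψ]
    refine Set.indicator_apply_eq_zero.2 fun hyd => ?_
    obtain ⟨h1, h2⟩ := exists_mem_patchSet o hyd
    have : f ((extChartAt (𝓡 m) c).symm y) = 0 := by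
      refine image_eq_zero_of_notMem_tsupport fun h => hy ?_
      rw [hK]
      exact ⟨_, h, h2⟩
    simp only [fluxDensity, this, zero_mul, mul_zero, Finset.sum_const_zero]
  have hzero' : ∀ i, ∀ y ∉ K, ψ i =ᶠ[𝓝 y] fun _ => 0 := fun i y hy => by
    filter_upwards [hKc.isClosed.isOpen_compl.mem_nhds hy] with z hz using hzero i z hz
  have heq : ∀ i, ∀ y ∈ patchDomain o c, ψ i =ᶠ[𝓝 y] fluxDensity Q o f s c i := fun i y hy => by
    filter_upwards [(isOpen_patchDomain o hF c).mem_nhds hy] with z hz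
    rw [hψ]
    exact Set.indicator_of_mem hz _
  have hsmooth : ∀ i, ContDiff ℝ ∞ (ψ i) := fun i => contDiff_iff_contDiffAt.2 fun y => by
    by_cases hy : y ∈ K
    · obtain ⟨h1, h2⟩ := exists_mem_patchSet o (hKd hy)
      have := contDiffAt_fluxDensity hF hD h1 hH hf i (Q := Q) (s := s)
      rw [h2] at this
      exact this.congr_of_eventuallyEq (heq i y (hKd hy))
    · exact contDiffAt_const.congr_of_eventuallyEq (hzero' i y hy)
  have hcs : ∀ i, HasCompactSupport (ψ i) := fun i =>
    HasCompactSupport.intro hKc fun y hy => hzero i y hy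
  have hout : ∀ y ∉ K, ∑ i, fderiv ℝ (ψ i) y (stdBasis m i) = 0 := fun y hy =>
    Finset.sum_eq_zero fun i _ => by
      rw [(hzero' i y hy).fderiv_eq, fderiv_const_apply, _root_.zero_apply]
  have hsupp : ∀ p ∉ (chartAt (EuclideanSpace ℝ (Fin m)) c).source,
      totalIntegrand D Q o f s p = 0 := fun p hp =>
    totalIntegrand_eq_zero fun h => hp (hc h).1
  rw [integral_riemannianVolume (fun p => hF.isScalarProduct p) (continuousOn_chartDensity hF c)
    (continuous_totalIntegrand hF hD hH hf hQ) hsupp]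
  have h1 : ∫ y in (extChartAt (𝓡 m) c).target, chartDensity (inducedMetric (m := m) g F) c y *
      totalIntegrand D Q o f s ((extChartAt (𝓡 m) c).symm y)
      = ∫ y in (extChartAt (𝓡 m) c).target, ∑ i, fderiv ℝ (ψ i) y (stdBasis m i) := by
    refine setIntegral_congr_fun (isOpen_extChartAt_target c).measurableSet fun y hy => ?_
    by_cases hyd : y ∈ patchDomain o c
    · obtain ⟨h1, h2⟩ := exists_mem_patchSet o hyd
      have h3 := sum_fderiv_fluxDensity hF hD h1 hH hf hQ hs
      have h4 := chartDensity_inducedMetric h1.1 h1.2.1 hF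
      rw [h2] at h3 h4
      beta_reduce
      rw [h4, totalIntegrand, ← h3]
      exact Finset.sum_congr rfl fun i _ => by rw [(heq i y hyd).fderiv_eq]
    · beta_reduce
      rw [hout y fun h => hyd (hKd h), totalIntegrand_eq_zero, mul_zero]
      intro h
      have := extChartAt_mem_patchDomain o (hc h)
      rw [(extChartAt (𝓡 m) c).right_inv hy] at this
      exact hyd this
  rw [h1, setIntegral_eq_integral_of_forall_compl_eq_zero fun y hy =>
    hout y fun h => hy (hKd h).1, integral_finsetSum _ fun i _ => ?_]
  · exact Finset.sum_eq_zero fun i _ => integral_fderiv_eq_zero (hsmooth i) (hcs i) _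
  · exact (((hsmooth i).continuous_fderiv (by simp)).clm_apply
      continuous_const).integrable_of_hasCompactSupport ((hcs i).fderiv_apply ℝ _)

omit hf in
/-- The integral formula in general: the integrand is additive in `f`, so a partition of unity
subordinate to the patches reduces to functions supported in one of them. -/
lemma integral_totalIntegrand [T2Space S] (hf : ContMDiff (𝓡 m) 𝓘(ℝ, ℝ) ∞ f) (hs : s ^ 2 = 1) :
    ∫ p, totalIntegrand D Q o f s p ∂riemannianVolume (inducedMetric (m := m) g F) = 0 := by
  have hfin : IsFiniteMeasure (riemannianVolume (inducedMetric (m := m) g F)) :=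
    isFiniteMeasure_riemannianVolume (fun p => hF.isScalarProduct p)
      fun c => continuousOn_chartDensity hF c
  obtain ⟨χ, hχ⟩ := SmoothPartitionOfUnity.exists_isSubordinate (𝓡 m)
    (isClosed_univ : IsClosed (Set.univ : Set S)) (patchSet o) (isOpen_patchSet o hF)
    fun p _ => Set.mem_iUnion_of_mem p (mem_patchSet_self o p)
  have hsm : ∀ c, ContMDiff (𝓡 m) 𝓘(ℝ, ℝ) ∞ fun p => χ c p * f p := fun c =>
    (χ c).contMDiff.mul hf
  have hfinite : {c | (Function.support (χ c)).Nonempty}.Finite :=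
    χ.locallyFinite.finite_nonempty_of_compact
  have key : ∀ t : Finset S, ContMDiff (𝓡 m) 𝓘(ℝ, ℝ) ∞ (∑ c ∈ t, fun p => χ c p * f p) ∧
      ∫ p, totalIntegrand D Q o (∑ c ∈ t, fun p => χ c p * f p) s p
        ∂riemannianVolume (inducedMetric (m := m) g F) = 0 := by
    classical
    intro t
    induction t using Finset.induction_on with
    | empty =>
      refine ⟨contMDiff_const (c := (0 : ℝ)), ?_⟩
      rw [Finset.sum_empty]
      refine integral_eq_zero_of_ae (Filter.Eventually.of_forall fun p => ?_)
      exact totalIntegrand_eq_zero (by simp [tsupport])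
    | insert c t hct ih =>
      rw [Finset.sum_insert hct]
      refine ⟨(hsm c).add ih.1, ?_⟩
      simp only [totalIntegrand_add (hsm c) ih.1]
      rw [integral_add
        ((continuous_totalIntegrand hF hD hH (hsm c) hQ).integrable_of_hasCompactSupport
          (HasCompactSupport.of_compactSpace _))
        ((continuous_totalIntegrand hF hD hH ih.1 hQ).integrable_of_hasCompactSupport
          (HasCompactSupport.of_compactSpace _)), ih.2, add_zero]
      exact integral_totalIntegrand_of_patch hF hD hH (hsm c) hQ hs
        ((tsupport_mul_subset_left).trans (hχ c))
  have hsum : f = ∑ c ∈ hfinite.toFinset, fun p => χ c p * f p := by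
    ext p
    rw [Finset.sum_apply, ← Finset.sum_mul]
    have h1 := χ.sum_eq_one (Set.mem_univ p)
    rw [finsum_eq_sum_of_support_subset (s := hfinite.toFinset)] at h1
    · rw [h1, one_mul]
    · intro c hc
      exact hfinite.mem_toFinset.2 ⟨p, hc⟩
  rw [hsum]
  exact (key _).2

end IntegralFormula

end

theorem theorem2p2 (m : ℕ)
    {V : Type*} [TopologicalSpace V] [ChartedSpace (EuclideanSpace ℝ (Fin (m + 2))) V]
    [IsManifold (𝓡 (m + 2)) ∞ V] [T2Space V]
    (g : PseudoRiemannianMetric (m + 2) V)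
    (D : CovariantDerivative (𝓡 (m + 2)) (EuclideanSpace ℝ (Fin (m + 2)))
      (TangentSpace (𝓡 (m + 2)) : V → Type _))
    (hD : IsLeviCivita g D)
    (Q : TwoForm (m + 2) V) (hQ : Q.IsConformalKillingYano g D)
    {S : Type*} [TopologicalSpace S] [ChartedSpace (EuclideanSpace ℝ (Fin m)) S]
    [IsManifold (𝓡 m) ∞ S] [T2Space S] [CompactSpace S] [MeasurableSpace S] [BorelSpace S]
    (F : S → V) (hF : IsSpacelikeImmersion (m := m) g F)
    (o : NormalOrientation (m := m) g F)
    (hH : ∀ p : S, 0 < g.inner (F p) (meanCurvature (m := m) g D F p)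
      (meanCurvature (m := m) g D F p))
    (f : S → ℝ) (hf : ContMDiff (𝓡 m) 𝓘(ℝ, ℝ) ∞ f) :
    ∀ s : ℝ, s = 1 ∨ s = -1 →
      Integrable (fun p => f p / meanCurvatureNorm m g D F p *
        g.inner (F p) (Q.divergence g D (F p))
          (s • meanCurvature (m := m) g D F p + o.reflectedMeanCurvature D p))
        (riemannianVolume (inducedMetric (m := m) g F)) ∧
      Integrable (fun p => f p / meanCurvatureNorm m g D F p *
        Q.form (F p) (meanCurvature (m := m) g D F p) (o.reflectedMeanCurvature D p))
        (riemannianVolume (inducedMetric (m := m) g F)) ∧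
      Integrable (fun p => 1 / meanCurvatureNorm m g D F p *
        Q.form (F p)
          (mfderiv (𝓡 m) (𝓡 (m + 2)) F p
            (inducedGradient g F f p + (s * f p) • o.connectionVector D p))
          (s • meanCurvature (m := m) g D F p + o.reflectedMeanCurvature D p))
        (riemannianVolume (inducedMetric (m := m) g F)) ∧
      (m : ℝ) / ((m : ℝ) + 1) * (∫ p, f p / meanCurvatureNorm m g D F p *
        g.inner (F p) (Q.divergence g D (F p))
          (s • meanCurvature (m := m) g D F p + o.reflectedMeanCurvature D p)
        ∂(riemannianVolume (inducedMetric (m := m) g F)))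
      + (∫ p, f p / meanCurvatureNorm m g D F p *
        Q.form (F p) (meanCurvature (m := m) g D F p) (o.reflectedMeanCurvature D p)
        ∂(riemannianVolume (inducedMetric (m := m) g F)))
      + (∫ p, 1 / meanCurvatureNorm m g D F p *
        Q.form (F p)
          (mfderiv (𝓡 m) (𝓡 (m + 2)) F p
            (inducedGradient g F f p + (s * f p) • o.connectionVector D p))
          (s • meanCurvature (m := m) g D F p + o.reflectedMeanCurvature D p)
        ∂(riemannianVolume (inducedMetric (m := m) g F)))
      = 0 := by
  intro s hs
  have hs2 : s ^ 2 = 1 := by rcases hs with rfl | rfl <;> norm_num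
  have hfin : IsFiniteMeasure (riemannianVolume (inducedMetric (m := m) g F)) :=
    isFiniteMeasure_riemannianVolume (fun p => hF.isScalarProduct p)
      fun c => continuousOn_chartDensity hF c
  have hint : ∀ {I : S → ℝ}, Continuous I →
      Integrable I (riemannianVolume (inducedMetric (m := m) g F)) := fun hI =>
    hI.integrable_of_hasCompactSupport (HasCompactSupport.of_compactSpace _)
  have h1 := hint (continuous_divergenceIntegrand (s := s) (o := o) hF hD hH hf hQ)
  have h2 := hint (continuous_normalIntegrand (Q := Q) (o := o) hF hD hH hf)
  have h3 := hint (continuous_gradientIntegrand (Q := Q) (s := s) (o := o) hF hD hH hf)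
  refine ⟨h1, h2, h3, ?_⟩
  have h := integral_totalIntegrand (o := o) (s := s) hF hD hH hQ hf hs2
  have h4 : ∫ p, totalIntegrand D Q o f s p ∂riemannianVolume (inducedMetric (m := m) g F) = _ :=
    (integral_add ((h1.const_mul ((m : ℝ) / ((m : ℝ) + 1))).add h2) h3).trans
      (congrArg (· + _) (integral_add (h1.const_mul ((m : ℝ) / ((m : ℝ) + 1))) h2))
  rw [integral_const_mul] at h4
  exact h4.symm.trans h
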